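/- Let $\mathbb{F}$ be an algebraically closed field of arbitrary characteristic, let $n\ge 1$, and let $A$ be a nilpotent $n\times n$ matrix over $\mathbb{F}$. Let $C(A)$ be the centralizer of $A$ in $M_n(\mathbb{F})$, and let $$D_2(A)=\{(B,C)\in C(A)\times C(A) : BC=CB,\ B \text{ and } C \text{ are nilpotent},\ \dim_{\mathbb{F}} \mathbb{F}[A,B]=n\},$$ where $\mathbb{F}[A,B]$ is the unital subalgebra of $M_n(\mathbb{F})$ generated by $A$ and $B$. Let $\overline{D_2(A)}$ be the closure of $D_2(A)$ in the Zariski topology of $M_n(\mathbb{F})\times M_n(\mathbb{F})=\mathbb{F}^{2n^2}$. Then $\overline{D_2(A)}$ is irreducible, and its dimension is $$\dim \overline{D_2(A)}=\dim_{\mathbb{F}} C(A)-\dim_{\mathbb{F}}\ker A+n-1 .$$ -/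

import Mathlib

/-- The Zariski topology on the affine space `F^σ`: the closed sets are exactly the sets of common
zeros of families of polynomials. -/
@[reducible]
def zariskiTopology (F : Type*) [Field F] (σ : Type*) : TopologicalSpace (σ → F) :=
  TopologicalSpace.ofClosed
    {Z | ∃ I : Ideal (MvPolynomial σ F), Z = MvPolynomial.zeroLocus F I}
    ⟨⊤, by simp⟩
    (by
      intro 𝒜 h𝒜
      refine ⟨sSup {I : Ideal (MvPolynomial σ F) | MvPolynomial.zeroLocus F I ∈ 𝒜}, ?_⟩
      ext x
      have key : x ∈ MvPolynomial.zeroLocus F (sSup {I : Ideal (MvPolynomial σ F) | MvPolynomial.zeroLocus F I ∈ 𝒜}) ↔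
          sSup {I : Ideal (MvPolynomial σ F) | MvPolynomial.zeroLocus F I ∈ 𝒜} ≤
            MvPolynomial.vanishingIdeal F ({x} : Set (σ → F)) := by
        rw [← MvPolynomial.le_zeroLocus_iff_le_vanishingIdeal]
        simp
      rw [key, sSup_le_iff, Set.mem_sInter]
      constructor
      · intro h I hI
        rw [← MvPolynomial.le_zeroLocus_iff_le_vanishingIdeal]
        simpa using h _ hI
      · intro h Z hZ
        obtain ⟨I, rfl⟩ := h𝒜 hZ
        have := h I hZ
        rw [← MvPolynomial.le_zeroLocus_iff_le_vanishingIdeal] at this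
        simpa using this)
    (by
      rintro _ ⟨I, rfl⟩ _ ⟨J, rfl⟩
      refine ⟨I * J, ?_⟩
      ext x
      rw [Set.mem_union, MvPolynomial.mem_zeroLocus_iff, MvPolynomial.mem_zeroLocus_iff,
        MvPolynomial.mem_zeroLocus_iff]
      constructor
      · intro hx p hp
        rcases hx with h | h
        · exact h p ((Ideal.mul_le_inf hp).1)
        · exact h p ((Ideal.mul_le_inf hp).2)
      · intro h
        by_contra hx
        simp only [not_or, not_forall] at hx
        obtain ⟨⟨p, hp, hpx⟩, ⟨q, hq, hqx⟩⟩ := hx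
        have := h _ (Ideal.mul_mem_mul hp hq)
        rw [map_mul] at this
        exact (mul_ne_zero hpx hqx) this)

/-- Pairs `(B, C)` of `n × n` matrices over `F`, the points of the affine space `F^(2n²)`. -/
@[ext]
structure MatrixPair (F : Type*) (n : ℕ) where
  /-- the first matrix -/
  B : Matrix (Fin n) (Fin n) F
  /-- the second matrix -/
  C : Matrix (Fin n) (Fin n) F

/-- The `2n²` coordinates (matrix entries) of a pair of matrices. -/
def MatrixPair.coords {F : Type*} {n : ℕ} (P : MatrixPair F n) :
    (Fin n × Fin n) ⊕ (Fin n × Fin n) → F :=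
  Sum.elim (fun ij => P.B ij.1 ij.2) (fun ij => P.C ij.1 ij.2)

/-- The Zariski topology on pairs of matrices, i.e. that of `F^(2n²)` under the identification
of a pair with its entries. -/
instance MatrixPair.instTopologicalSpace (F : Type*) [Field F] (n : ℕ) :
    TopologicalSpace (MatrixPair F n) :=
  TopologicalSpace.induced MatrixPair.coords (zariskiTopology F _)

/-- The centralizer `C(A)` of a matrix in the algebra of `n × n` matrices. -/
abbrev matrixCentralizer {F : Type*} [Field F] {n : ℕ} (A : Matrix (Fin n) (Fin n) F) :
    Subalgebra F (Matrix (Fin n) (Fin n) F) :=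
  Subalgebra.centralizer F {A}

/-- `N₂(A)`: pairs of commuting nilpotent matrices in the centralizer of `A`. -/
def N₂ {F : Type*} [Field F] {n : ℕ} (A : Matrix (Fin n) (Fin n) F) : Set (MatrixPair F n) :=
  {P | P.B ∈ matrixCentralizer A ∧ P.C ∈ matrixCentralizer A ∧ P.B * P.C = P.C * P.B ∧
    IsNilpotent P.B ∧ IsNilpotent P.C}

/-- `D₂(A)`: the pairs `(B, C)` in `N₂(A)` such that the unital algebra `F[A, B]` has
dimension `n`. -/
def D₂ {F : Type*} [Field F] {n : ℕ} (A : Matrix (Fin n) (Fin n) F) : Set (MatrixPair F n) :=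
  {P ∈ N₂ A | Module.finrank F (Algebra.adjoin F ({A, P.B} : Set (Matrix (Fin n) (Fin n) F))) = n}

/-! The proof rests on Gerstenhaber's theorem: two commuting nilpotent n × n matrices generate an
algebra of dimension at most n. It also needs the equality case: if dim F[A, B] = n, every matrix
commuting with A and B lies in F[A, B]. Both are proved for a module V over a commutative algebra S
generated by two elements x, y acting nilpotently. With t = dim V / xV, the determinant trick puts y
^ t in Ann V + (x), and induction along V ⊇ xV ⊇ x²V ⊇ ... gives the bound
(`finrank_quotient_annihilator_le`). Under equality V or its dual is cyclic (`cyclic_or_cocyclic`),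
and either property makes every S-endomorphism of V a multiplication.

Hence a pair in D₂(A) consists of a nilpotent B in C(A) with dim F[A, B] = n and a polynomial C in A
and B without constant term. The nilpotent B form the image of an affine space
(`exists_nilpotent_parametrization`). Indeed C(A) acts on V / AV, now with V = F^n, nilpotency is
detected there, and each nilpotent B equals g m g⁻¹ with g, m in C(A) and m strictly upper
triangular on V / AV; an adjugate in place of g⁻¹ makes this polynomial. So D₂(A) lies in the image
of a polynomial map and contains the image of a nonempty principal open set, which gives
irreducibility.

For the dimension, fix n monomials in A and B, one of them 1, that are linearly independent for some
nilpotent B. Where they are independent, Cramer's rule recovers the coefficients of C, so the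
closure of D₂(A) has the dimension of N × F^(n-1), with N the nilpotent cone of C(A). Put t = dim
ker A = dim V / AV. The cone N is cut out by t equations, the lower coefficients of the
characteristic polynomial on V / AV, so dim N ≥ dim C(A) - t. Conversely, t diagonal coordinates are
integral over the remaining ones on N, so dim N ≤ dim C(A) - t. -/

/-! ### Gerstenhaber's bound for two-generated algebras -/

section TwoGenerated

variable {F S V : Type*} [Field F] [CommRing S] [Algebra F S] [AddCommGroup V] [Module F V]
  [Module S V] [IsScalarTower F S V]

/-- The submodule `x V` of an `S`-module `V`. -/
abbrev smulRange (V : Type*) [AddCommGroup V] [Module S V] (x : S) : Submodule S V :=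
  LinearMap.range (LinearMap.lsmul S V x)

/-- The kernel of multiplication by `x` on `V`. -/
abbrev smulKer (V : Type*) [AddCommGroup V] [Module S V] (x : S) : Submodule S V :=
  LinearMap.ker (LinearMap.lsmul S V x)

theorem smul_mem_smulRange (x : S) (v : V) : x • v ∈ smulRange V x := ⟨v, rfl⟩

/-- Nakayama's lemma for a nilpotent x: iterating V = N + xV gives V = N + x^j V for every j. -/
theorem Submodule.eq_top_of_sup_smulRange_eq_top {x : S} (hx : ∃ k : ℕ, ∀ v : V, x ^ k • v = 0)
    (N : Submodule S V) (h : N ⊔ smulRange V x = ⊤) : N = ⊤ := by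
  obtain ⟨k, hk⟩ := hx
  have key : ∀ j : ℕ, ∀ v : V, ∃ w : V, v - x ^ j • w ∈ N := by
    intro j
    induction j with
    | zero => intro v; exact ⟨v, by simp⟩
    | succ j ih =>
      intro v
      obtain ⟨w, hw⟩ := ih v
      have hw' : w ∈ N ⊔ smulRange V x := h ▸ Submodule.mem_top
      obtain ⟨a, ha, b, ⟨u, rfl⟩, hab⟩ := Submodule.mem_sup.1 hw'
      refine ⟨u, ?_⟩
      have : v - x ^ (j + 1) • u = (v - x ^ j • w) + x ^ j • a := by
        rw [← hab, LinearMap.lsmul_apply, smul_add, pow_succ, mul_smul]; abel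
      rw [this]
      exact N.add_mem hw (N.smul_mem _ ha)
  refine (Submodule.eq_top_iff').2 fun v => ?_
  obtain ⟨w, hw⟩ := key k v
  simpa [hk] using hw

theorem Matrix.det_smul_eq_zero_of_sum_smul_eq_zero {ι : Type*} [Fintype ι] [DecidableEq ι]
    (N : Matrix ι ι S) (e : ι → V) (h : ∀ i, ∑ j, N i j • e j = 0) (k : ι) :
    N.det • e k = 0 := by
  have h1 : ∑ j, (N.adjugate * N) k j • e j = 0 := by
    simp only [Matrix.mul_apply, Finset.sum_smul, mul_smul]
    rw [Finset.sum_comm]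
    simp only [← Finset.smul_sum, h, smul_zero, Finset.sum_const_zero]
  rw [Matrix.adjugate_mul] at h1
  simpa [Matrix.one_apply, ite_smul] using h1

/-- Determinant trick. A basis of V / xV lifts to generators e of V by Nakayama. On them y acts as C
+ xm, where C is the matrix of y on V / xV, so the determinant of y - C - xm kills V. Modulo x that
determinant is the characteristic polynomial of the nilpotent C evaluated at y, namely y ^ t. -/
theorem exists_pow_smul_eq_smul_smul [FiniteDimensional F V] {x y : S}
    (hx : ∃ k : ℕ, ∀ v : V, x ^ k • v = 0) (hy : ∃ k : ℕ, ∀ v : V, y ^ k • v = 0) :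
    ∃ s : S, ∀ v : V, y ^ (Module.finrank F (V ⧸ smulRange V x)) • v = x • s • v := by
  classical
  set t := Module.finrank F (V ⧸ smulRange V x) with ht
  let b : Module.Basis (Fin t) F (V ⧸ smulRange V x) := Module.finBasis F _
  choose e he using fun i => Submodule.Quotient.mk_surjective (smulRange V x) (b i)
  have hq : ∀ c : Fin t → F, (Submodule.Quotient.mk (∑ i, algebraMap F S (c i) • e i) :
      V ⧸ smulRange V x) = ∑ i, c i • b i := by
    intro c
    rw [← Submodule.mkQ_apply, map_sum]
    refine Finset.sum_congr rfl fun i _ => ?_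
    rw [algebraMap_smul, Submodule.mkQ_apply, Submodule.Quotient.mk_smul, he]
  have hspan : Submodule.span S (Set.range e) = ⊤ := by
    apply Submodule.eq_top_of_sup_smulRange_eq_top hx
    refine (Submodule.eq_top_iff').2 fun v => ?_
    have h1 : v - ∑ i, algebraMap F S (b.repr (Submodule.Quotient.mk v) i) • e i
        ∈ smulRange V x := by
      rw [← Submodule.Quotient.mk_eq_zero, Submodule.Quotient.mk_sub, sub_eq_zero, hq]
      exact (b.sum_repr _).symm
    rw [← sub_add_cancel v (∑ i, algebraMap F S (b.repr (Submodule.Quotient.mk v) i) • e i),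
      add_comm]
    exact Submodule.add_mem_sup (Submodule.sum_mem _ fun i _ =>
      Submodule.smul_mem _ _ (Submodule.subset_span ⟨i, rfl⟩)) h1
  let f : Module.End F (V ⧸ smulRange V x) :=
    (LinearMap.lsmul S (V ⧸ smulRange V x) y).restrictScalars F
  have hf : IsNilpotent f := by
    obtain ⟨k, hk⟩ := hy
    refine ⟨k, LinearMap.ext fun v => ?_⟩
    obtain ⟨v, rfl⟩ := Submodule.Quotient.mk_surjective _ v
    have : ∀ j : ℕ, (f ^ j) (Submodule.Quotient.mk v) =
        Submodule.Quotient.mk (y ^ j • v) := by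
      intro j
      induction j with
      | zero => simp
      | succ j ih => rw [pow_succ', Module.End.mul_apply, ih, pow_succ', mul_smul]; rfl
    rw [this, hk]; rfl
  let C : Matrix (Fin t) (Fin t) F := LinearMap.toMatrix b b f
  have hC : C.charpoly = Polynomial.X ^ t := by
    rw [LinearMap.charpoly_toMatrix]
    exact hf.charpoly_eq_X_pow_finrank
  have hM : ∀ j, ∃ m : Fin t → S,
      y • e j = ∑ i, (algebraMap F S (C i j) + x * m i) • e i := by
    intro j
    have h1 : y • e j - ∑ i, algebraMap F S (C i j) • e i ∈ smulRange V x := by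
      rw [← Submodule.Quotient.mk_eq_zero, Submodule.Quotient.mk_sub, sub_eq_zero, hq]
      have := b.sum_repr (f (b j))
      simp only [C, LinearMap.toMatrix_apply]
      rw [this, ← he]; rfl
    obtain ⟨w, hw⟩ := h1
    have hw' : w ∈ Submodule.span S (Set.range e) := hspan ▸ Submodule.mem_top
    obtain ⟨m, rfl⟩ := (Submodule.mem_span_range_iff_exists_fun S).1 hw'
    refine ⟨m, ?_⟩
    simp only [add_smul, Finset.sum_add_distrib, mul_smul, ← Finset.smul_sum]
    rw [LinearMap.lsmul_apply] at hw
    rw [hw]; abel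
  choose m hm using hM
  let N : Matrix (Fin t) (Fin t) S := Matrix.of fun j i =>
    (if j = i then y else 0) - (algebraMap F S (C i j) + x * m j i)
  have hN : ∀ j, ∑ i, N j i • e i = 0 := by
    intro j
    simp only [N, Matrix.of_apply, sub_smul, Finset.sum_sub_distrib, ← hm, ite_smul, zero_smul]
    simp
  have hdet : N.det - y ^ t ∈ Ideal.span {x} := by
    rw [← Ideal.Quotient.eq]
    let q := Ideal.Quotient.mk (Ideal.span {x})
    have hqx : q x = 0 := Ideal.Quotient.eq_zero_iff_mem.2 (Ideal.mem_span_singleton_self x)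
    change q _ = q _
    rw [RingHom.map_det]
    -- Modulo x the correction terms `m` disappear.
    have h2 : q.mapMatrix N = (Matrix.scalar (Fin t) (q y) -
        C.map (q.comp (algebraMap F S))).transpose := by
      ext j i
      simp only [N, Matrix.of_apply, RingHom.mapMatrix_apply, Matrix.map_apply, map_sub, map_add, map_mul, hqx,
        zero_mul, add_zero, Matrix.transpose_apply, Matrix.sub_apply, RingHom.comp_apply,
        Matrix.scalar_apply, Matrix.diagonal_apply, eq_comm (a := i)]
      split_ifs <;> simp
    rw [h2, Matrix.det_transpose, ← Matrix.eval_charpoly, Matrix.charpoly_map, hC]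
    simp
  obtain ⟨s, hs⟩ := Ideal.mem_span_singleton'.1 hdet
  have hkill : ∀ v : V, N.det • v = 0 := by
    intro v
    have hv : v ∈ Submodule.span S (Set.range e) := hspan ▸ Submodule.mem_top
    obtain ⟨c, rfl⟩ := (Submodule.mem_span_range_iff_exists_fun S).1 hv
    rw [Finset.smul_sum]
    refine Finset.sum_eq_zero fun i _ => ?_
    rw [smul_comm, Matrix.det_smul_eq_zero_of_sum_smul_eq_zero N e hN, smul_zero]
  refine ⟨-s, fun v => ?_⟩
  have h3 : y ^ t = N.det - s * x := by rw [hs]; ring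
  rw [h3, sub_smul, hkill, neg_smul, smul_neg, ← mul_smul, mul_comm x s]; simp

/-- Since x vanishes in S / J, this quotient is generated by y alone and spanned by 1, y, ..., y ^
(m - 1). -/
theorem finrank_quotient_le_of_pow_mem {x y : S} (hS : Algebra.adjoin F {x, y} = ⊤)
    (J : Ideal S) (hxJ : x ∈ J) {m : ℕ} (hy : y ^ m ∈ J) :
    Module.finrank F (S ⧸ J) ≤ m := by
  let g : Polynomial.degreeLT F m →ₗ[F] S ⧸ J :=
    (Polynomial.aeval (Ideal.Quotient.mk J y)).toLinearMap ∘ₗ (Polynomial.degreeLT F m).subtype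
  have hg : Function.Surjective g := by
    intro z
    have hz : z ∈ (Polynomial.aeval (R := F) (Ideal.Quotient.mk J y)).range := by
      obtain ⟨s, rfl⟩ := Ideal.Quotient.mk_surjective z
      have hs : s ∈ Algebra.adjoin F {x, y} := hS ▸ Algebra.mem_top
      have hle : Algebra.adjoin F {x, y} ≤
          (Polynomial.aeval (R := F) (Ideal.Quotient.mk J y)).range.comap
            (Ideal.Quotient.mkₐ F J) := by
        rw [Algebra.adjoin_le_iff]
        rintro a (rfl | rfl)
        · refine ⟨0, ?_⟩
          simpa using (Ideal.Quotient.eq_zero_iff_mem.2 hxJ).symm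
        · exact ⟨Polynomial.X, by simp⟩
      exact hle hs
    obtain ⟨p, rfl⟩ := hz
    refine ⟨⟨p %ₘ Polynomial.X ^ m, ?_⟩, ?_⟩
    · rw [Polynomial.mem_degreeLT]
      have := Polynomial.degree_modByMonic_lt p (Polynomial.monic_X_pow (R := F) m)
      rwa [Polynomial.degree_X_pow] at this
    · have h0 : (Ideal.Quotient.mk J y) ^ m = 0 := by
        rw [← map_pow]; exact Ideal.Quotient.eq_zero_iff_mem.2 hy
      conv_rhs => rw [← Polynomial.modByMonic_add_div p (Polynomial.X ^ m)]
      simp [g, h0]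
  have : FiniteDimensional F (Polynomial.degreeLT F m) :=
    (Polynomial.degreeLTEquiv F m).symm.finiteDimensional
  have h1 := LinearMap.finrank_le_finrank_of_surjective (f := g) hg
  rwa [(Polynomial.degreeLTEquiv F m).finrank_eq, Module.finrank_fin_fun] at h1

theorem finiteDimensional_quotient_annihilator [FiniteDimensional F V] :
    FiniteDimensional F (S ⧸ Module.annihilator S V) := by
  let g : S →ₗ[F] Module.End F V := (Algebra.lsmul F F V : S →ₐ[F] Module.End F V).toLinearMap
  have hg : ∀ s : S, s ∈ Module.annihilator S V ↔ g s = 0 := by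
    intro s
    rw [Module.mem_annihilator, LinearMap.ext_iff]; rfl
  let g' : (S ⧸ Module.annihilator S V) →ₗ[F] Module.End F V :=
    ((Module.annihilator S V).restrictScalars F).liftQ g fun s hs => (hg s).1 hs
  refine FiniteDimensional.of_injective g' ?_
  rw [← LinearMap.ker_eq_bot, LinearMap.ker_eq_bot']
  intro z hz
  obtain ⟨s, rfl⟩ := Ideal.Quotient.mk_surjective z
  exact Ideal.Quotient.eq_zero_iff_mem.2 ((hg s).2 hz)

/-- Multiplication by x gives an exact sequence 0 → S / Ann(xV) → S / Ann V → S / (Ann V + (x)) → 0,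
because s kills xV exactly when xs kills V. -/
theorem finrank_quotient_annihilator_eq_add [FiniteDimensional F V] (x : S) :
    Module.finrank F (S ⧸ Module.annihilator S V) =
      Module.finrank F (S ⧸ Module.annihilator S (smulRange V x)) +
      Module.finrank F (S ⧸ (Module.annihilator S V ⊔ Ideal.span {x})) := by
  have hfd : FiniteDimensional F (S ⧸ Module.annihilator S V) :=
    finiteDimensional_quotient_annihilator
  have hx : ∀ s : S, s ∈ Module.annihilator S (smulRange V x) ↔
      x * s ∈ Module.annihilator S V := by
    intro s
    rw [Module.mem_annihilator, Module.mem_annihilator]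
    constructor
    · intro h v
      have := congrArg Subtype.val (h ⟨x • v, smul_mem_smulRange x v⟩)
      rw [mul_comm, mul_smul]; exact this
    · rintro h ⟨_, v, rfl⟩
      apply Subtype.ext
      have := h v
      rw [mul_comm, mul_smul] at this; exact this
  let p : (S ⧸ Module.annihilator S V) →ₗ[F] (S ⧸ (Module.annihilator S V ⊔ Ideal.span {x})) :=
    (Ideal.Quotient.factorₐ F (le_sup_left)).toLinearMap
  have hp : Function.Surjective p := Ideal.Quotient.factor_surjective le_sup_left
  let μ : (S ⧸ Module.annihilator S (smulRange V x)) →ₗ[F] (S ⧸ Module.annihilator S V) :=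
    (((Module.annihilator S (smulRange V x)).liftQ
      ((Module.annihilator S V).mkQ ∘ₗ LinearMap.lsmul S S x) (by
        intro s hs
        rw [LinearMap.mem_ker, LinearMap.comp_apply, Submodule.mkQ_apply,
          Submodule.Quotient.mk_eq_zero]
        exact (hx s).1 hs)) : _ →ₗ[S] _).restrictScalars F
  have hμ : ∀ s, μ (Ideal.Quotient.mk _ s) = Ideal.Quotient.mk _ (x * s) := fun s => rfl
  have hμi : Function.Injective μ := by
    rw [← LinearMap.ker_eq_bot, LinearMap.ker_eq_bot']
    intro z hz
    obtain ⟨s, rfl⟩ := Ideal.Quotient.mk_surjective z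
    rw [hμ] at hz
    exact Ideal.Quotient.eq_zero_iff_mem.2 ((hx s).2 (Ideal.Quotient.eq_zero_iff_mem.1 hz))
  have hker : LinearMap.ker p = LinearMap.range μ := by
    ext z
    obtain ⟨s, rfl⟩ := Ideal.Quotient.mk_surjective z
    rw [LinearMap.mem_ker]
    change Ideal.Quotient.mk _ s = 0 ↔ _
    rw [Ideal.Quotient.eq_zero_iff_mem, Submodule.mem_sup]
    constructor
    · rintro ⟨a, ha, c, hc, rfl⟩
      obtain ⟨d, rfl⟩ := Ideal.mem_span_singleton'.1 hc
      refine ⟨Ideal.Quotient.mk _ d, ?_⟩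
      rw [hμ, Ideal.Quotient.eq]
      have : x * d - (a + d * x) = -a := by ring
      rw [this]; exact neg_mem ha
    · rintro ⟨z, hz⟩
      obtain ⟨d, rfl⟩ := Ideal.Quotient.mk_surjective z
      rw [hμ, Ideal.Quotient.eq] at hz
      exact ⟨s - x * d, by rw [← neg_mem_iff, neg_sub]; exact hz, x * d,
        Ideal.mul_mem_right _ _ (Ideal.mem_span_singleton_self x), by ring⟩
  have h1 := LinearMap.finrank_range_add_finrank_ker p
  rw [hker, LinearMap.finrank_range_of_inj hμi, LinearMap.range_eq_top.2 hp, finrank_top] at h1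
  omega

instance finiteDimensional_smulRange [FiniteDimensional F V] (x : S) :
    FiniteDimensional F (smulRange V x) :=
  inferInstanceAs (FiniteDimensional F ((smulRange V x).restrictScalars F))

theorem finrank_smulRange_add_finrank_quotient [FiniteDimensional F V] (x : S) :
    Module.finrank F (smulRange V x) + Module.finrank F (V ⧸ smulRange V x) =
      Module.finrank F V := by
  have := Submodule.finrank_quotient_add_finrank ((smulRange V x).restrictScalars F)
  rw [add_comm]; exact this

theorem finrank_smulKer [FiniteDimensional F V] (x : S) :
    Module.finrank F (smulKer V x) = Module.finrank F (V ⧸ smulRange V x) := by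
  have h1 := LinearMap.finrank_range_add_finrank_ker ((LinearMap.lsmul S V x).restrictScalars F)
  have h2 := finrank_smulRange_add_finrank_quotient (F := F) (V := V) x
  have h3 : Module.finrank F (LinearMap.ker ((LinearMap.lsmul S V x).restrictScalars F)) =
    Module.finrank F (smulKer V x) := rfl
  have h4 : Module.finrank F (LinearMap.range ((LinearMap.lsmul S V x).restrictScalars F)) =
    Module.finrank F (smulRange V x) := rfl
  omega

theorem exists_pow_smul_eq_zero_submodule {x : S} (hx : ∃ k : ℕ, ∀ v : V, x ^ k • v = 0)
    (N : Submodule S V) : ∃ k : ℕ, ∀ v : N, x ^ k • v = 0 := by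
  obtain ⟨k, hk⟩ := hx
  exact ⟨k, fun v => Subtype.ext (hk v)⟩

theorem finrank_pos_of_smul_nilpotent [FiniteDimensional F V] [Nontrivial V] {x : S}
    (hx : ∃ k : ℕ, ∀ v : V, x ^ k • v = 0) :
    0 < Module.finrank F (V ⧸ smulRange V x) := by
  rw [Module.finrank_pos_iff, Submodule.Quotient.nontrivial_iff]
  intro h
  have := Submodule.eq_top_of_sup_smulRange_eq_top hx ⊥ (by rw [h]; simp)
  exact bot_ne_top this

theorem finrank_smulRange_lt [FiniteDimensional F V] [Nontrivial V] {x : S}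
    (hx : ∃ k : ℕ, ∀ v : V, x ^ k • v = 0) :
    Module.finrank F (smulRange V x) < Module.finrank F V := by
  have h1 := finrank_smulRange_add_finrank_quotient (F := F) (V := V) x
  have h2 := finrank_pos_of_smul_nilpotent (F := F) hx
  omega

theorem pow_finrank_mem_annihilator_sup [FiniteDimensional F V] {x y : S}
    (hx : ∃ k : ℕ, ∀ v : V, x ^ k • v = 0) (hy : ∃ k : ℕ, ∀ v : V, y ^ k • v = 0) :
    y ^ (Module.finrank F (V ⧸ smulRange V x)) ∈ Module.annihilator S V ⊔ Ideal.span {x} := by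
  obtain ⟨s, hs⟩ := exists_pow_smul_eq_smul_smul (F := F) hx hy
  refine Submodule.mem_sup.2 ⟨_, ?_, x * s,
    Ideal.mul_mem_right _ _ (Ideal.mem_span_singleton_self x), sub_add_cancel _ (x * s)⟩
  rw [Module.mem_annihilator]
  intro v
  rw [sub_smul, hs, mul_smul, sub_self]

/-- **Gerstenhaber's bound** for modules over a two-generated algebra, both generators acting
nilpotently. -/
theorem finrank_quotient_annihilator_le [FiniteDimensional F V] {x y : S}
    (hS : Algebra.adjoin F {x, y} = ⊤)
    (hx : ∃ k : ℕ, ∀ v : V, x ^ k • v = 0) (hy : ∃ k : ℕ, ∀ v : V, y ^ k • v = 0) :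
    Module.finrank F (S ⧸ Module.annihilator S V) ≤ Module.finrank F V := by
  induction hn : Module.finrank F V using Nat.strong_induction_on generalizing V with
  | _ n ih =>
    subst hn
    rcases subsingleton_or_nontrivial V with hV | hV
    · have : Module.annihilator S V = ⊤ := Module.annihilator_eq_top_iff.2 hV
      rw [this]
      have : Subsingleton (S ⧸ (⊤ : Ideal S)) := Ideal.Quotient.subsingleton_iff.2 rfl
      rw [Module.finrank_zero_of_subsingleton]; exact Nat.zero_le _
    · have h1 := ih _ (finrank_smulRange_lt (F := F) hx)
        (exists_pow_smul_eq_zero_submodule hx _) (exists_pow_smul_eq_zero_submodule hy _) rfl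
      have h2 := finrank_quotient_le_of_pow_mem hS _
        (Ideal.mem_sup_right (Ideal.mem_span_singleton_self x))
        (pow_finrank_mem_annihilator_sup (F := F) hx hy)
      -- Both sides split along x and are compared termwise: xV by induction, V / xV by the
      -- determinant trick.
      rw [finrank_quotient_annihilator_eq_add (V := V) x,
        ← finrank_smulRange_add_finrank_quotient (F := F) (V := V) x]
      exact add_le_add h1 h2

end TwoGenerated

/-! ### Vectors generating a single nilpotent Jordan block -/

section NilpotentOrbit

variable {F T : Type*} [Field F] [AddCommGroup T] [Module F T]

/-- If i is the lowest index with nonzero coefficient, f ^ (m - 1 - i) moves that term to the top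
power and kills all later ones. -/
theorem exists_pow_apply_sum_eq_smul {f : Module.End F T} {m : ℕ} (hf : f ^ m = 0) (w : T)
    (c : Fin m → F) (hc : c ≠ 0) :
    ∃ (j : ℕ) (a : F), a ≠ 0 ∧ (f ^ j) (∑ i, c i • (f ^ (i : ℕ)) w) = a • (f ^ (m - 1)) w := by
  classical
  obtain ⟨i, hi, hmin⟩ : ∃ i, c i ≠ 0 ∧ ∀ l < i, c l = 0 := by
    have hne : (Finset.univ.filter fun i => c i ≠ 0).Nonempty := by
      obtain ⟨i, hi⟩ := Function.ne_iff.1 hc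
      exact ⟨i, by simpa using hi⟩
    refine ⟨_, (Finset.mem_filter.1 (Finset.min'_mem _ hne)).2, fun l hl => ?_⟩
    by_contra h
    exact absurd (Finset.min'_le _ l (by simpa using h)) (not_le.2 hl)
  refine ⟨m - 1 - i, c i, hi, ?_⟩
  rw [map_sum, Finset.sum_eq_single i]
  · rw [map_smul, ← Module.End.mul_apply, ← pow_add]
    congr 3; omega
  · intro l _ hl
    rw [map_smul, ← Module.End.mul_apply, ← pow_add]
    rcases lt_or_gt_of_ne hl with h | h
    · rw [hmin l h, zero_smul]
    · have : m ≤ m - 1 - (i : ℕ) + (l : ℕ) := by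
        have : (i : ℕ) < (l : ℕ) := h
        omega
      rw [pow_eq_zero_of_le this hf]; simp
  · simp

theorem span_pow_apply_eq_top [FiniteDimensional F T] {f : Module.End F T} (hf : IsNilpotent f)
    {w : T} (hw : (f ^ (Module.finrank F T - 1)) w ≠ 0) :
    Submodule.span F (Set.range fun i : Fin (Module.finrank F T) => (f ^ (i : ℕ)) w) = ⊤ := by
  have hf' : f ^ Module.finrank F T = 0 := by
    have h1 := LinearMap.aeval_self_charpoly f
    rw [hf.charpoly_eq_X_pow_finrank] at h1
    simpa using h1
  refine LinearIndependent.span_eq_top_of_card_eq_finrank' ?_ (by simp)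
  rw [Fintype.linearIndependent_iff]
  intro c hc i
  by_contra hi
  obtain ⟨j, a, ha, h⟩ := exists_pow_apply_sum_eq_smul hf' w c (fun h => hi (congrFun h i))
  rw [hc, map_zero] at h
  exact (smul_ne_zero ha hw) h.symm

/-- Here T is one Jordan block, so every nonzero f-stable subspace contains its socle, the line of f
^ (dim T - 1) w. -/
theorem exists_pow_apply_eq_smul [FiniteDimensional F T] {f : Module.End F T} (hf : IsNilpotent f)
    {w : T} (hw : (f ^ (Module.finrank F T - 1)) w ≠ 0) {u : T} (hu : u ≠ 0) :
    ∃ (j : ℕ) (a : F), a ≠ 0 ∧ (f ^ j) u = a • (f ^ (Module.finrank F T - 1)) w := by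
  have hf' : f ^ Module.finrank F T = 0 := by
    have h1 := LinearMap.aeval_self_charpoly f
    rw [hf.charpoly_eq_X_pow_finrank] at h1
    simpa using h1
  have h1 : u ∈ Submodule.span F
      (Set.range fun i : Fin (Module.finrank F T) => (f ^ (i : ℕ)) w) :=
    span_pow_apply_eq_top hf hw ▸ Submodule.mem_top
  obtain ⟨c, rfl⟩ := (Submodule.mem_span_range_iff_exists_fun F).1 h1
  refine exists_pow_apply_sum_eq_smul hf' w c ?_
  rintro rfl
  exact hu (by simp)

end NilpotentOrbit

/-! ### The equality case: cyclic and dually cyclic modules -/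

section TwoGenerated

variable {F S V : Type*} [Field F] [CommRing S] [Algebra F S] [AddCommGroup V] [Module F V]
  [Module S V] [IsScalarTower F S V]

/-- Multiplication by `y`, as an `F`-linear endomorphism. -/
abbrev smulEnd (F V : Type*) [Field F] [Algebra F S] [AddCommGroup V] [Module F V]
    [Module S V] [IsScalarTower F S V] (y : S) : Module.End F V :=
  (LinearMap.lsmul S V y).restrictScalars F

theorem smulEnd_pow_apply (y : S) (j : ℕ) (v : V) : (smulEnd F V y ^ j) v = y ^ j • v := by
  induction j with
  | zero => simp
  | succ j ih => rw [pow_succ', Module.End.mul_apply, ih, pow_succ', mul_smul]; rfl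

theorem isNilpotent_smulEnd {y : S} (hy : ∃ k : ℕ, ∀ v : V, y ^ k • v = 0) :
    IsNilpotent (smulEnd F V y) := by
  obtain ⟨k, hk⟩ := hy
  exact ⟨k, LinearMap.ext fun v => by rw [smulEnd_pow_apply, hk]; rfl⟩

theorem exists_pow_smul_eq_zero_quotient {y : S} (hy : ∃ k : ℕ, ∀ v : V, y ^ k • v = 0)
    (N : Submodule S V) : ∃ k : ℕ, ∀ v : V ⧸ N, y ^ k • v = 0 := by
  obtain ⟨k, hk⟩ := hy
  refine ⟨k, fun v => ?_⟩
  obtain ⟨v, rfl⟩ := Submodule.Quotient.mk_surjective _ v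
  rw [← Submodule.Quotient.mk_smul, hk, Submodule.Quotient.mk_zero]

/-- The hypothesis makes V / xV a single Jordan block for y generated by the class of v. By Nakayama
V = Sv, and f is determined by f v = s v. -/
theorem exists_smul_eq_of_cyclic [FiniteDimensional F V] {x y : S}
    (hx : ∃ k : ℕ, ∀ v : V, x ^ k • v = 0) (hy : ∃ k : ℕ, ∀ v : V, y ^ k • v = 0)
    {v : V} (hv : y ^ (Module.finrank F (V ⧸ smulRange V x) - 1) • v ∉ smulRange V x)
    (f : Module.End S V) : ∃ s : S, ∀ u, f u = s • u := by
  have hspan : Submodule.span S {v} = ⊤ := by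
    apply Submodule.eq_top_of_sup_smulRange_eq_top hx
    have hnil := isNilpotent_smulEnd (F := F) (exists_pow_smul_eq_zero_quotient hy (smulRange V x))
    have h0 : ((smulEnd F (V ⧸ smulRange V x) y) ^
        (Module.finrank F (V ⧸ smulRange V x) - 1)) (Submodule.Quotient.mk v) ≠ 0 := by
      rw [smulEnd_pow_apply, ← Submodule.Quotient.mk_smul]
      rwa [Ne, Submodule.Quotient.mk_eq_zero]
    have h1 := span_pow_apply_eq_top hnil h0
    refine (Submodule.eq_top_iff').2 fun u => ?_
    have h2 : (Submodule.Quotient.mk u : V ⧸ smulRange V x) ∈ Submodule.span F _ :=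
      h1 ▸ Submodule.mem_top
    obtain ⟨c, hc⟩ := (Submodule.mem_span_range_iff_exists_fun F).1 h2
    simp only [smulEnd_pow_apply] at hc
    have h3 : u - (∑ i, algebraMap F S (c i) * y ^ (i : ℕ)) • v ∈ smulRange V x := by
      rw [← Submodule.Quotient.mk_eq_zero, Submodule.Quotient.mk_sub, sub_eq_zero, ← hc,
        Submodule.Quotient.mk_smul, Finset.sum_smul]
      simp only [mul_smul, algebraMap_smul]
    rw [← sub_add_cancel u ((∑ i, algebraMap F S (c i) * y ^ (i : ℕ)) • v), add_comm]
    exact Submodule.add_mem_sup (Submodule.smul_mem _ _ (Submodule.mem_span_singleton_self v)) h3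
  have hall : ∀ u : V, ∃ s : S, s • v = u := fun u =>
    Submodule.mem_span_singleton.1 (hspan ▸ Submodule.mem_top)
  obtain ⟨s, hs⟩ := hall (f v)
  refine ⟨s, fun u => ?_⟩
  obtain ⟨r, rfl⟩ := hall u
  rw [map_smul, ← hs, smul_comm]

/-- Dual to the cyclic case. As dim ker x = dim V / xV, the kernel of x is a single Jordan block for
y. Every nonzero submodule of V meets ker x, hence contains its socle. A functional φ nonzero on
that socle therefore vanishes on no nonzero submodule, so φ generates the dual of V over S, and φ ∘
f = φ(s ·) forces f to be multiplication by s. -/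
theorem exists_smul_eq_of_cocyclic [FiniteDimensional F V] {x y : S}
    (hx : ∃ k : ℕ, ∀ v : V, x ^ k • v = 0) (hy : ∃ k : ℕ, ∀ v : V, y ^ k • v = 0)
    {w : V} (hw : x • w = 0) (hyw : y ^ (Module.finrank F (V ⧸ smulRange V x) - 1) • w ≠ 0)
    (f : Module.End S V) : ∃ s : S, ∀ u, f u = s • u := by
  have hfd : FiniteDimensional F (smulKer V x) :=
    inferInstanceAs (FiniteDimensional F ((smulKer V x).restrictScalars F))
  obtain ⟨φ, hφ⟩ : ∃ φ : Module.Dual F V,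
      φ (y ^ (Module.finrank F (V ⧸ smulRange V x) - 1) • w) ≠ 0 := by
    by_contra! h
    exact hyw ((Module.forall_dual_apply_eq_zero_iff F _).1 h)
  have hco : ∀ v : V, (∀ s : S, φ (s • v) = 0) → v = 0 := by
    intro v hv
    by_contra hv0
    -- A power of x moves v into ker x; a power of y then moves it onto the socle.
    obtain ⟨j, hj0, hj⟩ : ∃ j : ℕ, x ^ j • v ≠ 0 ∧ x ^ (j + 1) • v = 0 := by
      classical
      obtain ⟨k, hk⟩ := hx
      have hex : ∃ k, x ^ k • v = 0 := ⟨k, hk v⟩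
      have hpos : Nat.find hex ≠ 0 := by
        intro h
        have := Nat.find_spec hex
        rw [h] at this
        exact hv0 (by simpa using this)
      obtain ⟨j, hj⟩ := Nat.exists_eq_succ_of_ne_zero hpos
      exact ⟨j, Nat.find_min hex (by omega), by have := Nat.find_spec hex; rwa [hj] at this⟩
    have hmem : x ^ j • v ∈ smulKer V x := by
      rw [LinearMap.mem_ker, LinearMap.lsmul_apply, ← mul_smul, ← pow_succ', hj]
    have hnil := isNilpotent_smulEnd (F := F) (exists_pow_smul_eq_zero_submodule hy (smulKer V x))
    have hwm : w ∈ smulKer V x := hw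
    have h0 : ((smulEnd F (smulKer V x) y) ^
        (Module.finrank F (smulKer V x) - 1)) ⟨w, hwm⟩ ≠ 0 := by
      rw [smulEnd_pow_apply, finrank_smulKer]
      intro h
      exact hyw (congrArg Subtype.val h)
    have hu : (⟨x ^ j • v, hmem⟩ : smulKer V x) ≠ 0 := fun h => hj0 (congrArg Subtype.val h)
    obtain ⟨l, a, ha, h⟩ := exists_pow_apply_eq_smul hnil h0 hu
    rw [smulEnd_pow_apply, smulEnd_pow_apply, finrank_smulKer] at h
    have h' : y ^ l • x ^ j • v =
      a • y ^ (Module.finrank F (V ⧸ smulRange V x) - 1) • w := congrArg Subtype.val h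
    have h2 := hv (y ^ l * x ^ j)
    rw [mul_smul, h', map_smul] at h2
    exact (smul_ne_zero ha hφ) h2
  let g : S →ₗ[F] Module.Dual F V :=
    { toFun := fun s => φ ∘ₗ smulEnd F V s
      map_add' := fun a b => by ext v; simp
      map_smul' := fun a b => by ext v; simp }
  have hg : LinearMap.range g = ⊤ := by
    rw [← Subspace.dualCoannihilator_dualAnnihilator_eq (W := LinearMap.range g)]
    have : (LinearMap.range g).dualCoannihilator = ⊥ := by
      rw [eq_bot_iff]
      intro v hv
      rw [Submodule.mem_dualCoannihilator] at hv
      exact hco v fun s => hv (g s) ⟨s, rfl⟩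
    rw [this]; simp
  obtain ⟨s, hs⟩ : (φ ∘ₗ f.restrictScalars F) ∈ LinearMap.range g := hg ▸ Submodule.mem_top
  refine ⟨s, fun u => ?_⟩
  rw [← sub_eq_zero]
  refine hco _ fun r => ?_
  have := LinearMap.congr_fun hs (r • u)
  have h1 : φ (s • r • u) = φ (f (r • u)) := this
  rw [smul_sub, map_sub, ← map_smul, ← h1, smul_comm, sub_self]

/-- Equality in a sum of two inequalities makes each of them sharp. -/
theorem eq_of_finrank_annihilator_eq [FiniteDimensional F V] {x y : S}
    (hS : Algebra.adjoin F {x, y} = ⊤)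
    (hx : ∃ k : ℕ, ∀ v : V, x ^ k • v = 0) (hy : ∃ k : ℕ, ∀ v : V, y ^ k • v = 0)
    (h : Module.finrank F (S ⧸ Module.annihilator S V) = Module.finrank F V) :
    Module.finrank F (S ⧸ Module.annihilator S (smulRange V x)) =
      Module.finrank F (smulRange V x) ∧
    Module.finrank F (S ⧸ (Module.annihilator S V ⊔ Ideal.span {x})) =
      Module.finrank F (V ⧸ smulRange V x) := by
  have h1 := finrank_quotient_annihilator_le (F := F) (V := smulRange V x) hS
    (exists_pow_smul_eq_zero_submodule hx _) (exists_pow_smul_eq_zero_submodule hy _)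
  have h2 := finrank_quotient_le_of_pow_mem hS _
    (Ideal.mem_sup_right (Ideal.mem_span_singleton_self x))
    (pow_finrank_mem_annihilator_sup (F := F) hx hy)
  have h3 := finrank_quotient_annihilator_eq_add (F := F) (V := V) x
  have h4 := finrank_smulRange_add_finrank_quotient (F := F) (V := V) x
  omega

/-- If the quotient acting faithfully on `V` has the same dimension as `V`, then `V` is cyclic or
its dual is cyclic, expressed through the action of `y` on `V / x V` and on the kernel of `x`. -/
theorem cyclic_or_cocyclic [FiniteDimensional F V] [Nontrivial V] {x y : S}
    (hS : Algebra.adjoin F {x, y} = ⊤)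
    (hx : ∃ k : ℕ, ∀ v : V, x ^ k • v = 0) (hy : ∃ k : ℕ, ∀ v : V, y ^ k • v = 0)
    (h : Module.finrank F (S ⧸ Module.annihilator S V) = Module.finrank F V) :
    (∃ v : V, y ^ (Module.finrank F (V ⧸ smulRange V x) - 1) • v ∉ smulRange V x) ∨
    (∃ v : V, x • v = 0 ∧ y ^ (Module.finrank F (V ⧸ smulRange V x) - 1) • v ≠ 0) := by
  induction hn : Module.finrank F V using Nat.strong_induction_on generalizing V with
  | _ n ih =>
  subst hn
  by_contra! hcon
  obtain ⟨hc1, hc2⟩ := hcon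
  obtain ⟨e1, e2⟩ := eq_of_finrank_annihilator_eq hS hx hy h
  set t := Module.finrank F (V ⧸ smulRange V x) with ht
  have htpos : 0 < t := finrank_pos_of_smul_nilpotent hx
  have hx' := exists_pow_smul_eq_zero_submodule hx (smulRange V x)
  have hy' := exists_pow_smul_eq_zero_submodule hy (smulRange V x)
  -- Sharpness forbids the exponent t - 1, which would bound dim S / (Ann V + (x)) by t - 1.
  have hnot : y ^ (t - 1) ∉ Module.annihilator S V ⊔ Ideal.span {x} := by
    intro hmem
    have := finrank_quotient_le_of_pow_mem hS _
      (Ideal.mem_sup_right (Ideal.mem_span_singleton_self x)) hmem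
    omega
  obtain ⟨t', ht'⟩ : ∃ t', t' = Module.finrank F (smulRange V x ⧸ smulRange (smulRange V x) x) :=
    ⟨_, rfl⟩
  -- Both cokernel dimensions are kernel dimensions, and the kernel of x on xV lies in ker x.
  have hle : t' ≤ t := by
    rw [ht', ht, ← finrank_smulKer, ← finrank_smulKer]
    have hfd : FiniteDimensional F (smulKer V x) :=
      inferInstanceAs (FiniteDimensional F ((smulKer V x).restrictScalars F))
    let ι : smulKer (smulRange V x) x →ₗ[F] smulKer V x :=
      { toFun := fun v => ⟨v.1.1, congrArg Subtype.val v.2⟩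
        map_add' := fun _ _ => rfl
        map_smul' := fun _ _ => rfl }
    refine LinearMap.finrank_le_finrank_of_injective (f := ι) fun a b hab => ?_
    exact Subtype.ext (Subtype.ext (congrArg (fun z => z.1) hab))
  rcases subsingleton_or_nontrivial (smulRange V x) with hsub | hnt
  · apply hnot
    apply Ideal.mem_sup_left
    rw [Module.mem_annihilator]
    intro v
    have : (⟨_, hc1 v⟩ : smulRange V x) = 0 := Subsingleton.elim _ _
    exact congrArg Subtype.val this
  have hQ := ih _ (finrank_smulRange_lt (F := F) hx) hx' hy' e1 rfl
  -- For t' = t, the failure of both alternatives on V passes directly to xV, against the induction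
  -- hypothesis.
  rcases hle.eq_or_lt with heq | hlt
  · rw [← ht', heq] at hQ
    rcases hQ with ⟨⟨_, u, rfl⟩, hv⟩ | ⟨v, hv, hyv⟩
    · apply hv
      obtain ⟨u', hu'⟩ := hc1 u
      refine ⟨⟨x • u', smul_mem_smulRange x u'⟩, Subtype.ext ?_⟩
      change x • x • u' = y ^ (t - 1) • x • u
      rw [LinearMap.lsmul_apply] at hu'
      rw [hu', smul_comm]
    · apply hyv
      exact Subtype.ext (hc2 v.1 (congrArg Subtype.val hv))
  · have hE : ∀ f : Module.End S (smulRange V x), ∃ s : S, ∀ u, f u = s • u := by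
      rcases hQ with ⟨v, hv⟩ | ⟨v, hv, hyv⟩
      · exact exists_smul_eq_of_cyclic (F := F) hx' hy' hv
      · exact exists_smul_eq_of_cocyclic (F := F) hx' hy' hv hyv
    obtain ⟨r, hr⟩ := exists_pow_smul_eq_smul_smul (F := F) hx' hy'
    rw [← ht'] at hr
    -- Congruent to y ^ (t - 1) modulo x, so it suffices to show a ∈ Ann V + (x).
    let a : S := y ^ (t - 1) - x * (r * y ^ (t - 1 - t'))
    have ha : ∀ v : V, a • v = y ^ (t - 1) • v - x • (r * y ^ (t - 1 - t')) • v := fun v => by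
      rw [sub_smul, mul_smul x]
    have hax : ∀ v : V, a • x • v = 0 := by
      intro v
      have h1 : y ^ t' • x • v = x • r • x • v :=
        congrArg Subtype.val (hr ⟨x • v, smul_mem_smulRange x v⟩)
      have h2 : y ^ (t - 1) = y ^ (t - 1 - t') * y ^ t' := by
        rw [← pow_add]; congr 1; omega
      rw [ha, h2, mul_smul, h1, mul_comm r, mul_smul, smul_comm x (y ^ _), sub_self]
    have hamem : ∀ v : V, a • v ∈ smulRange V x := fun v => by
      rw [ha]
      exact Submodule.sub_mem _ (hc1 v) (smul_mem_smulRange _ _)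
    have haker : smulKer V x ≤ LinearMap.ker
        ((LinearMap.lsmul S V a).codRestrict (smulRange V x) hamem) := by
      intro v hv
      have hv' : x • v = 0 := hv
      rw [LinearMap.mem_ker]
      apply Subtype.ext
      change a • v = 0
      rw [ha, hc2 v hv', smul_comm x, hv', smul_zero, sub_zero]
    -- As a kills ker x and maps V into xV, the rule xv ↦ av defines an endomorphism of xV. It is
    -- multiplication by some s, so a - sx kills V, contradicting `hnot`.
    let g : Module.End S (smulRange V x) :=
      ((smulKer V x).liftQ _ haker) ∘ₗ
        (LinearMap.lsmul S V x).quotKerEquivRange.symm.toLinearMap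
    have hg : ∀ v : V, (g ⟨x • v, smul_mem_smulRange x v⟩ : V) = a • v := by
      intro v
      have h1 : (LinearMap.lsmul S V x).quotKerEquivRange.symm ⟨x • v, smul_mem_smulRange x v⟩ =
          Submodule.Quotient.mk v := by
        rw [LinearEquiv.symm_apply_eq]; rfl
      simp only [g, LinearMap.comp_apply, LinearEquiv.coe_coe, h1]
      rfl
    obtain ⟨s, hs⟩ := hE g
    apply hnot
    refine Submodule.mem_sup.2 ⟨a - s * x, ?_, x * (r * y ^ (t - 1 - t') + s),
      Ideal.mul_mem_right _ _ (Ideal.mem_span_singleton_self x), by simp only [a]; ring⟩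
    rw [Module.mem_annihilator]
    intro v
    rw [sub_smul, ← hg, hs, mul_smul]
    exact sub_self _

theorem exists_smul_eq_of_finrank_eq [FiniteDimensional F V] {x y : S}
    (hS : Algebra.adjoin F {x, y} = ⊤)
    (hx : ∃ k : ℕ, ∀ v : V, x ^ k • v = 0) (hy : ∃ k : ℕ, ∀ v : V, y ^ k • v = 0)
    (h : Module.finrank F (S ⧸ Module.annihilator S V) = Module.finrank F V)
    (f : Module.End S V) : ∃ s : S, ∀ u, f u = s • u := by
  rcases subsingleton_or_nontrivial V with hV | hV
  · exact ⟨0, fun u => Subsingleton.elim _ _⟩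
  · rcases cyclic_or_cocyclic hS hx hy h with ⟨v, hv⟩ | ⟨v, hv, hyv⟩
    · exact exists_smul_eq_of_cyclic (F := F) hx hy hv f
    · exact exists_smul_eq_of_cocyclic (F := F) hx hy hv hyv f

end TwoGenerated

/-! ### Gerstenhaber's theorem for commuting nilpotent matrices -/

section Matrix

variable {F : Type*} [Field F] {n : ℕ}

/-- Through ρ the space F^n becomes a faithful S-module, and a matrix commuting with the image of ρ
is an S-endomorphism of it. -/
theorem finrank_le_and_mem_range_of_injective {S : Type*} [CommRing S] [Algebra F S]
    (ρ : S →ₐ[F] Matrix (Fin n) (Fin n) F) (hρ : Function.Injective ρ) {x y : S}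
    (hS : Algebra.adjoin F {x, y} = ⊤) (hx : IsNilpotent x) (hy : IsNilpotent y) :
    Module.finrank F S ≤ n ∧ (Module.finrank F S = n →
      ∀ C : Matrix (Fin n) (Fin n) F, (∀ s, Commute (ρ s) C) → C ∈ ρ.range) := by
  let act : Module S (Fin n → F) := Module.compHom (Fin n → F)
    ((Matrix.toLinAlgEquiv' (R := F) (n := Fin n)).toAlgHom.comp ρ).toRingHom
  have hact : ∀ (r : S) (v : Fin n → F), r • v = (ρ r).mulVec v := fun r v => rfl
  have : IsScalarTower F S (Fin n → F) := ⟨fun a r v => by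
    rw [hact, hact, map_smul]; exact Matrix.smul_mulVec _ _ _⟩
  have hext : ∀ M N : Matrix (Fin n) (Fin n) F, (∀ v, M.mulVec v = N.mulVec v) → M = N :=
    fun M N h => Matrix.toLin'.injective (LinearMap.ext fun v => by simpa using h v)
  have hx' : ∃ k : ℕ, ∀ v : Fin n → F, x ^ k • v = 0 := by
    obtain ⟨k, hk⟩ := hx
    exact ⟨k, fun v => by rw [hk, zero_smul]⟩
  have hy' : ∃ k : ℕ, ∀ v : Fin n → F, y ^ k • v = 0 := by
    obtain ⟨k, hk⟩ := hy
    exact ⟨k, fun v => by rw [hk, zero_smul]⟩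
  have hann : Module.annihilator S (Fin n → F) = ⊥ := by
    rw [eq_bot_iff]
    intro r hr
    rw [Module.mem_annihilator] at hr
    rw [Ideal.mem_bot]
    apply hρ
    rw [map_zero]
    exact hext _ _ fun v => by rw [← hact, hr, Matrix.zero_mulVec]
  have hfin : Module.finrank F (S ⧸ Module.annihilator S (Fin n → F)) = Module.finrank F S := by
    rw [hann]
    exact (AlgEquiv.quotientBot F S).toLinearEquiv.finrank_eq
  have h1 := finrank_quotient_annihilator_le (F := F) (V := Fin n → F) hS hx' hy'
  rw [hfin, Module.finrank_fin_fun] at h1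
  refine ⟨h1, fun heq C hC => ?_⟩
  let f : Module.End S (Fin n → F) :=
    { toFun := fun v => C.mulVec v
      map_add' := fun v w => Matrix.mulVec_add _ _ _
      map_smul' := fun r v => by
        rw [hact, hact, Matrix.mulVec_mulVec, Matrix.mulVec_mulVec, RingHom.id_apply, (hC r).eq] }
  obtain ⟨s, hs⟩ := exists_smul_eq_of_finrank_eq (F := F) hS hx' hy'
    (by rw [hfin, Module.finrank_fin_fun]; exact heq) f
  exact ⟨s, hext _ _ fun v => (hs v).symm⟩

open scoped IsMulCommutative in
/-- For commuting nilpotent matrices `A`, `B`, the algebra `F[A, B]` has dimension at most `n`,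
and in case of equality it contains every matrix commuting with `A` and `B`. -/
theorem finrank_adjoin_pair_le_and_mem_of_commute {A B : Matrix (Fin n) (Fin n) F}
    (hAB : Commute A B) (hA : IsNilpotent A) (hB : IsNilpotent B) :
    Module.finrank F (Algebra.adjoin F ({A, B} : Set (Matrix (Fin n) (Fin n) F))) ≤ n ∧
    (Module.finrank F (Algebra.adjoin F ({A, B} : Set (Matrix (Fin n) (Fin n) F))) = n →
      ∀ C : Matrix (Fin n) (Fin n) F, Commute A C → Commute B C →
        C ∈ Algebra.adjoin F ({A, B} : Set (Matrix (Fin n) (Fin n) F))) := by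
  have hcomm : ∀ a ∈ ({A, B} : Set (Matrix (Fin n) (Fin n) F)), ∀ b ∈ ({A, B} : Set _),
      a * b = b * a := by
    rintro a (rfl | rfl) b (rfl | rfl)
    · rfl
    · exact hAB
    · exact hAB.symm
    · rfl
  let R := Algebra.adjoin F ({A, B} : Set (Matrix (Fin n) (Fin n) F))
  have : IsMulCommutative R := Algebra.isMulCommutative_adjoin F hcomm
  let x : R := ⟨A, Algebra.subset_adjoin (by simp)⟩
  let y : R := ⟨B, Algebra.subset_adjoin (by simp)⟩
  have hS : Algebra.adjoin F ({x, y} : Set R) = ⊤ := by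
    apply Subalgebra.map_injective (f := R.val) Subtype.val_injective
    rw [AlgHom.map_adjoin, Algebra.map_top, Subalgebra.range_val, Set.image_pair]
    rfl
  have hx : IsNilpotent x := by
    obtain ⟨k, hk⟩ := hA
    exact ⟨k, Subtype.ext hk⟩
  have hy : IsNilpotent y := by
    obtain ⟨k, hk⟩ := hB
    exact ⟨k, Subtype.ext hk⟩
  obtain ⟨h1, h2⟩ := finrank_le_and_mem_range_of_injective R.val Subtype.val_injective hS
    (x := x) (y := y) hx hy
  refine ⟨h1, fun heq C hAC hBC => ?_⟩
  have hR : R ≤ Subalgebra.centralizer F {C} := by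
    rw [Algebra.adjoin_le_iff]
    rintro a (rfl | rfl)
    · rw [SetLike.mem_coe, Subalgebra.mem_centralizer_iff]
      rintro _ rfl; exact hAC.symm
    · rw [SetLike.mem_coe, Subalgebra.mem_centralizer_iff]
      rintro _ rfl; exact hBC.symm
  have := h2 heq C fun s => by
    have h3 := hR s.2
    rw [Subalgebra.mem_centralizer_iff] at h3
    exact (h3 C rfl).symm
  rwa [Subalgebra.range_val] at this

end Matrix

/-! ### Jordan chains and the action of the centralizer on V / f V -/

section Jordan

theorem DFinsupp.basis_apply {ι R : Type*} [DecidableEq ι] [Semiring R] {η : ι → Type*}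
    {M : ι → Type*} [∀ i, AddCommMonoid (M i)] [∀ i, Module R (M i)]
    (b : ∀ i, Module.Basis (η i) R (M i)) (i : ι) (j : η i) :
    DFinsupp.basis b ⟨i, j⟩ = DFinsupp.single i (b i j) := by
  classical
  rw [DFinsupp.basis, Module.Basis.coe_ofRepr, LinearEquiv.symm_apply_eq, LinearEquiv.trans_apply,
    LinearEquiv.eq_symm_apply, DFinsupp.mapRange.linearEquiv_apply]
  change sigmaFinsuppEquivDFinsupp _ = _
  rw [sigmaFinsuppEquivDFinsupp_single]
  simp [DFinsupp.mapRange_single]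

-- With X acting as f, the F[X]-module V is X-power torsion, so it is a direct sum of modules F[X] /
-- (X ^ k i), each with the powers of X as a basis. Summands with k i = 0 are still allowed.
open Polynomial DirectSum in
theorem exists_jordan_family_aux {F V : Type*} [Field F] [AddCommGroup V] [Module F V]
    [FiniteDimensional F V] {f : Module.End F V} (hf : IsNilpotent f) :
    ∃ (d : ℕ) (l : Fin d → ℕ) (e : Fin d → V), (∀ i, (f ^ l i) (e i) = 0) ∧
      LinearIndependent F (fun p : Σ i, Fin (l i) => (f ^ (p.2 : ℕ)) (e p.1)) ∧
      Submodule.span F (Set.range fun p : Σ i, Fin (l i) => (f ^ (p.2 : ℕ)) (e p.1)) = ⊤ := by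
  classical
  let M := Module.AEval' f
  have hX : ∀ (j : ℕ) (v : V), (X : F[X]) ^ j • Module.AEval'.of f v =
      Module.AEval'.of f ((f ^ j) v) := by
    intro j
    induction j with
    | zero => intro v; simp
    | succ j ih => intro v; rw [pow_succ, mul_smul, Module.AEval'.X_smul_of, ih]; rw [pow_succ]; rfl
  have htors : Module.IsTorsion' M (Submonoid.powers (X : F[X])) := by
    intro m
    obtain ⟨v, rfl⟩ := (Module.AEval'.of f).surjective m
    obtain ⟨k, hk⟩ := hf
    refine ⟨⟨X ^ k, k, rfl⟩, ?_⟩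
    change (X : F[X]) ^ k • Module.AEval'.of f v = 0
    rw [hX, hk]; simp
  have hfin : Module.Finite F M := Module.Finite.equiv (Module.AEval'.of f)
  have : Module.Finite F[X] M := Module.Finite.of_restrictScalars_finite F F[X] M
  obtain ⟨d, k, ⟨φ⟩⟩ := Module.torsion_by_prime_power_decomposition
    (Polynomial.irreducible_X (R := F)) htors
  let pb : ∀ i, PowerBasis F (AdjoinRoot ((X : F[X]) ^ k i)) :=
    fun i => AdjoinRoot.powerBasis' (monic_X_pow (k i))
  let b0 : ∀ i, Module.Basis (Fin (pb i).dim) F (F[X] ⧸ (Submodule.span F[X] {(X : F[X]) ^ k i})) :=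
    fun i => (pb i).basis
  let B : Module.Basis (Σ i, Fin (pb i).dim) F
    (⨁ i : Fin d, F[X] ⧸ (Submodule.span F[X] {(X : F[X]) ^ k i})) := DFinsupp.basis b0
  let ψ : V ≃ₗ[F] (⨁ i : Fin d, F[X] ⧸ (Submodule.span F[X] {(X : F[X]) ^ k i})) :=
    (Module.AEval'.of f).trans (φ.restrictScalars F)
  let e : Fin d → V := fun i => ψ.symm (DirectSum.lof F[X] _ _ i (Submodule.Quotient.mk 1))
  have he : ∀ i (j : ℕ), ψ ((f ^ j) (e i)) =
      DirectSum.lof F[X] (Fin d) (fun i => F[X] ⧸ (Submodule.span F[X] {(X : F[X]) ^ k i})) i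
        (Submodule.Quotient.mk (X ^ j)) := by
    intro i j
    have h1 : ψ ((f ^ j) (e i)) = (X : F[X]) ^ j • ψ (e i) := by
      change φ (Module.AEval'.of f ((f ^ j) (e i))) = _
      rw [← hX, map_smul]; rfl
    rw [h1, LinearEquiv.apply_symm_apply, ← map_smul, ← Submodule.Quotient.mk_smul, smul_eq_mul,
      mul_one]
  have hB : ∀ p : Σ i, Fin (pb i).dim, (B.map ψ.symm) p = (f ^ (p.2 : ℕ)) (e p.1) := by
    rintro ⟨i, j⟩
    rw [Module.Basis.map_apply, LinearEquiv.symm_apply_eq, he]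
    change DFinsupp.basis b0 ⟨i, j⟩ = _
    rw [DFinsupp.basis_apply]
    have h1 : b0 i j = Submodule.Quotient.mk (X ^ (j : ℕ)) := (pb i).basis_eq_pow j
    rw [h1]; rfl
  refine ⟨d, fun i => (pb i).dim, e, fun i => ?_, ?_, ?_⟩
  · apply ψ.injective
    rw [he, map_zero]
    have : (pb i).dim = k i := by simp [pb]
    beta_reduce
    rw [this, (Submodule.Quotient.mk_eq_zero _).2 (Submodule.mem_span_singleton_self _), map_zero]
  · have := (B.map ψ.symm).linearIndependent
    rwa [funext hB] at this
  · have := (B.map ψ.symm).span_eq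
    rwa [funext hB] at this

/-- Empty chains are discarded and the others sorted. The ordering ensures that f ^ l i kills e j
for all j ≤ i, on which the triangular constructions depend. -/
theorem exists_jordan_family {F V : Type*} [Field F] [AddCommGroup V] [Module F V]
    [FiniteDimensional F V] {f : Module.End F V} (hf : IsNilpotent f) :
    ∃ (t : ℕ) (l : Fin t → ℕ) (e : Fin t → V), (∀ i, 0 < l i) ∧ Monotone l ∧
      (∀ i, (f ^ l i) (e i) = 0) ∧
      LinearIndependent F (fun p : Σ i, Fin (l i) => (f ^ (p.2 : ℕ)) (e p.1)) ∧
      Submodule.span F (Set.range fun p : Σ i, Fin (l i) => (f ^ (p.2 : ℕ)) (e p.1)) = ⊤ := by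
  classical
  obtain ⟨d, l, e, h1, h2, h3⟩ := exists_jordan_family_aux hf
  let t := Fintype.card {i // 0 < l i}
  let σ₀ : Fin t ≃ {i // 0 < l i} := (Fintype.equivFin _).symm
  let σ : Fin t ≃ {i // 0 < l i} := (Tuple.sort fun i => l (σ₀ i)).trans σ₀
  let g : (Σ i : Fin t, Fin (l (σ i))) → Σ i, Fin (l i) := fun p => ⟨σ p.1, p.2⟩
  have hg : Function.Injective g := by
    rintro ⟨i, j⟩ ⟨i', j'⟩ h
    simp only [g, Sigma.mk.injEq] at h
    obtain ⟨h, h'⟩ := h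
    obtain rfl := σ.injective (Subtype.ext h)
    simpa using h'
  have hg' : Function.Surjective g := by
    rintro ⟨i, j⟩
    have hi : 0 < l i := lt_of_le_of_lt (Nat.zero_le _) j.2
    obtain ⟨i', hi'⟩ := σ.surjective ⟨i, hi⟩
    obtain rfl : (σ i' : Fin d) = i := by rw [hi']
    exact ⟨⟨i', j⟩, rfl⟩
  refine ⟨t, fun i => l (σ i), fun i => e (σ i), fun i => (σ i).2,
    Tuple.monotone_sort fun i => l (σ₀ i), fun i => h1 _, h2.comp g hg, ?_⟩
  rw [← h3, ← hg'.range_comp]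
  rfl

theorem Matrix.isNilpotent_of_strictly_upper_triangular {F : Type*} [Field F] {t : ℕ}
    {M : Matrix (Fin t) (Fin t) F} (hM : ∀ i j, j ≤ i → M i j = 0) : IsNilpotent M := by
  have h1 : M.charpoly = Polynomial.X ^ t := by
    rw [Matrix.charpoly_of_isUpperTriangular M fun i j hij => hM i j (le_of_lt hij)]
    simp [hM]
  have h2 := M.aeval_self_charpoly
  rw [h1] at h2
  exact ⟨t, by simpa using h2⟩

/-- Jordan chains of an endomorphism `f`: chains starting at `e i` of length `l i`, the lengths
weakly increasing, whose members form a basis. -/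
structure JordanFamily {F V : Type*} [Field F] [AddCommGroup V] [Module F V]
    (f : Module.End F V) (t : ℕ) where
  /-- the lengths of the chains -/
  l : Fin t → ℕ
  /-- the generators of the chains -/
  e : Fin t → V
  pos : ∀ i, 0 < l i
  mono : Monotone l
  pow_eq_zero : ∀ i, (f ^ l i) (e i) = 0
  /-- the basis consisting of the members of the chains -/
  basis : Module.Basis (Σ i, Fin (l i)) F V
  basis_apply : ∀ p, basis p = (f ^ (p.2 : ℕ)) (e p.1)

namespace JordanFamily

variable {F V : Type*} [Field F] [AddCommGroup V] [Module F V] {f : Module.End F V} {t : ℕ}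

theorem exists_of_isNilpotent [FiniteDimensional F V] (hf : IsNilpotent f) :
    ∃ t, Nonempty (JordanFamily f t) := by
  obtain ⟨t, l, e, h1, h2, h3, h4, h5⟩ := exists_jordan_family hf
  exact ⟨t, ⟨⟨l, e, h1, h2, h3, Module.Basis.mk h4 h5.ge, fun p => by simp⟩⟩⟩

variable (J : JordanFamily f t)

/-- The functional reading off the coefficient of the generator `e i`. -/
noncomputable def coord (i : Fin t) : Module.Dual F V := J.basis.coord ⟨i, ⟨0, J.pos i⟩⟩

theorem basis_zero (i : Fin t) : J.basis ⟨i, ⟨0, J.pos i⟩⟩ = J.e i := by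
  rw [J.basis_apply]; simp

theorem pow_apply_e (i : Fin t) (j : ℕ) (hj : J.l i ≤ j) : (f ^ j) (J.e i) = 0 := by
  obtain ⟨k, rfl⟩ := Nat.exists_eq_add_of_le' hj
  rw [pow_add, Module.End.mul_apply, J.pow_eq_zero, map_zero]

theorem coord_e (i j : Fin t) : J.coord i (J.e j) = if i = j then 1 else 0 := by
  rw [coord, ← basis_zero, Module.Basis.coord_apply, Module.Basis.repr_self,
    Finsupp.single_apply]
  by_cases h : j = i
  · subst h; simp
  · rw [if_neg, if_neg (Ne.symm h)]
    intro h'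
    exact h (congrArg Sigma.fst h')

/-- Since f shifts every chain, the functionals `coord i` descend to V / f V, where they are
coordinates. -/
theorem coord_apply_f (i : Fin t) (v : V) : J.coord i (f v) = 0 := by
  have : J.coord i ∘ₗ f = 0 := by
    apply J.basis.ext
    rintro ⟨k, j⟩
    rw [LinearMap.comp_apply, J.basis_apply, ← Module.End.mul_apply, ← pow_succ']
    by_cases hj : (j : ℕ) + 1 < J.l k
    · have := J.basis_apply ⟨k, ⟨j + 1, hj⟩⟩
      simp only at this
      simp only
      rw [← this, coord, Module.Basis.coord_apply, Module.Basis.repr_self, Finsupp.single_apply,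
        if_neg]
      · rfl
      · intro h
        obtain ⟨rfl, h⟩ := Sigma.mk.inj_iff.1 h
        simp at h
    · rw [J.pow_apply_e _ _ (not_lt.1 hj), map_zero]; rfl
  exact LinearMap.congr_fun this v

theorem sub_sum_mem_range (v : V) : v - ∑ i, J.coord i v • J.e i ∈ LinearMap.range f := by
  let T : V →ₗ[F] V := LinearMap.id - ∑ i, (J.coord i).smulRight (J.e i)
  have hT : ∀ v, T v = v - ∑ i, J.coord i v • J.e i := fun v => by
    simp [T, LinearMap.sum_apply]
  rw [← hT]
  have : (⊤ : Submodule F V) ≤ (LinearMap.range f).comap T := by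
    rw [← J.basis.span_eq, Submodule.span_le]
    rintro _ ⟨⟨k, j, hj⟩, rfl⟩
    rw [SetLike.mem_coe, Submodule.mem_comap, hT]
    rcases j with _ | j
    · rw [J.basis_zero]
      simp [coord_e]
    · rw [J.basis_apply]
      simp only [pow_succ', Module.End.mul_apply, coord_apply_f, zero_smul, Finset.sum_const_zero,
        sub_zero]
      exact ⟨_, rfl⟩
  exact this Submodule.mem_top

theorem mem_range_iff (v : V) : v ∈ LinearMap.range f ↔ ∀ i, J.coord i v = 0 := by
  constructor
  · rintro ⟨w, rfl⟩ i
    exact J.coord_apply_f i w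
  · intro h
    simpa [h] using J.sub_sum_mem_range v

/-- The only relations between the generators over F[f] are f ^ l i (e i) = 0, so their images may
be any vectors satisfying the same relations. -/
theorem exists_commute_apply_e (v : Fin t → V) (hv : ∀ i, (f ^ J.l i) (v i) = 0) :
    ∃ g : Module.End F V, Commute f g ∧ ∀ i, g (J.e i) = v i := by
  let g : Module.End F V := J.basis.constr F fun p => (f ^ (p.2 : ℕ)) (v p.1)
  have hg : ∀ p, g (J.basis p) = (f ^ (p.2 : ℕ)) (v p.1) := fun p => J.basis.constr_basis F _ p
  refine ⟨g, ?_, fun i => ?_⟩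
  · apply J.basis.ext
    rintro ⟨k, j⟩
    rw [Module.End.mul_apply, Module.End.mul_apply, hg, J.basis_apply]
    simp only
    rw [← Module.End.mul_apply, ← Module.End.mul_apply f, ← pow_succ']
    by_cases hj : (j : ℕ) + 1 < J.l k
    · have h1 := J.basis_apply ⟨k, ⟨j + 1, hj⟩⟩
      have h2 := hg ⟨k, ⟨j + 1, hj⟩⟩
      simp only at h1 h2
      rw [← h1, h2]
    · have hj' : (j : ℕ) + 1 = J.l k := by have := j.2; omega
      rw [hj', J.pow_eq_zero, hv, map_zero]
  · rw [← J.basis_zero, hg]; simp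

/-- The action on `V / f V` of an endomorphism, in the basis given by the generators. -/
noncomputable def topMatrix : Module.End F V →ₗ[F] Matrix (Fin t) (Fin t) F where
  toFun g := Matrix.of fun i j => J.coord i (g (J.e j))
  map_add' g h := by ext; simp
  map_smul' a g := by ext; simp

theorem topMatrix_apply (g : Module.End F V) (i j : Fin t) :
    J.topMatrix g i j = J.coord i (g (J.e j)) := rfl

theorem topMatrix_one : J.topMatrix 1 = 1 := by
  ext i j
  rw [topMatrix_apply, Module.End.one_apply, coord_e, Matrix.one_apply]

theorem coord_apply_of_commute {g : Module.End F V} (hg : Commute f g) (i : Fin t) (v : V) :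
    J.coord i (g v) = ∑ j, J.topMatrix g i j * J.coord j v := by
  obtain ⟨w, hw⟩ := J.sub_sum_mem_range v
  have h1 : v = f w + ∑ j, J.coord j v • J.e j := by rw [hw]; abel
  have h2 : g (f w) = f (g w) := (LinearMap.congr_fun hg w).symm
  conv_lhs => rw [h1]
  rw [map_add, map_add, h2, J.coord_apply_f, zero_add, map_sum, map_sum]
  refine Finset.sum_congr rfl fun j _ => ?_
  rw [map_smul, map_smul, smul_eq_mul, mul_comm, topMatrix_apply]

theorem topMatrix_mul {g h : Module.End F V} (hg : Commute f g) :
    J.topMatrix (g * h) = J.topMatrix g * J.topMatrix h := by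
  ext i j
  rw [topMatrix_apply, Module.End.mul_apply, J.coord_apply_of_commute hg, Matrix.mul_apply]
  rfl

theorem topMatrix_pow {g : Module.End F V} (hg : Commute f g) (k : ℕ) :
    J.topMatrix (g ^ k) = J.topMatrix g ^ k := by
  induction k with
  | zero => rw [pow_zero, pow_zero, topMatrix_one]
  | succ k ih => rw [pow_succ', pow_succ', J.topMatrix_mul hg, ih]

/-- If g ^ k maps V into f V, commutation with f makes g ^ (k m) map V into f ^ m V, which is zero
for large m. -/
theorem isNilpotent_topMatrix_iff (hf : IsNilpotent f) {g : Module.End F V} (hg : Commute f g) :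
    IsNilpotent (J.topMatrix g) ↔ IsNilpotent g := by
  constructor
  · rintro ⟨k, hk⟩
    rw [← J.topMatrix_pow hg] at hk
    have h1 : ∀ v, (g ^ k) v ∈ LinearMap.range f := fun v => by
      rw [J.mem_range_iff]
      intro i
      rw [J.coord_apply_of_commute (hg.pow_right k), hk]
      simp
    have h2 : ∀ m : ℕ, ∀ v, ∃ w, (g ^ (k * m)) v = (f ^ m) w := by
      intro m
      induction m with
      | zero => intro v; exact ⟨v, by simp⟩
      | succ m ih =>
        intro v
        obtain ⟨w, hw⟩ := ih v
        obtain ⟨u, hu⟩ := h1 w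
        refine ⟨u, ?_⟩
        rw [mul_add, mul_one, add_comm, pow_add, Module.End.mul_apply, hw, ← Module.End.mul_apply,
          (hg.pow_pow m k).symm.eq, Module.End.mul_apply, ← hu, pow_succ, Module.End.mul_apply]
    obtain ⟨m, hm⟩ := hf
    refine ⟨k * m, LinearMap.ext fun v => ?_⟩
    obtain ⟨w, hw⟩ := h2 m v
    rw [hw, hm]; rfl
  · rintro ⟨k, hk⟩
    exact ⟨k, by rw [← J.topMatrix_pow hg, hk, map_zero]⟩

/-- The span of the first `k` members of `v` and of the range of `f`. -/
def flag (f : Module.End F V) (v : Fin t → V) (k : ℕ) : Submodule F V :=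
  Submodule.span F (v '' {j | (j : ℕ) < k}) ⊔ LinearMap.range f

theorem range_le_flag (v : Fin t → V) (k : ℕ) : LinearMap.range f ≤ flag f v k := le_sup_right

theorem mem_flag (v : Fin t → V) {k : ℕ} {j : Fin t} (h : (j : ℕ) < k) : v j ∈ flag f v k :=
  Submodule.mem_sup_left (Submodule.subset_span ⟨j, h, rfl⟩)

theorem flag_le_iff (v : Fin t → V) (k : ℕ) (N : Submodule F V) :
    flag f v k ≤ N ↔ (∀ j : Fin t, (j : ℕ) < k → v j ∈ N) ∧ LinearMap.range f ≤ N := by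
  rw [flag, sup_le_iff, Submodule.span_le, Set.image_subset_iff]
  rfl

theorem flag_mono (v : Fin t → V) {k m : ℕ} (h : k ≤ m) : flag f v k ≤ flag f v m :=
  (flag_le_iff v k _).2 ⟨fun _ hj => mem_flag v (hj.trans_le h), range_le_flag v m⟩

theorem flag_congr {v w : Fin t → V} {k : ℕ} (h : ∀ j : Fin t, (j : ℕ) < k → v j = w j) :
    flag f v k = flag f w k := by
  have : v '' {j | (j : ℕ) < k} = w '' {j | (j : ℕ) < k} := Set.image_congr fun j hj => h j hj
  rw [flag, flag, this]

theorem finrank_flag_le [FiniteDimensional F V] (v : Fin t → V) (k : ℕ) (hk : k ≤ t) :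
    Module.finrank F (flag f v k) ≤ Module.finrank F (LinearMap.range f) + k := by
  induction k with
  | zero =>
    exact Submodule.finrank_mono ((flag_le_iff v 0 _).2 ⟨fun j hj => absurd hj (by omega), le_rfl⟩)
  | succ k ih =>
    have h1 : flag f v (k + 1) ≤ flag f v k ⊔ Submodule.span F {v ⟨k, hk⟩} := by
      rw [flag_le_iff]
      refine ⟨fun j hj => ?_, (range_le_flag v k).trans le_sup_left⟩
      rcases Nat.lt_succ_iff_lt_or_eq.1 hj with h | h
      · exact Submodule.mem_sup_left (mem_flag v h)
      · refine Submodule.mem_sup_right ?_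
        obtain rfl : j = ⟨k, hk⟩ := Fin.ext h
        exact Submodule.mem_span_singleton_self _
    have h2 := Submodule.finrank_mono h1
    have h3 := Submodule.finrank_add_le_finrank_add_finrank (flag f v k)
      (Submodule.span F {v ⟨k, hk⟩})
    have h4 := finrank_span_le_card (R := F) ({v ⟨k, hk⟩} : Set V)
    simp at h4
    have := ih (by omega)
    omega

theorem le_finrank_flag [FiniteDimensional F V] (v : Fin t → V) (k : ℕ) (hk : k ≤ t)
    (hv : ∀ j : Fin t, (j : ℕ) < k → v j ∉ flag f v j) :
    Module.finrank F (LinearMap.range f) + k ≤ Module.finrank F (flag f v k) := by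
  induction k with
  | zero => exact Submodule.finrank_mono (range_le_flag v 0)
  | succ k ih =>
    have h1 := ih (by omega) fun j hj => hv j (by omega)
    have h2 : flag f v k < flag f v (k + 1) := by
      refine lt_of_le_of_ne (flag_mono v (Nat.le_succ k)) fun h => ?_
      refine hv ⟨k, hk⟩ (Nat.lt_succ_self k) ?_
      change v ⟨k, hk⟩ ∈ flag f v k
      rw [h]
      exact mem_flag v (Nat.lt_succ_self k)
    have h3 := Submodule.finrank_lt_finrank_of_lt h2
    omega

theorem coord_eq_zero_of_mem_flag {i : Fin t} {k : ℕ} (hk : k ≤ i) {v : V}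
    (hv : v ∈ flag f J.e k) : J.coord i v = 0 := by
  have : flag f J.e k ≤ LinearMap.ker (J.coord i) := by
    rw [flag_le_iff]
    refine ⟨fun j hj => ?_, ?_⟩
    · rw [LinearMap.mem_ker, coord_e, if_neg]
      rintro rfl
      omega
    · rintro _ ⟨w, rfl⟩
      exact J.coord_apply_f i w
  exact this hv

theorem e_notMem_flag (i : Fin t) : J.e i ∉ flag f J.e i := by
  intro h
  have := J.coord_eq_zero_of_mem_flag le_rfl h
  rw [coord_e] at this
  simp at this

theorem flag_e_eq_top : flag f J.e t = ⊤ := by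
  rw [eq_top_iff]
  intro v _
  rw [← sub_add_cancel v (∑ i, J.coord i v • J.e i), add_comm]
  refine add_mem (Submodule.sum_mem _ fun i _ => Submodule.smul_mem _ _ (mem_flag _ i.2)) ?_
  exact range_le_flag _ _ (J.sub_sum_mem_range v)

theorem finrank_range_add (J : JordanFamily f t) [FiniteDimensional F V] :
    Module.finrank F (LinearMap.range f) + t = Module.finrank F V := by
  have h1 := finrank_flag_le (f := f) J.e t le_rfl
  have h2 := le_finrank_flag (f := f) J.e t le_rfl fun j _ => J.e_notMem_flag j
  rw [J.flag_e_eq_top, finrank_top] at h1 h2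
  omega

theorem finrank_ker (J : JordanFamily f t) [FiniteDimensional F V] :
    Module.finrank F (LinearMap.ker f) = t := by
  have := LinearMap.finrank_range_add_finrank_ker f
  have := J.finrank_range_add
  omega

/-- A flag of V / f V strictly lowered by B is built from vectors v i obeying the chain relations,
so that some element of the centralizer can send e i to v i. The vectors e 0, ..., e k are all
killed by f ^ l k, and by dimension they cannot all lie in the k-th step of the flag. So some w
killed by f ^ l k lies outside it, and v k is the last B-iterate of w outside; it is still killed by
f ^ l k because B commutes with f. -/
theorem exists_triangular_chain [FiniteDimensional F V] {B : Module.End F V} (hB : Commute f B)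
    (hBn : IsNilpotent B) (k : ℕ) (hk : k ≤ t) :
    ∃ v : Fin t → V, ∀ i : Fin t, (i : ℕ) < k →
      (f ^ J.l i) (v i) = 0 ∧ v i ∉ flag f v i ∧ B (v i) ∈ flag f v i := by
  classical
  induction k with
  | zero => exact ⟨0, fun i hi => absurd hi (Nat.not_lt_zero _)⟩
  | succ k ih =>
    obtain ⟨v, hv⟩ := ih (by omega)
    let i₀ : Fin t := ⟨k, hk⟩
    have hstab : flag f v k ≤ (flag f v k).comap B := by
      rw [flag_le_iff]
      refine ⟨fun j hj => flag_mono v hj.le (hv j hj).2.2, ?_⟩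
      rintro _ ⟨w, rfl⟩
      refine range_le_flag v k ⟨B w, ?_⟩
      exact LinearMap.congr_fun hB w
    obtain ⟨w, hw, hwn⟩ : ∃ w, (f ^ J.l i₀) w = 0 ∧ w ∉ flag f v k := by
      by_contra! h
      have h1 : flag f J.e (k + 1) ≤ flag f v k := by
        rw [flag_le_iff]
        exact ⟨fun j hj => h _ (J.pow_apply_e _ _ (J.mono (Nat.lt_succ_iff.1 hj))),
          range_le_flag v k⟩
      have h2 := Submodule.finrank_mono h1
      have h3 := finrank_flag_le (f := f) v k (by omega)
      have h4 := le_finrank_flag (f := f) J.e (k + 1) hk fun j _ => J.e_notMem_flag j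
      omega
    obtain ⟨m, hm1, hm2⟩ : ∃ m : ℕ, (B ^ m) w ∉ flag f v k ∧ (B ^ (m + 1)) w ∈ flag f v k := by
      obtain ⟨K, hK⟩ := hBn
      have hex : ∃ m : ℕ, (B ^ m) w ∈ flag f v k := ⟨K, by rw [hK]; exact zero_mem _⟩
      have hpos : Nat.find hex ≠ 0 := by
        intro h
        have := Nat.find_spec hex
        rw [h] at this
        exact hwn (by simpa using this)
      obtain ⟨j, hj⟩ := Nat.exists_eq_succ_of_ne_zero hpos
      exact ⟨j, Nat.find_min hex (by omega), by have := Nat.find_spec hex; rwa [hj] at this⟩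
    have hsame : ∀ i ≤ k, flag f (Function.update v i₀ ((B ^ m) w)) i = flag f v i := by
      intro i hi
      refine flag_congr fun j hj => ?_
      rw [Function.update_of_ne]
      rintro rfl
      simp only [i₀] at hj
      omega
    refine ⟨Function.update v i₀ ((B ^ m) w), fun i hi => ?_⟩
    rw [hsame i (by omega)]
    rcases Nat.lt_succ_iff_lt_or_eq.1 hi with h | h
    · rw [Function.update_of_ne (by rintro rfl; exact absurd h (lt_irrefl _))]
      exact hv i h
    · obtain rfl : i = i₀ := Fin.ext h
      rw [Function.update_self]
      refine ⟨?_, hm1, ?_⟩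
      · rw [← Module.End.mul_apply, (hB.pow_pow _ _).eq, Module.End.mul_apply, hw, map_zero]
      · rw [← Module.End.mul_apply, ← pow_succ']; exact hm2

/-- The commuting endomorphism g sending e i to v i is onto modulo f V, hence onto V because f is
nilpotent, hence invertible. Conjugating by it carries the flag of the v i to that of the e i. -/
theorem exists_conj_triangular [FiniteDimensional F V] (hf : IsNilpotent f) {B : Module.End F V}
    (hB : Commute f B) (hBn : IsNilpotent B) :
    ∃ g h m : Module.End F V, Commute f g ∧ Commute f h ∧ Commute f m ∧ g * h = 1 ∧ h * g = 1 ∧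
      B = g * m * h ∧ ∀ i j, j ≤ i → J.topMatrix m i j = 0 := by
  obtain ⟨v, hv⟩ := J.exists_triangular_chain hB hBn t le_rfl
  obtain ⟨g, hg, hge⟩ := J.exists_commute_apply_e v fun i => (hv i i.2).1
  have htop : flag f v t = ⊤ := by
    apply Submodule.eq_top_of_finrank_eq
    have h1 := le_finrank_flag v t le_rfl fun j _ => (hv j j.2).2.1
    have h2 := J.finrank_range_add
    have h3 := Submodule.finrank_le (flag f v t)
    omega
  have hdec : ∀ u : V, ∃ a b, u = g a + f b := by
    intro u
    have : u ∈ LinearMap.range g ⊔ LinearMap.range f := by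
      have hle : flag f v t ≤ LinearMap.range g ⊔ LinearMap.range f := by
        rw [flag_le_iff]
        exact ⟨fun j _ => Submodule.mem_sup_left ⟨J.e j, hge j⟩, le_sup_right⟩
      exact hle (htop ▸ Submodule.mem_top)
    obtain ⟨_, ⟨a, rfl⟩, _, ⟨b, rfl⟩, h⟩ := Submodule.mem_sup.1 this
    exact ⟨a, b, h.symm⟩
  have hdec' : ∀ (k : ℕ) (u : V), ∃ a b, u = g a + (f ^ k) b := by
    intro k
    induction k with
    | zero => intro u; exact ⟨0, u, by simp⟩
    | succ k ih =>
      intro u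
      obtain ⟨a, b, rfl⟩ := ih u
      obtain ⟨c, d, rfl⟩ := hdec b
      refine ⟨a + (f ^ k) c, d, ?_⟩
      have h1 : (f ^ k) (g c) = g ((f ^ k) c) := LinearMap.congr_fun (hg.pow_left k) c
      rw [map_add, map_add, h1, pow_succ, Module.End.mul_apply, add_assoc]
  have hsurj : LinearMap.range g = ⊤ := by
    rw [LinearMap.range_eq_top]
    intro u
    obtain ⟨k, hk⟩ := hf
    obtain ⟨a, b, h⟩ := hdec' k u
    exact ⟨a, by rw [h, hk]; simp⟩
  obtain ⟨⟨g', h, hgh, hhg⟩, rfl⟩ := LinearMap.isUnit_iff_range_eq_top g |>.2 hsurj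
  have hh : Commute f h := by
    change f * h = h * f
    calc f * h = h * g' * (f * h) := by rw [hhg, one_mul]
      _ = h * (g' * f) * h := by simp only [mul_assoc]
      _ = h * f * (g' * h) := by rw [← hg.eq]; simp only [mul_assoc]
      _ = h * f := by rw [hgh, mul_one]
  refine ⟨g', h, h * B * g', hg, hh, (hh.mul_right hB).mul_right hg, hgh, hhg, ?_, ?_⟩
  · calc B = (g' * h) * B * (g' * h) := by rw [hgh]; simp
      _ = _ := by simp only [mul_assoc]
  · intro i j hij
    rw [topMatrix_apply, Module.End.mul_apply, Module.End.mul_apply]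
    have h1 : flag f v j ≤ (flag f J.e j).comap h := by
      rw [flag_le_iff]
      refine ⟨fun k hk => ?_, ?_⟩
      · rw [Submodule.mem_comap, ← hge k]
        have : h (g' (J.e k)) = J.e k := LinearMap.congr_fun hhg (J.e k)
        change h (g' (J.e k)) ∈ _
        rw [this]
        exact mem_flag _ hk
      · rintro _ ⟨w, rfl⟩
        exact range_le_flag _ _ ⟨h w, LinearMap.congr_fun hh w⟩
    have h2 : g' (J.e j) = v j := hge j
    rw [h2]
    exact J.coord_eq_zero_of_mem_flag hij (h1 (hv j j.2).2.2)

theorem exists_commute_topMatrix_single (i : Fin t) :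
    ∃ E : Module.End F V, Commute f E ∧ J.topMatrix E = Matrix.single i i 1 := by
  obtain ⟨E, hE, hEe⟩ := J.exists_commute_apply_e (fun j => if i = j then J.e j else 0) fun j => by
    split_ifs
    · exact J.pow_eq_zero j
    · exact map_zero _
  refine ⟨E, hE, ?_⟩
  ext a b
  rw [topMatrix_apply, hEe, Matrix.single_apply]
  by_cases h : i = b
  · subst h
    simp [coord_e, eq_comm]
  · simp [h]

/-- Take B shifting e i to e (i - 1), which the increasing lengths allow. Evaluated at the last
generator, the monomials f ^ j B ^ (t - 1 - i) become exactly the Jordan basis. -/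
theorem exists_linearIndependent_monomials (J : JordanFamily f t) [FiniteDimensional F V]
    (hf : IsNilpotent f) (ht : 0 < t) :
    ∃ B : Module.End F V, Commute f B ∧ IsNilpotent B ∧ LinearIndependent F
      fun p : Σ i, Fin (J.l i) => f ^ (p.2 : ℕ) * B ^ (t - 1 - (p.1 : ℕ)) := by
  obtain ⟨B, hB, hBe⟩ := J.exists_commute_apply_e
    (fun i => if h : 0 < (i : ℕ) then J.e ⟨i - 1, by omega⟩ else 0) fun i => by
      split_ifs with h
      · exact J.pow_apply_e _ _ (J.mono (Fin.mk_le_of_le_val (by omega)))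
      · exact map_zero _
  have hBn : IsNilpotent B := by
    rw [← J.isNilpotent_topMatrix_iff hf hB]
    refine Matrix.isNilpotent_of_strictly_upper_triangular fun i j hij => ?_
    rw [topMatrix_apply, hBe]
    split_ifs with h
    · rw [coord_e, if_neg]
      rintro rfl
      have : (j : ℕ) ≤ (j : ℕ) - 1 := hij
      omega
    · exact map_zero _
  have hBk : ∀ k (hk : k < t), (B ^ k) (J.e ⟨t - 1, by omega⟩) = J.e ⟨t - 1 - k, by omega⟩ := by
    intro k
    induction k with
    | zero => intro _; simp
    | succ k ih =>
      intro hk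
      rw [pow_succ', Module.End.mul_apply, ih (by omega), hBe]
      have h : 0 < t - 1 - k := by omega
      rw [dif_pos h]
      congr 1
  refine ⟨B, hB, hBn, LinearIndependent.of_comp
    (LinearMap.applyₗ (R := F) (M₂ := V) (J.e ⟨t - 1, by omega⟩)) ?_⟩
  convert J.basis.linearIndependent using 1
  ext1 p
  rw [J.basis_apply]
  change (f ^ (p.2 : ℕ)) ((B ^ (t - 1 - (p.1 : ℕ))) _) = _
  have := p.1.2
  rw [hBk _ (by omega)]
  congr 2
  ext
  simp only
  omega

end JordanFamily

end Jordan

/-! ### The centralizer of a nilpotent matrix -/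

section CentralizerData

variable {F : Type*} [Field F] {n : ℕ}

theorem mem_matrixCentralizer_iff {A B : Matrix (Fin n) (Fin n) F} :
    B ∈ matrixCentralizer A ↔ Commute A B := by
  rw [Subalgebra.mem_centralizer_iff]
  exact ⟨fun h => h A rfl, by rintro h _ rfl; exact h⟩

/-- The action of the centralizer of a nilpotent matrix `A` on `V / A V`, together with the
properties of it that determine the nilpotent part of the centralizer. -/
theorem exists_centralizer_representation {A : Matrix (Fin n) (Fin n) F} (hA : IsNilpotent A) :
    ∃ β : matrixCentralizer A →ₐ[F]
        Matrix (Fin (Module.finrank F (LinearMap.ker (Matrix.toLin' A))))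
          (Fin (Module.finrank F (LinearMap.ker (Matrix.toLin' A)))) F,
      (∀ B, IsNilpotent (β B) ↔ IsNilpotent B) ∧ (∀ i, ∃ E, β E = Matrix.single i i 1) ∧
      ∀ B, IsNilpotent B → ∃ g h m : matrixCentralizer A, g * h = 1 ∧ h * g = 1 ∧ B = g * m * h ∧
        ∀ i j, j ≤ i → β m i j = 0 := by
  let φ := Matrix.toLinAlgEquiv' (R := F) (n := Fin n)
  have hf : IsNilpotent (Matrix.toLin' A) := hA.map φ
  obtain ⟨t, ⟨J⟩⟩ := JordanFamily.exists_of_isNilpotent hf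
  rw [J.finrank_ker]
  have hcomm : ∀ B : matrixCentralizer A, Commute (Matrix.toLin' A) (φ B.1) := fun B =>
    (mem_matrixCentralizer_iff.1 B.2).map φ
  have hlift : ∀ g : Module.End F (Fin n → F), Commute (Matrix.toLin' A) g →
      ∃ B : matrixCentralizer A, φ B.1 = g := fun g hg => by
    refine ⟨⟨φ.symm g, mem_matrixCentralizer_iff.2 ?_⟩, φ.apply_symm_apply g⟩
    have := hg.map φ.symm
    have h2 : φ.symm (Matrix.toLin' A) = A := φ.symm_apply_apply A
    rwa [h2] at this
  let β : matrixCentralizer A →ₐ[F] Matrix (Fin t) (Fin t) F :=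
    AlgHom.ofLinearMap (J.topMatrix ∘ₗ φ.toLinearMap ∘ₗ (matrixCentralizer A).val.toLinearMap)
      (by
        change J.topMatrix (φ 1) = 1
        rw [map_one, J.topMatrix_one])
      (fun a b => by
        change J.topMatrix (φ (a.1 * b.1)) = _
        rw [map_mul, J.topMatrix_mul (hcomm a)]; rfl)
  have hβ : ∀ B, β B = J.topMatrix (φ B.1) := fun B => rfl
  refine ⟨β, fun B => ?_, fun i => ?_, fun B hB => ?_⟩
  · rw [hβ, J.isNilpotent_topMatrix_iff hf (hcomm B), IsNilpotent.map_iff φ.injective]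
    exact IsNilpotent.map_iff (f := (matrixCentralizer A).val) Subtype.val_injective
  · obtain ⟨E, hE, hE'⟩ := J.exists_commute_topMatrix_single i
    obtain ⟨B, rfl⟩ := hlift E hE
    exact ⟨B, hE'⟩
  · obtain ⟨g, h, m, hg, hh, hm, h1, h2, h3, h4⟩ := J.exists_conj_triangular hf (hcomm B)
      ((hB.map (matrixCentralizer A).val).map φ)
    obtain ⟨g, rfl⟩ := hlift g hg
    obtain ⟨h, rfl⟩ := hlift h hh
    obtain ⟨m, rfl⟩ := hlift m hm
    refine ⟨g, h, m, ?_, ?_, ?_, h4⟩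
    · exact Subtype.ext (φ.injective (by simpa using h1))
    · exact Subtype.ext (φ.injective (by simpa using h2))
    · exact Subtype.ext (φ.injective (by simpa using h3))

/-- The index k marks the monomial 1, which must later be omitted for a combination to be nilpotent;
it comes from the last generator itself. -/
theorem exists_linearIndependent_monomials (hn : 1 ≤ n) {A : Matrix (Fin n) (Fin n) F}
    (hA : IsNilpotent A) :
    ∃ (B : Matrix (Fin n) (Fin n) F) (p : Fin n → ℕ × ℕ) (k : Fin n), Commute A B ∧
      IsNilpotent B ∧ p k = (0, 0) ∧
      LinearIndependent F fun i => A ^ (p i).1 * B ^ (p i).2 := by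
  let φ := Matrix.toLinAlgEquiv' (R := F) (n := Fin n)
  have hf : IsNilpotent (Matrix.toLin' A) := hA.map φ
  obtain ⟨t, ⟨J⟩⟩ := JordanFamily.exists_of_isNilpotent hf
  have ht : 0 < t := by
    by_contra h
    obtain rfl : t = 0 := by omega
    have h1 := Module.finrank_eq_card_basis J.basis
    rw [Module.finrank_fin_fun] at h1
    simp at h1
    omega
  obtain ⟨g, hg, hgn, hli⟩ := J.exists_linearIndependent_monomials hf ht
  have hcard : Fintype.card (Σ i, Fin (J.l i)) = n := by
    rw [← Module.finrank_eq_card_basis J.basis, Module.finrank_fin_fun]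
  let e : (Σ i, Fin (J.l i)) ≃ Fin n := Fintype.equivFinOfCardEq hcard
  have hA' : φ.symm (Matrix.toLin' A) = A := φ.symm_apply_apply A
  refine ⟨φ.symm g, fun i => ((e.symm i).2, t - 1 - ((e.symm i).1 : ℕ)),
    e ⟨⟨t - 1, by omega⟩, ⟨0, J.pos _⟩⟩, ?_, hgn.map φ.symm, ?_, ?_⟩
  · have := hg.map φ.symm
    rwa [hA'] at this
  · beta_reduce
    rw [e.symm_apply_apply, Nat.sub_self]
  · have h1 := (hli.comp e.symm e.symm.injective).map' φ.symm.toLinearMap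
      (LinearMap.ker_eq_bot.2 φ.symm.injective)
    have h2 : (fun i => A ^ ((e.symm i).2 : ℕ) * φ.symm g ^ (t - 1 - ((e.symm i).1 : ℕ))) =
        ⇑φ.symm.toLinearMap ∘
          (fun p : Σ i, Fin (J.l i) => Matrix.toLin' A ^ (p.2 : ℕ) * g ^ (t - 1 - (p.1 : ℕ))) ∘
          ⇑e.symm := by
      ext1 i
      change _ = φ.symm (Matrix.toLin' A ^ _ * g ^ _)
      rw [map_mul, map_pow, map_pow, hA']
    rw [← h2] at h1
    exact h1

end CentralizerData

/-! ### Krull dimension, transcendence degree and height -/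

section DimensionTheory

/-- Chains of primes lift by lying over and going up; by incomparability they stay strict under
contraction. -/
theorem ringKrullDim_eq_of_isIntegral {R S : Type*} [CommRing R] [CommRing S] [Algebra R S]
    [Algebra.IsIntegral R S] (hinj : Function.Injective (algebraMap R S)) :
    ringKrullDim R = ringKrullDim S := by
  apply le_antisymm
  · refine iSup_le fun l => ?_
    obtain ⟨P, -, hP, hPl⟩ := Ideal.exists_ideal_over_prime_of_isIntegral
      (RelSeries.head l).asIdeal (⊥ : Ideal S) (by
        rw [← RingHom.ker_eq_comap_bot, (RingHom.injective_iff_ker_eq_bot _).1 hinj]; exact bot_le)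
    have : P.LiesOver (RelSeries.head l).asIdeal := ⟨hPl.symm⟩
    obtain ⟨L, hL, -⟩ := Ideal.exists_ltSeries_of_hasGoingUp l P
    rw [← hL]
    exact Order.LTSeries.length_le_krullDim L
  · refine Order.krullDim_le_of_strictMono (PrimeSpectrum.comap (algebraMap R S)) ?_
    intro I J hIJ
    exact Ideal.IsIntegral.comap_lt_comap (R := R) (I := I.asIdeal) (J := J.asIdeal) hIJ

/-- The Krull dimension of a finitely generated domain over a field is its transcendence degree. -/
theorem exists_ringKrullDim_eq_and_trdeg_eq (K D : Type*) [Field K] [CommRing D] [IsDomain D]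
    [Algebra K D] [Algebra.FiniteType K D] :
    ∃ s : ℕ, ringKrullDim D = s ∧ Algebra.trdeg K D = s := by
  -- Noether normalization: both invariants are read off a polynomial ring in s variables.
  obtain ⟨s, g, hg, hint⟩ := exists_integral_inj_algHom_of_fg K D
  let _ := g.toRingHom.toAlgebra
  have : IsScalarTower K (MvPolynomial (Fin s) K) D := IsScalarTower.of_algHom g
  have hi : Algebra.IsIntegral (MvPolynomial (Fin s) K) D := ⟨hint⟩
  have hfaith : FaithfulSMul (MvPolynomial (Fin s) K) D :=
    (faithfulSMul_iff_algebraMap_injective _ _).2 hg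
  refine ⟨s, ?_, ?_⟩
  · rw [← ringKrullDim_eq_of_isIntegral (R := MvPolynomial (Fin s) K) hg,
      MvPolynomial.ringKrullDim_of_isNoetherianRing, ringKrullDim_eq_zero_of_field]
    simp
  · have h1 := lift_trdeg_add_eq K (MvPolynomial (Fin s) K) D
    rw [MvPolynomial.trdeg_of_isDomain, trdeg_eq_zero] at h1
    simp at h1
    exact h1.symm

/-- Translations permute the points transitively and, by the Nullstellensatz, the points give all
maximal ideals. So all these heights agree, and their supremum is the dimension of the polynomial
ring. -/
theorem MvPolynomial.height_vanishingIdeal_singleton {K : Type*} [Field K] [IsAlgClosed K]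
    {ι : Type*} [Fintype ι] (a : ι → K) :
    (MvPolynomial.vanishingIdeal K {a} : Ideal (MvPolynomial ι K)).height = Fintype.card ι := by
  have htrans : ∀ b c : ι → K, (MvPolynomial.vanishingIdeal K {b} : Ideal (MvPolynomial ι K)).height
      = (MvPolynomial.vanishingIdeal K {c} : Ideal (MvPolynomial ι K)).height := by
    intro b c
    have hcomp : ∀ u v : ι → K, u + v = 0 →
        (MvPolynomial.aeval (R := K) fun i => MvPolynomial.X i + MvPolynomial.C (u i)).comp
        (MvPolynomial.aeval fun i => MvPolynomial.X i + MvPolynomial.C (v i)) =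
        AlgHom.id K (MvPolynomial ι K) := by
      intro u v huv
      ext i
      have h0 : u i + v i = 0 := congrFun huv i
      simp [add_assoc, ← MvPolynomial.C_add, h0]
    let e : MvPolynomial ι K ≃ₐ[K] MvPolynomial ι K :=
      AlgEquiv.ofAlgHom (MvPolynomial.aeval fun i => MvPolynomial.X i + MvPolynomial.C ((b - c) i))
        (MvPolynomial.aeval fun i => MvPolynomial.X i + MvPolynomial.C ((c - b) i))
        (hcomp _ _ (by abel)) (hcomp _ _ (by abel))
    rw [← RingEquiv.height_comap e.toRingEquiv (MvPolynomial.vanishingIdeal K {c})]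
    congr 1
    ext p
    rw [Ideal.mem_comap, MvPolynomial.mem_vanishingIdeal_singleton_iff,
      MvPolynomial.mem_vanishingIdeal_singleton_iff]
    have : (MvPolynomial.aeval c).comp e.toAlgHom = MvPolynomial.aeval (R := K) b := by
      ext i
      simp [e]
    rw [← this]; rfl
  have h1 := Ideal.sup_isMaximal_height_eq_ringKrullDim (R := MvPolynomial ι K)
  rw [MvPolynomial.ringKrullDim_of_isNoetherianRing, ringKrullDim_eq_zero_of_field, zero_add,
    Nat.card_eq_fintype_card] at h1
  have h2 : (⨆ (I : Ideal (MvPolynomial ι K)) (_ : I.IsMaximal), I.height) =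
      (MvPolynomial.vanishingIdeal K {a} : Ideal (MvPolynomial ι K)).height := by
    apply le_antisymm
    · refine iSup₂_le fun I hI => ?_
      obtain ⟨b, rfl⟩ := MvPolynomial.isMaximal_iff_eq_vanishingIdeal_singleton.1 hI
      exact (htrans b a).le
    · exact le_iSup₂ (f := fun (I : Ideal (MvPolynomial ι K)) (_ : I.IsMaximal) => I.height)
        (MvPolynomial.vanishingIdeal K {a}) inferInstance
  rw [h2] at h1
  exact_mod_cast h1

/-- The zero locus of `t` polynomials through a point of affine `N`-space has dimension at least
`N - t`. -/
theorem card_le_ringKrullDim_quotient_vanishingIdeal_add {K : Type*} [Field K] [IsAlgClosed K]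
    {ι κ : Type*} [Fintype ι] [Fintype κ] (q : κ → MvPolynomial ι K) (Y : Set (ι → K))
    (hY : ∀ y, y ∈ Y ↔ ∀ k, MvPolynomial.eval y (q k) = 0) (a : ι → K) (ha : a ∈ Y) :
    (Fintype.card ι : WithBot ℕ∞) ≤
      ringKrullDim (MvPolynomial ι K ⧸ (MvPolynomial.vanishingIdeal K Y : Ideal (MvPolynomial ι K)))
        + Fintype.card κ := by
  -- Krull's height theorem at the point a.
  have h1 := Ideal.height_le_ringKrullDim_quotient_add_encard
    (p := (MvPolynomial.vanishingIdeal K {a} : Ideal (MvPolynomial ι K))) (Set.range q) (by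
      rintro _ ⟨k, rfl⟩
      rw [SetLike.mem_coe, MvPolynomial.mem_vanishingIdeal_singleton_iff]
      simpa [MvPolynomial.aeval_eq_eval] using (hY a).1 ha k)
  have hlocus : Y = MvPolynomial.zeroLocus K (Ideal.span (Set.range q)) := by
    rw [MvPolynomial.zeroLocus_span]
    ext y
    rw [hY]
    simp [MvPolynomial.aeval_eq_eval]
  -- The vanishing ideal of Y is the radical of the ideal of the equations, and both lie in the same
  -- primes.
  have h2 : ringKrullDim (MvPolynomial ι K ⧸ Ideal.span (Set.range q)) =
      ringKrullDim (MvPolynomial ι K ⧸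
        (MvPolynomial.vanishingIdeal K Y : Ideal (MvPolynomial ι K))) := by
    rw [ringKrullDim_quotient, ringKrullDim_quotient, hlocus,
      MvPolynomial.vanishingIdeal_zeroLocus_eq_radical, PrimeSpectrum.zeroLocus_radical]
  rw [h2, MvPolynomial.height_vanishingIdeal_singleton] at h1
  refine le_trans (by exact_mod_cast h1) (add_le_add le_rfl ?_)
  have h3 : (Set.range q).encard ≤ Fintype.card κ := by
    rw [← Set.image_univ]
    refine (Set.encard_image_le _ _).trans ?_
    simp
  exact_mod_cast h3

end DimensionTheory

/-! ### Closed sets of matrix pairs and their ideals -/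

section Zariski

open TopologicalSpace

theorem MatrixPair.coords_surjective {K : Type*} {n : ℕ} :
    Function.Surjective (MatrixPair.coords (F := K) (n := n)) :=
  fun x => ⟨⟨Matrix.of fun i j => x (Sum.inl (i, j)), Matrix.of fun i j => x (Sum.inr (i, j))⟩, by
    ext (⟨i, j⟩ | ⟨i, j⟩) <;> rfl⟩

variable {K : Type*} [Field K] {n : ℕ}

/-- The ideal of polynomials in the matrix entries vanishing on a set of pairs of matrices. -/
noncomputable def pairIdeal (S : Set (MatrixPair K n)) :
    Ideal (MvPolynomial ((Fin n × Fin n) ⊕ (Fin n × Fin n)) K) :=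
  MvPolynomial.vanishingIdeal K (MatrixPair.coords '' S)

theorem mem_pairIdeal {S : Set (MatrixPair K n)}
    {p : MvPolynomial ((Fin n × Fin n) ⊕ (Fin n × Fin n)) K} :
    p ∈ pairIdeal S ↔ ∀ P ∈ S, MvPolynomial.eval P.coords p = 0 := by
  simp [pairIdeal, MvPolynomial.aeval_eq_eval]

theorem isClosed_matrixPair_iff {Z : Set (MatrixPair K n)} :
    IsClosed Z ↔ ∃ I : Ideal (MvPolynomial ((Fin n × Fin n) ⊕ (Fin n × Fin n)) K),
      Z = MatrixPair.coords ⁻¹' MvPolynomial.zeroLocus K I := by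
  let _ := zariskiTopology K ((Fin n × Fin n) ⊕ (Fin n × Fin n))
  have h : ∀ W : Set ((Fin n × Fin n) ⊕ (Fin n × Fin n) → K), IsClosed W ↔
      ∃ I : Ideal (MvPolynomial ((Fin n × Fin n) ⊕ (Fin n × Fin n)) K),
        W = MvPolynomial.zeroLocus K I := fun W => by
    rw [← isOpen_compl_iff]
    change Wᶜᶜ ∈ _ ↔ _
    rw [compl_compl]
    rfl
  rw [isClosed_induced_iff]
  constructor
  · rintro ⟨t, ht, rfl⟩
    obtain ⟨I, rfl⟩ := (h t).1 ht
    exact ⟨I, rfl⟩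
  · rintro ⟨I, rfl⟩
    exact ⟨_, (h _).2 ⟨I, rfl⟩, rfl⟩

/-- The set of pairs of matrices at which all polynomials of an ideal vanish. -/
def pairLocus (I : Ideal (MvPolynomial ((Fin n × Fin n) ⊕ (Fin n × Fin n)) K)) :
    Set (MatrixPair K n) :=
  MatrixPair.coords ⁻¹' MvPolynomial.zeroLocus K I

theorem mem_pairLocus {I : Ideal (MvPolynomial ((Fin n × Fin n) ⊕ (Fin n × Fin n)) K)}
    {P : MatrixPair K n} : P ∈ pairLocus I ↔ ∀ p ∈ I, MvPolynomial.eval P.coords p = 0 := by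
  simp [pairLocus, MvPolynomial.aeval_eq_eval]

theorem isClosed_pairLocus (I : Ideal (MvPolynomial ((Fin n × Fin n) ⊕ (Fin n × Fin n)) K)) :
    IsClosed (pairLocus I) := isClosed_matrixPair_iff.2 ⟨I, rfl⟩

theorem le_pairIdeal_iff {S : Set (MatrixPair K n)}
    {I : Ideal (MvPolynomial ((Fin n × Fin n) ⊕ (Fin n × Fin n)) K)} :
    I ≤ pairIdeal S ↔ S ⊆ pairLocus I := by
  constructor
  · intro h P hP
    exact mem_pairLocus.2 fun p hp => mem_pairIdeal.1 (h hp) P hP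
  · intro h p hp
    exact mem_pairIdeal.2 fun P hP => mem_pairLocus.1 (h hP) p hp

theorem closure_eq_pairLocus (S : Set (MatrixPair K n)) : closure S = pairLocus (pairIdeal S) := by
  apply subset_antisymm
  · exact closure_minimal (le_pairIdeal_iff.1 le_rfl) (isClosed_pairLocus _)
  · obtain ⟨I, hI⟩ := isClosed_matrixPair_iff.1 (isClosed_closure (s := S))
    rw [hI]
    have h1 : I ≤ pairIdeal S := le_pairIdeal_iff.2 (subset_closure.trans hI.subset)
    intro P hP
    exact mem_pairLocus.2 fun p hp => mem_pairLocus.1 hP p (h1 hp)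

theorem pairIdeal_pairLocus [IsAlgClosed K]
    (I : Ideal (MvPolynomial ((Fin n × Fin n) ⊕ (Fin n × Fin n)) K)) [I.IsPrime] :
    pairIdeal (pairLocus I) = I := by
  rw [pairIdeal, pairLocus, Set.image_preimage_eq _ MatrixPair.coords_surjective,
    MvPolynomial.IsPrime.vanishingIdeal_zeroLocus]

theorem Topology.IsClosedEmbedding.isIrreducible_of_image {X Y : Type*} [TopologicalSpace X]
    [TopologicalSpace Y] {f : X → Y} (hf : Topology.IsClosedEmbedding f) {T : Set X}
    (hT : IsIrreducible (f '' T)) : IsIrreducible T := by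
  refine ⟨Set.image_nonempty.1 hT.1, isPreirreducible_iff_isClosed_union_isClosed.2 ?_⟩
  intro Z W hZ hW h
  have h1 := isPreirreducible_iff_isClosed_union_isClosed.1 hT.2 (f '' Z) (f '' W)
    (hf.isClosedMap _ hZ) (hf.isClosedMap _ hW) (by rw [← Set.image_union]; exact Set.image_mono h)
  rwa [Set.image_subset_image_iff hf.injective, Set.image_subset_image_iff hf.injective] at h1

theorem isPrime_pairIdeal_of_isIrreducible {S : Set (MatrixPair K n)} (hS : IsIrreducible S) :
    (pairIdeal S).IsPrime := by
  refine ⟨fun h => ?_, fun {p q} hpq => ?_⟩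
  · obtain ⟨P, hP⟩ := hS.nonempty
    have h1 : (1 : MvPolynomial ((Fin n × Fin n) ⊕ (Fin n × Fin n)) K) ∈ pairIdeal S :=
      h ▸ Submodule.mem_top
    simpa using mem_pairIdeal.1 h1 P hP
  · have h1 := isPreirreducible_iff_isClosed_union_isClosed.1 hS.isPreirreducible
      (pairLocus (Ideal.span {p})) (pairLocus (Ideal.span {q}))
      (isClosed_pairLocus _) (isClosed_pairLocus _) (fun P hP => ?_)
    · rw [← le_pairIdeal_iff, ← le_pairIdeal_iff, Ideal.span_singleton_le_iff_mem,
        Ideal.span_singleton_le_iff_mem] at h1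
      exact h1
    · have h2 := mem_pairIdeal.1 hpq P hP
      rw [map_mul, mul_eq_zero] at h2
      refine h2.imp (fun h => ?_) (fun h => ?_)
      · rw [mem_pairLocus]
        intro r hr
        obtain ⟨a, rfl⟩ := Ideal.mem_span_singleton'.1 hr
        rw [map_mul, h, mul_zero]
      · rw [mem_pairLocus]
        intro r hr
        obtain ⟨a, rfl⟩ := Ideal.mem_span_singleton'.1 hr
        rw [map_mul, h, mul_zero]

theorem isIrreducible_of_isPrime_pairIdeal {S : Set (MatrixPair K n)} (hS : (pairIdeal S).IsPrime) :
    IsIrreducible S := by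
  refine ⟨?_, ?_⟩
  · by_contra h
    rw [Set.not_nonempty_iff_eq_empty] at h
    subst h
    exact hS.ne_top ((Ideal.eq_top_iff_one _).2 (mem_pairIdeal.2 fun P hP => absurd hP id))
  · rw [isPreirreducible_iff_isClosed_union_isClosed]
    intro Z W hZ hW hSZW
    obtain ⟨I, rfl⟩ := isClosed_matrixPair_iff.1 hZ
    obtain ⟨J, rfl⟩ := isClosed_matrixPair_iff.1 hW
    change S ⊆ pairLocus I ∪ pairLocus J at hSZW
    change S ⊆ pairLocus I ∨ S ⊆ pairLocus J
    rw [← le_pairIdeal_iff, ← le_pairIdeal_iff, ← hS.mul_le, Ideal.mul_le]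
    intro p hp q hq
    rw [mem_pairIdeal]
    intro P hP
    rw [map_mul]
    rcases hSZW hP with h | h
    · rw [mem_pairLocus.1 h p hp, zero_mul]
    · rw [mem_pairLocus.1 h q hq, mul_zero]

/-- The Krull dimension of the closure of `S` is that of the coordinate ring. -/
theorem topologicalKrullDim_closure_eq_ringKrullDim [IsAlgClosed K] (S : Set (MatrixPair K n)) :
    topologicalKrullDim (closure S) =
      ringKrullDim (MvPolynomial ((Fin n × Fin n) ⊕ (Fin n × Fin n)) K ⧸ pairIdeal S) := by
  rw [ringKrullDim_quotient, topologicalKrullDim]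
  have hcl : Topology.IsClosedEmbedding (Subtype.val : closure S → MatrixPair K n) :=
    isClosed_closure.isClosedEmbedding_subtypeVal
  -- Irreducible closed subsets of the closure correspond, with order reversed, to primes containing
  -- the ideal of S; each direction gives one inequality.
  apply le_antisymm
  · rw [← Order.krullDim_orderDual (α := PrimeSpectrum.zeroLocus _)]
    have hP : ∀ Z : IrreducibleCloseds (closure S),
        (pairIdeal (Subtype.val '' (Z : Set (closure S)))).IsPrime := fun Z =>
      isPrime_pairIdeal_of_isIrreducible
        (Z.isIrreducible.image _ continuous_subtype_val.continuousOn)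
    have hZc : ∀ Z : IrreducibleCloseds (closure S),
        pairLocus (pairIdeal (Subtype.val '' (Z : Set (closure S)))) =
          Subtype.val '' (Z : Set (closure S)) := fun Z => by
      rw [← closure_eq_pairLocus]
      exact (hcl.isClosedMap _ Z.isClosed).closure_eq
    refine Order.krullDim_le_of_strictMono (fun Z => OrderDual.toDual
      ⟨⟨pairIdeal (Subtype.val '' (Z : Set (closure S))), hP Z⟩, ?_⟩) ?_
    · rw [PrimeSpectrum.mem_zeroLocus]
      change pairIdeal S ≤ pairIdeal _
      rw [le_pairIdeal_iff, ← closure_eq_pairLocus]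
      rintro _ ⟨P, -, rfl⟩
      exact P.2
    · intro Z W hZW
      rw [OrderDual.toDual_lt_toDual]
      change pairIdeal _ < pairIdeal _
      refine lt_of_le_of_ne ?_ fun h => ?_
      · rw [le_pairIdeal_iff, hZc]
        exact Set.image_mono hZW.le
      · have h1 := congrArg pairLocus h
        rw [hZc, hZc] at h1
        exact hZW.ne (IrreducibleCloseds.ext (Subtype.val_injective.image_injective h1.symm))
  · rw [← Order.krullDim_orderDual (α := IrreducibleCloseds (closure S))]
    have hval : ∀ Q : PrimeSpectrum.zeroLocus
        (pairIdeal S : Set (MvPolynomial ((Fin n × Fin n) ⊕ (Fin n × Fin n)) K)),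
        Subtype.val '' (Subtype.val ⁻¹' pairLocus Q.1.asIdeal : Set (closure S)) =
          pairLocus Q.1.asIdeal := fun Q => by
      rw [Subtype.image_preimage_coe, Set.inter_eq_right, closure_eq_pairLocus]
      intro P hP
      exact mem_pairLocus.2 fun p hp => mem_pairLocus.1 hP p (Q.2 hp)
    have hirr : ∀ Q : PrimeSpectrum.zeroLocus
        (pairIdeal S : Set (MvPolynomial ((Fin n × Fin n) ⊕ (Fin n × Fin n)) K)),
        IsIrreducible (Subtype.val ⁻¹' pairLocus Q.1.asIdeal : Set (closure S)) := fun Q => by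
      refine hcl.isIrreducible_of_image ?_
      rw [hval]
      apply isIrreducible_of_isPrime_pairIdeal
      have := Q.1.2
      rw [pairIdeal_pairLocus]
      exact this
    let g : PrimeSpectrum.zeroLocus
        (pairIdeal S : Set (MvPolynomial ((Fin n × Fin n) ⊕ (Fin n × Fin n)) K)) →
        IrreducibleCloseds (closure S) := fun Q =>
      ⟨Subtype.val ⁻¹' pairLocus Q.1.asIdeal, hirr Q,
        (isClosed_pairLocus _).preimage continuous_subtype_val⟩
    refine Order.krullDim_le_of_strictMono (fun Q => OrderDual.toDual (g Q)) ?_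
    intro Q R hQR
    rw [OrderDual.toDual_lt_toDual]
    refine lt_of_le_of_ne ?_ fun h => ?_
    · intro P hP
      exact mem_pairLocus.2 fun p hp => mem_pairLocus.1 hP p (hQR.le hp)
    · have h1 : (g R : Set (closure S)) = g Q := congrArg _ h
      have h2 := congrArg (fun Z => pairIdeal (Subtype.val '' Z)) h1
      simp only [g, IrreducibleCloseds.coe_mk] at h2
      have := Q.1.2
      have := R.1.2
      rw [hval, hval, pairIdeal_pairLocus, pairIdeal_pairLocus] at h2
      exact hQR.ne (Subtype.ext (PrimeSpectrum.ext h2.symm))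

end Zariski

/-! ### Integrality of diagonal entries of a nilpotent matrix -/

section Integrality

-- If some z i lay outside V, take z j of largest valuation and divide the matrix by it. The result
-- has entries in V, and the part coming from M lies in the maximal ideal. Its reduction is a
-- nilpotent diagonal matrix with j-th entry 1, which is absurd.
open Matrix in
theorem ValuationSubring.mem_of_isNilpotent_diagonal_add {K κ : Type*} [Field K] [Fintype κ]
    [DecidableEq κ] (V : ValuationSubring K) (z : κ → K) (M : Matrix κ κ K)
    (hM : ∀ i j, M i j ∈ V) (hnil : IsNilpotent (diagonal z + M)) (i : κ) : z i ∈ V := by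
  by_contra hi
  obtain ⟨j, -, hj⟩ := Finset.exists_max_image Finset.univ (fun k => V.valuation (z k))
    ⟨i, Finset.mem_univ i⟩
  have hc : 1 < V.valuation (z j) := by
    refine lt_of_lt_of_le ?_ (hj i (Finset.mem_univ i))
    rwa [← not_le, V.valuation_le_one_iff]
  have hc0 : z j ≠ 0 := by
    intro h
    rw [h, map_zero] at hc
    exact not_lt_zero hc
  have hv : V.valuation (z j) ≠ 0 := (Valuation.ne_zero_iff _).2 hc0
  have hcV : V.valuation (z j)⁻¹ < 1 := by
    rw [map_inv₀]
    exact inv_lt_one_of_one_lt₀ hc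
  have hz : ∀ k, (z j)⁻¹ * z k ∈ V := by
    intro k
    rw [← V.valuation_le_one_iff, map_mul, map_inv₀, inv_mul_le_one₀ (zero_lt_iff.2 hv)]
    exact hj k (Finset.mem_univ k)
  have hcm : (z j)⁻¹ ∈ V := (V.valuation_le_one_iff _).1 hcV.le
  let c : V := ⟨(z j)⁻¹, hcm⟩
  let N : Matrix κ κ V := diagonal (fun k => ⟨(z j)⁻¹ * z k, hz k⟩) +
    c • of (fun a b => (⟨M a b, hM a b⟩ : V))
  have hNK : N.map V.subtype = (z j)⁻¹ • (diagonal z + M) := by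
    ext a b
    by_cases hab : a = b
    · subst hab
      simp [N, c, mul_add]
    · simp [N, c, diagonal_apply_ne _ hab]
  have hNnil : IsNilpotent N := by
    have hinj : Function.Injective (V.subtype.mapMatrix : Matrix κ κ V →+* Matrix κ κ K) :=
      Matrix.map_injective V.subtype_injective
    rw [← IsNilpotent.map_iff hinj]
    change IsNilpotent (N.map V.subtype)
    rw [hNK]
    exact hnil.smul _
  have hres := hNnil.map (IsLocalRing.residue V).mapMatrix
  have hdiag : (IsLocalRing.residue V).mapMatrix N =
      diagonal (fun k => IsLocalRing.residue V ⟨(z j)⁻¹ * z k, hz k⟩) := by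
    have hcz : IsLocalRing.residue V c = 0 := by
      rw [IsLocalRing.residue_eq_zero_iff]
      exact (V.valuation_lt_one_iff c).2 hcV
    ext a b
    by_cases hab : a = b
    · subst hab
      simp [N, hcz]
    · simp [N, hcz, diagonal_apply_ne _ hab]
  rw [hdiag] at hres
  obtain ⟨e, he⟩ := hres
  rw [diagonal_pow] at he
  have h1 := congrFun (congrFun he j) j
  have h2 : (⟨(z j)⁻¹ * z j, hz j⟩ : V) = 1 := Subtype.ext (inv_mul_cancel₀ hc0)
  rw [diagonal_apply_eq, Pi.pow_apply, h2] at h1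
  simp at h1

/-- If `diag(z) + M` is nilpotent, then the `z i` are integral over the ring generated by the
entries of `M`. -/
theorem isIntegral_of_isNilpotent_diagonal_add {D κ : Type*} [CommRing D] [IsDomain D]
    [Fintype κ] [DecidableEq κ] {R : Type*} [CommRing R] [Algebra R D] (S : Subalgebra R D)
    (z : κ → D) (M : Matrix κ κ D)
    (hM : ∀ i j, M i j ∈ S) (hnil : IsNilpotent (Matrix.diagonal z + M)) (i : κ) :
    IsIntegral S (z i) := by
  let K := FractionRing D
  let f : S →+* K := (algebraMap D K).comp S.subtype
  have hf : Function.Injective (algebraMap D K) := IsFractionRing.injective D K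
  rw [← isIntegral_algebraMap_iff (B := K) hf]
  -- The integral closure of a subring of a field is the intersection of the valuation rings
  -- containing it.
  have h1 : algebraMap D K (z i) ∈
      (integralClosure (Subring.closure (f.range : Set K)) K).toSubring := by
    rw [← iInf_valuationSubring_superset, Subring.mem_iInf]
    rintro ⟨V, hV⟩
    refine V.mem_of_isNilpotent_diagonal_add (fun k => algebraMap D K (z k))
      (M.map (algebraMap D K)) (fun a b => hV ⟨⟨M a b, hM a b⟩, rfl⟩) ?_ i
    have := hnil.map (algebraMap D K).mapMatrix
    rw [map_add] at this
    simpa [Matrix.diagonal_map, Function.comp_def] using this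
  rw [Subring.closure_eq] at h1
  have h2 : IsIntegral f.range (algebraMap D K (z i)) := h1
  let _ : Algebra S f.range := f.rangeRestrict.toAlgebra
  have : IsScalarTower S f.range K := IsScalarTower.of_algebraMap_eq fun _ => rfl
  have : Algebra.IsIntegral S f.range := ⟨fun y => by
    obtain ⟨x, rfl⟩ := f.rangeRestrict_surjective y
    exact isIntegral_algebraMap⟩
  exact isIntegral_trans (R := S) _ h2

end Integrality

/-! ### Nilpotency as polynomial equations -/

theorem Matrix.isNilpotent_iff_charpoly_eq_X_pow {F m : Type*} [Field F] [Fintype m]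
    [DecidableEq m] (M : Matrix m m F) :
    IsNilpotent M ↔ M.charpoly = Polynomial.X ^ Fintype.card m := by
  refine ⟨fun h => sub_eq_zero.1 (Matrix.isNilpotent_charpoly_sub_pow_of_isNilpotent h).eq_zero,
    fun h => ⟨Fintype.card m, ?_⟩⟩
  have := M.aeval_self_charpoly
  rwa [h, map_pow, Polynomial.aeval_X] at this

theorem Matrix.isNilpotent_iff_pow_card_eq_zero {F m : Type*} [Field F] [Fintype m]
    [DecidableEq m] (M : Matrix m m F) : IsNilpotent M ↔ M ^ Fintype.card m = 0 := by
  refine ⟨fun h => ?_, fun h => ⟨_, h⟩⟩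
  have := M.aeval_self_charpoly
  rwa [M.isNilpotent_iff_charpoly_eq_X_pow.1 h, map_pow, Polynomial.aeval_X] at this

theorem Matrix.isNilpotent_iff_charpoly_coeff_eq_zero {F m : Type*} [Field F] [Fintype m]
    [DecidableEq m] (M : Matrix m m F) :
    IsNilpotent M ↔ ∀ k < Fintype.card m, M.charpoly.coeff k = 0 := by
  rw [M.isNilpotent_iff_charpoly_eq_X_pow]
  constructor
  · intro h k hk
    rw [h, Polynomial.coeff_X_pow, if_neg hk.ne]
  · intro h
    ext k
    rw [Polynomial.coeff_X_pow]
    rcases lt_trichotomy k (Fintype.card m) with hk | hk | hk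
    · rw [h k hk, if_neg hk.ne]
    · subst hk
      rw [if_pos rfl, ← M.charpoly_natDegree_eq_dim]
      exact M.charpoly_monic
    · rw [if_neg hk.ne', Polynomial.coeff_eq_zero_of_natDegree_lt]
      rwa [M.charpoly_natDegree_eq_dim]

/-! ### Polynomial maps on affine space -/

section PolynomialMaps

variable {F : Type*} [Field F] {ι κ : Type*}

/-- The algebra of polynomial functions on the affine space `F^ι`. -/
noncomputable def affinePolynomials (F ι : Type*) [Field F] : Subalgebra F ((ι → F) → F) :=
  (MvPolynomial.aeval fun (i : ι) (x : ι → F) => x i : MvPolynomial ι F →ₐ[F] (ι → F) → F).range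

theorem mem_affinePolynomials {f : (ι → F) → F} :
    f ∈ affinePolynomials F ι ↔ ∃ p : MvPolynomial ι F, ∀ x, MvPolynomial.eval x p = f x := by
  have h : ∀ (p : MvPolynomial ι F) (x : ι → F),
      (MvPolynomial.aeval fun (i : ι) (x : ι → F) => x i : MvPolynomial ι F →ₐ[F] (ι → F) → F) p x
        = MvPolynomial.eval x p := by
    intro p x
    induction p using MvPolynomial.induction_on with
    | C a => simp
    | add p q hp hq => simp [hp, hq]
    | mul_X p i hp => simp [hp]
  constructor
  · rintro ⟨p, rfl⟩
    exact ⟨p, fun x => (h p x).symm⟩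
  · rintro ⟨p, hp⟩
    exact ⟨p, funext fun x => (h p x).trans (hp x)⟩

/-- A map from an affine space to a vector space is polynomial if its composites with all linear
functionals are. -/
def IsPolynomialMap {W : Type*} [AddCommGroup W] [Module F W] (f : (ι → F) → W) : Prop :=
  ∀ l : W →ₗ[F] F, (fun x => l (f x)) ∈ affinePolynomials F ι

namespace IsPolynomialMap

variable {W W' : Type*} [AddCommGroup W] [Module F W] [AddCommGroup W'] [Module F W']

theorem mem {f : (ι → F) → F} (hf : IsPolynomialMap f) : f ∈ affinePolynomials F ι :=
  hf LinearMap.id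

theorem of_mem {f : (ι → F) → F} (hf : f ∈ affinePolynomials F ι) : IsPolynomialMap f := by
  intro l
  have : (fun x => l (f x)) = l 1 • f := by
    ext x
    rw [← mul_one (f x), ← smul_eq_mul, map_smul, Pi.smul_apply, smul_eq_mul, smul_eq_mul, mul_comm]
  rw [this]
  exact Subalgebra.smul_mem _ hf _

theorem linear_comp {f : (ι → F) → W} (hf : IsPolynomialMap f) (L : W →ₗ[F] W') :
    IsPolynomialMap fun x => L (f x) := fun l => hf (l ∘ₗ L)

theorem const (w : W) : IsPolynomialMap fun _ : ι → F => w := fun l =>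
  (affinePolynomials F ι).algebraMap_mem (l w)

theorem sum {α : Type*} (s : Finset α) {f : α → (ι → F) → W}
    (hf : ∀ a ∈ s, IsPolynomialMap (f a)) : IsPolynomialMap fun x => ∑ a ∈ s, f a x := fun l => by
  have : (fun x => l (∑ a ∈ s, f a x)) = ∑ a ∈ s, fun x => l (f a x) := by
    ext x
    simp
  rw [this]
  exact sum_mem fun a ha => hf a ha l

theorem smul {c : (ι → F) → F} {f : (ι → F) → W} (hc : IsPolynomialMap c)
    (hf : IsPolynomialMap f) : IsPolynomialMap fun x => c x • f x := fun l => by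
  simp only [map_smul, smul_eq_mul]
  exact mul_mem hc.mem (hf l)

theorem mul {R : Type*} [Ring R] [Algebra F R] [FiniteDimensional F R] {f g : (ι → F) → R}
    (hf : IsPolynomialMap f) (hg : IsPolynomialMap g) : IsPolynomialMap fun x => f x * g x := by
  let b := Module.finBasis F R
  have : (fun x => f x * g x) =
      fun x => ∑ i, ∑ j, (b.coord i (f x) * b.coord j (g x)) • (b i * b j) := by
    ext x
    conv_lhs => rw [← b.sum_repr (f x), ← b.sum_repr (g x), Finset.sum_mul_sum]
    simp only [smul_mul_smul_comm, Module.Basis.coord_apply]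
  rw [this]
  refine sum _ fun i _ => sum _ fun j _ => smul (of_mem ?_) (const _)
  exact mul_mem (hf _) (hg _)

theorem pow {R : Type*} [Ring R] [Algebra F R] [FiniteDimensional F R] {f : (ι → F) → R}
    (hf : IsPolynomialMap f) (k : ℕ) : IsPolynomialMap fun x => f x ^ k := by
  induction k with
  | zero => simpa using const (ι := ι) (F := F) (1 : R)
  | succ k ih => simpa only [pow_succ] using ih.mul hf

theorem linearMap [Finite ι] (L : (ι → F) →ₗ[F] W) : IsPolynomialMap L := fun l => by
  classical
  have := Fintype.ofFinite ι
  refine mem_affinePolynomials.2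
    ⟨∑ i, MvPolynomial.C (l (L (Pi.single i 1))) * MvPolynomial.X i, fun x => ?_⟩
  have h : l (L x) = ∑ i, x i * l (L (Pi.single i 1)) := by
    conv_lhs => rw [pi_eq_sum_univ' x]
    simp only [map_sum, map_smul, smul_eq_mul]
  rw [h]
  simp [mul_comm]

theorem comp {f : (ι → F) → κ → F} (hf : IsPolynomialMap f) {g : (κ → F) → W}
    (hg : IsPolynomialMap g) : IsPolynomialMap fun x => g (f x) := fun l => by
  obtain ⟨p, hp⟩ := mem_affinePolynomials.1 (hg l)
  choose q hq using fun k => mem_affinePolynomials.1 (hf (LinearMap.proj k))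
  refine mem_affinePolynomials.2 ⟨MvPolynomial.bind₁ q p, fun x => ?_⟩
  rw [← hp, MvPolynomial.eval, MvPolynomial.eval₂Hom_bind₁]
  congr 2
  ext k
  exact hq k x

theorem pi [Finite κ] {f : (ι → F) → κ → W} (hf : ∀ k, IsPolynomialMap fun x => f x k) :
    IsPolynomialMap f := by
  classical
  have := Fintype.ofFinite κ
  have h : f = fun x => ∑ k, LinearMap.single F (fun _ => W) k (f x k) := by
    ext x k
    simp
  rw [h]
  exact sum _ fun k _ => (hf k).linear_comp _

theorem charpoly_coeff {m : Type*} [Fintype m] [DecidableEq m] {f : (ι → F) → Matrix m m F}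
    (hf : IsPolynomialMap f) (k : ℕ) : IsPolynomialMap fun x => (f x).charpoly.coeff k := by
  have h : (fun x => (f x).charpoly.coeff k) =
      fun x => MvPolynomial.eval (fun ij : m × m => f x ij.1 ij.2)
        ((Matrix.charpoly.univ F m).coeff k) := by
    ext x
    have := Matrix.charpoly.univ_coeff_eval₂Hom m (RingHom.id F) (fun ij : m × m => f x ij.1 ij.2) k
    exact this.symm
  rw [h]
  refine comp (f := fun x => fun ij : m × m => f x ij.1 ij.2)
    (pi fun ij => hf.linear_comp (Matrix.entryLinearMap F F ij.1 ij.2))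
    (of_mem (mem_affinePolynomials.2 ⟨_, fun x => rfl⟩))

theorem det {m : Type*} [Fintype m] [DecidableEq m] {f : (ι → F) → Matrix m m F}
    (hf : IsPolynomialMap f) : IsPolynomialMap fun x => (f x).det := by
  simp only [Matrix.det_eq_sign_charpoly_coeff]
  exact (const ((-1 : F) ^ Fintype.card m)).mul (hf.charpoly_coeff 0)

theorem exists_eval_comp {f : (ι → F) → κ → F} (hf : IsPolynomialMap f) :
    ∃ φ : MvPolynomial κ F →ₐ[F] MvPolynomial ι F,
      ∀ p x, MvPolynomial.eval x (φ p) = MvPolynomial.eval (f x) p := by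
  choose q hq using fun k => mem_affinePolynomials.1 (hf (LinearMap.proj k))
  refine ⟨MvPolynomial.bind₁ q, fun p x => ?_⟩
  rw [MvPolynomial.eval, MvPolynomial.eval₂Hom_bind₁]
  congr 2
  ext k
  exact hq k x

theorem of_matrix {m m' : Type*} [Finite m] [Finite m'] {f : (ι → F) → Matrix m m' F}
    (hf : ∀ i j, IsPolynomialMap fun x => f x i j) : IsPolynomialMap f := by
  have h : IsPolynomialMap (W := m → m' → F) f := pi fun i => pi fun j => hf i j
  exact h.linear_comp (Matrix.ofLinearEquiv F : (m → m' → F) ≃ₗ[F] Matrix m m' F).toLinearMap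

end IsPolynomialMap

open MvPolynomial in
theorem mem_vanishingIdeal_iff_eval {S : Set (ι → F)} {p : MvPolynomial ι F} :
    p ∈ vanishingIdeal F S ↔ ∀ x ∈ S, eval x p = 0 := by
  simp [aeval_eq_eval]

open MvPolynomial in
/-- The vanishing ideal of a set parametrized by a nonempty principal open subset of an affine
space is prime. -/
theorem isPrime_vanishingIdeal_of_parametrization [Infinite F] {S : Set (κ → F)}
    {f : (ι → F) → κ → F} (hf : IsPolynomialMap f) {d : (ι → F) → F} (hd : IsPolynomialMap d)
    (hS : ∀ s ∈ S, ∃ x, f x = s) (hdS : ∀ x, d x ≠ 0 → f x ∈ S) (hd0 : ∃ x, d x ≠ 0) :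
    (vanishingIdeal F S : Ideal (MvPolynomial κ F)).IsPrime := by
  obtain ⟨φ, hφ⟩ := hf.exists_eval_comp
  obtain ⟨δ, hδ⟩ := mem_affinePolynomials.1 hd.mem
  have hmem : ∀ p, φ p = 0 → p ∈ vanishingIdeal F S := by
    intro p hp
    rw [mem_vanishingIdeal_iff_eval]
    intro s hs
    obtain ⟨x, rfl⟩ := hS s hs
    rw [← hφ, hp, map_zero]
  obtain ⟨x₀, hx₀⟩ := hd0
  have hδ0 : δ ≠ 0 := by
    rintro rfl
    exact hx₀ (by rw [← hδ, map_zero])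
  refine ⟨fun h => ?_, fun {p q} hpq => ?_⟩
  · have h1 := mem_vanishingIdeal_iff_eval.1 ((Ideal.eq_top_iff_one _).1 h) _ (hdS x₀ hx₀)
    rw [map_one] at h1
    exact one_ne_zero h1
  -- The product vanishes on f x whenever d x ≠ 0, so δ times its pullback is the zero polynomial, F
  -- being infinite. A factor with zero pullback vanishes on all of S, since S lies in the full
  -- image of f.
  · have h0 : δ * (φ p * φ q) = 0 := by
      apply MvPolynomial.funext
      intro x
      rw [map_mul, ← map_mul φ, hφ, hδ, map_zero]
      by_cases hx : d x = 0
      · rw [hx, zero_mul]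
      · rw [mem_vanishingIdeal_iff_eval.1 hpq _ (hdS x hx), mul_zero]
    rcases mul_eq_zero.1 ((mul_eq_zero.1 h0).resolve_left hδ0) with h | h
    · exact Or.inl (hmem p h)
    · exact Or.inr (hmem q h)

end PolynomialMaps

/-! ### Comparison of dimensions through algebraic extensions -/

section DimensionComparison

variable {F : Type*} [Field F] {ι κ : Type*} [Fintype ι] [Fintype κ]

open MvPolynomial in
/-- A polynomial map which is dominant and generically finite on `Y` preserves the dimension. -/
theorem ringKrullDim_quotient_vanishingIdeal_eq {Y : Set (ι → F)} {S : Set (κ → F)}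
    [hY : (vanishingIdeal F Y : Ideal (MvPolynomial ι F)).IsPrime]
    [hSp : (vanishingIdeal F S : Ideal (MvPolynomial κ F)).IsPrime]
    {ψ : (ι → F) → κ → F} (hψ : IsPolynomialMap ψ)
    (hYS : ∀ p : MvPolynomial κ F, p ∈ (vanishingIdeal F S : Ideal (MvPolynomial κ F)) ↔
      ∀ y ∈ Y, eval (ψ y) p = 0)
    (hfin : ∀ i, ∃ d e : MvPolynomial κ F, d ∉ (vanishingIdeal F S : Ideal (MvPolynomial κ F)) ∧
      ∀ y, eval (ψ y) e = eval (ψ y) d * y i) :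
    ringKrullDim (MvPolynomial κ F ⧸ (vanishingIdeal F S : Ideal (MvPolynomial κ F))) =
      ringKrullDim (MvPolynomial ι F ⧸ (vanishingIdeal F Y : Ideal (MvPolynomial ι F))) := by
  obtain ⟨φ, hφ⟩ := hψ.exists_eval_comp
  have hcomap : (vanishingIdeal F S : Ideal (MvPolynomial κ F)) =
      Ideal.comap φ (vanishingIdeal F Y : Ideal (MvPolynomial ι F)) := by
    ext p
    rw [hYS, Ideal.mem_comap, mem_vanishingIdeal_iff_eval]
    simp only [hφ]
  let R := MvPolynomial κ F ⧸ (vanishingIdeal F S : Ideal (MvPolynomial κ F))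
  let D := MvPolynomial ι F ⧸ (vanishingIdeal F Y : Ideal (MvPolynomial ι F))
  let Φ : R →ₐ[F] D := Ideal.quotientMapₐ _ φ hcomap.le
  have hΦ : Function.Injective Φ := Ideal.quotientMap_injective' (H := hcomap.le) hcomap.ge
  let _ : Algebra R D := Φ.toRingHom.toAlgebra
  have : IsScalarTower F R D := IsScalarTower.of_algHom Φ
  have : FaithfulSMul R D := (faithfulSMul_iff_algebraMap_injective _ _).2 hΦ
  -- Each coordinate satisfies a linear equation d · y i = e over R with d nonzero, so the
  -- transcendence degrees agree.
  have halg : Algebra.IsAlgebraic R D := by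
    refine ⟨fun z => ?_⟩
    obtain ⟨p, rfl⟩ := Ideal.Quotient.mk_surjective z
    rw [← Subalgebra.mem_algebraicClosure]
    induction p using MvPolynomial.induction_on with
    | C a =>
      have : Ideal.Quotient.mk (vanishingIdeal F Y : Ideal (MvPolynomial ι F)) (C a) =
          algebraMap R D (algebraMap F R a) := by
        rw [← IsScalarTower.algebraMap_apply F R D]
        rfl
      rw [this]
      exact Subalgebra.algebraMap_mem _ _
    | add p q hp hq => rw [map_add]; exact add_mem hp hq
    | mul_X p i hp =>
      rw [map_mul]
      refine mul_mem hp ?_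
      obtain ⟨d, e, hd, he⟩ := hfin i
      rw [Subalgebra.mem_algebraicClosure]
      have hd0 : (Ideal.Quotient.mk (vanishingIdeal F S : Ideal (MvPolynomial κ F)) d) ≠ 0 := by
        rwa [Ne, Ideal.Quotient.eq_zero_iff_mem]
      refine ⟨Polynomial.C (Ideal.Quotient.mk _ d : R) * Polynomial.X -
        Polynomial.C (Ideal.Quotient.mk _ e : R), ?_, ?_⟩
      · intro h
        have := congrArg (Polynomial.coeff · 1) h
        simp at this
        exact hd0 this
      · rw [map_sub, map_mul, Polynomial.aeval_C, Polynomial.aeval_C, Polynomial.aeval_X,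
          sub_eq_zero]
        change Ideal.Quotient.mk _ (φ d) * Ideal.Quotient.mk _ (X i) = Ideal.Quotient.mk _ (φ e)
        rw [← map_mul, Ideal.Quotient.eq, mem_vanishingIdeal_iff_eval]
        intro y _
        rw [map_sub, map_mul, hφ, hφ, he, eval_X, sub_self]
  obtain ⟨s, hs, hs'⟩ := exists_ringKrullDim_eq_and_trdeg_eq F R
  obtain ⟨r, hr, hr'⟩ := exists_ringKrullDim_eq_and_trdeg_eq F D
  have h1 := lift_trdeg_add_eq F R D
  rw [hs', hr', trdeg_eq_zero] at h1
  simp only [Cardinal.lift_natCast, Cardinal.lift_zero, add_zero, Nat.cast_inj] at h1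
  change ringKrullDim R = ringKrullDim D
  rw [hs, hr, h1]

open MvPolynomial in
/-- If the matrices `diag(y) + ∑ x, y x • M x` are nilpotent for all `y ∈ Y`, then the diagonal
coordinates do not contribute to the dimension of `Y`. -/
theorem ringKrullDim_quotient_vanishingIdeal_le [DecidableEq ι] (Y : Set (ι ⊕ κ → F))
    [hY : (vanishingIdeal F Y : Ideal (MvPolynomial (ι ⊕ κ) F)).IsPrime]
    (M : κ → Matrix ι ι F)
    (hM : ∀ y ∈ Y, IsNilpotent (Matrix.diagonal (fun i => y (Sum.inl i)) +
      ∑ k, y (Sum.inr k) • M k)) :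
    ringKrullDim (MvPolynomial (ι ⊕ κ) F ⧸ (vanishingIdeal F Y : Ideal (MvPolynomial (ι ⊕ κ) F)))
      ≤ Fintype.card κ := by
  let I := (vanishingIdeal F Y : Ideal (MvPolynomial (ι ⊕ κ) F))
  let D := MvPolynomial (ι ⊕ κ) F ⧸ I
  let N : Matrix ι ι (MvPolynomial (ι ⊕ κ) F) := ∑ k, (X (Sum.inr k) : MvPolynomial (ι ⊕ κ) F) •
    (M k).map C
  let T : Matrix ι ι (MvPolynomial (ι ⊕ κ) F) := Matrix.diagonal (fun i => X (Sum.inl i)) + N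
  have hT : ∀ y, (eval y).mapMatrix T = Matrix.diagonal (fun i => y (Sum.inl i)) +
      ∑ k, y (Sum.inr k) • M k := by
    intro y
    ext i j
    by_cases hij : i = j
    · subst hij
      simp [T, N, Matrix.sum_apply]
    · simp [T, N, Matrix.sum_apply, Matrix.diagonal_apply_ne _ hij]
  -- Pointwise nilpotency on Y has the uniform exponent `Fintype.card ι`, so the generic matrix is
  -- nilpotent over the coordinate ring.
  have hTI : IsNilpotent ((Ideal.Quotient.mk I).mapMatrix T) := by
    refine ⟨Fintype.card ι, ?_⟩
    rw [← map_pow]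
    ext i j
    change Ideal.Quotient.mk I ((T ^ Fintype.card ι) i j) = 0
    rw [Ideal.Quotient.eq_zero_iff_mem, mem_vanishingIdeal_iff_eval]
    intro y hy
    have h1 : ((eval y).mapMatrix (T ^ Fintype.card ι)) i j = 0 := by
      rw [map_pow, hT, (Matrix.isNilpotent_iff_pow_card_eq_zero _).1 (hM y hy)]
      rfl
    exact h1
  let s : Set D := Set.range fun k => Ideal.Quotient.mk I (X (Sum.inr k))
  have hint : ∀ i, IsIntegral (Algebra.adjoin F s) (Ideal.Quotient.mk I (X (Sum.inl i)) : D) := by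
    refine isIntegral_of_isNilpotent_diagonal_add (Algebra.adjoin F s)
      (fun i => (Ideal.Quotient.mk I (X (Sum.inl i)) : D)) ((Ideal.Quotient.mk I).mapMatrix N) ?_ ?_
    · intro i j
      have : (Ideal.Quotient.mk I).mapMatrix N i j =
          ∑ k, Ideal.Quotient.mk I (X (Sum.inr k)) * algebraMap F D (M k i j) := by
        simp [N, Matrix.sum_apply]
        rfl
      rw [this]
      exact sum_mem fun k _ => mul_mem (Algebra.subset_adjoin ⟨k, rfl⟩) (Subalgebra.algebraMap_mem _ _)
    · convert hTI using 1
      simp only [T, map_add]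
      congr 1
      ext i j
      by_cases hij : i = j
      · subst hij; simp
      · simp [Matrix.diagonal_apply_ne _ hij]
  -- Hence the transcendence degree of D is at most the number of κ-coordinates.
  have halg : Algebra.IsAlgebraic (Algebra.adjoin F s) D := by
    refine ⟨fun z => ?_⟩
    obtain ⟨p, rfl⟩ := Ideal.Quotient.mk_surjective z
    rw [← Subalgebra.mem_algebraicClosure]
    induction p using MvPolynomial.induction_on with
    | C a => exact Subalgebra.algebraMap_mem _ (algebraMap F (Algebra.adjoin F s) a)
    | add p q hp hq => rw [map_add]; exact add_mem hp hq
    | mul_X p i hp =>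
      rw [map_mul]
      refine mul_mem hp ?_
      rcases i with i | k
      · exact (hint i).isAlgebraic
      · exact Subalgebra.algebraMap_mem _
          (⟨_, Algebra.subset_adjoin ⟨k, rfl⟩⟩ : Algebra.adjoin F s)
  obtain ⟨r, hr, hr'⟩ := exists_ringKrullDim_eq_and_trdeg_eq F D
  have h1 := Algebra.IsAlgebraic.trdeg_le_cardinalMk F s
  have h2 : Cardinal.mk s ≤ Fintype.card κ := by
    have : Cardinal.mk s = Nat.card s := by
      have : Finite s := Set.finite_range _
      rw [Nat.cast_card]
    rw [this, Nat.cast_le, ← Nat.card_eq_fintype_card]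
    exact Finite.card_range_le _
  rw [hr'] at h1
  change ringKrullDim D ≤ _
  rw [hr]
  exact_mod_cast h1.trans h2

end DimensionComparison

/-! ### Monomials in two commuting elements -/

section CommutingMonomials

variable {F R : Type*} [Field F] [Ring R] [Algebra F R] {A B : R}

theorem Commute.pow_mul_pow (h : Commute A B) (i j k l : ℕ) :
    Commute (A ^ i * B ^ j) (A ^ k * B ^ l) :=
  ((Commute.pow_pow (Commute.refl A) i k).mul_right (h.pow_pow i l)).mul_left
    ((h.symm.pow_pow j k).mul_right (Commute.pow_pow (Commute.refl B) j l))

theorem exists_pow_mul_pow_of_mem_closure (h : Commute A B) {x : R}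
    (hx : x ∈ Submonoid.closure {A, B}) : ∃ i j : ℕ, x = A ^ i * B ^ j := by
  induction hx using Submonoid.closure_induction with
  | mem x hx =>
    rcases hx with rfl | rfl
    · exact ⟨1, 0, by simp⟩
    · exact ⟨0, 1, by simp⟩
  | one => exact ⟨0, 0, by simp⟩
  | mul x y _ _ hx hy =>
    obtain ⟨i, j, rfl⟩ := hx
    obtain ⟨k, l, rfl⟩ := hy
    refine ⟨i + k, j + l, ?_⟩
    rw [pow_add, pow_add, mul_assoc, ← mul_assoc (B ^ j), (h.symm.pow_pow j k).eq]
    simp only [mul_assoc]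

theorem pow_mul_pow_mem_adjoin (i j : ℕ) : A ^ i * B ^ j ∈ Algebra.adjoin F {A, B} :=
  mul_mem (pow_mem (Algebra.subset_adjoin (by simp)) i)
    (pow_mem (Algebra.subset_adjoin (by simp)) j)

theorem isNilpotent_pow_mul_pow (h : Commute A B) (hA : IsNilpotent A) (hB : IsNilpotent B)
    {p : ℕ × ℕ} (hp : p ≠ (0, 0)) : IsNilpotent (A ^ p.1 * B ^ p.2) := by
  by_cases h1 : p.1 = 0
  · have h2 : p.2 ≠ 0 := fun h2 => hp (Prod.ext h1 h2)
    exact (h.pow_pow _ _).isNilpotent_mul_left (hB.pow_of_pos h2)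
  · exact (h.pow_pow _ _).isNilpotent_mul_right (hA.pow_of_pos h1)

theorem isNilpotent_sum_smul_pow_mul_pow (h : Commute A B) (hA : IsNilpotent A)
    (hB : IsNilpotent B) {κ : Type*} [Fintype κ] {p : κ → ℕ × ℕ} (hp : ∀ k, p k ≠ (0, 0))
    (c : κ → F) : IsNilpotent (∑ k, c k • (A ^ (p k).1 * B ^ (p k).2)) :=
  Commute.isNilpotent_sum (fun k _ => (isNilpotent_pow_mul_pow h hA hB (hp k)).smul _)
    fun _ _ _ _ => ((h.pow_mul_pow _ _ _ _).smul_left _).smul_right _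

theorem commute_sum_smul_pow_mul_pow (h : Commute A B) {κ : Type*} [Fintype κ] (p : κ → ℕ × ℕ)
    (c : κ → F) (i j : ℕ) : Commute (A ^ i * B ^ j) (∑ k, c k • (A ^ (p k).1 * B ^ (p k).2)) :=
  Commute.sum_right _ _ _ fun _ _ => (h.pow_mul_pow _ _ _ _).smul_right _

/-- A nilpotent combination of monomials in commuting nilpotents has no constant term. -/
theorem exists_eq_sum_ne_of_isNilpotent [Nontrivial R] (h : Commute A B) (hA : IsNilpotent A)
    (hB : IsNilpotent B) {κ : Type*} [Fintype κ] {p : κ → ℕ × ℕ} {P : κ → Prop}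
    [DecidablePred P] (k₀ : κ) (hP : ∀ k, P k ↔ k ≠ k₀) (hp₀ : p k₀ = (0, 0))
    (hp : ∀ k, P k → p k ≠ (0, 0)) {C : R} (hC : IsNilpotent C)
    (hspan : C ∈ Submodule.span F (Set.range fun k => A ^ (p k).1 * B ^ (p k).2)) :
    ∃ c : {k // P k} → F, C = ∑ k, c k • (A ^ (p k.1).1 * B ^ (p k.1).2) := by
  classical
  obtain ⟨c, hc⟩ := (Submodule.mem_span_range_iff_exists_fun F).1 hspan
  let N := ∑ k : {k // P k}, c k • (A ^ (p k.1).1 * B ^ (p k.1).2)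
  have hCN : C = c k₀ • 1 + N := by
    rw [← hc, ← Finset.add_sum_erase _ _ (Finset.mem_univ k₀), hp₀, pow_zero, pow_zero, mul_one]
    congr 1
    refine (Finset.sum_subtype _ (fun k => ?_) fun k : κ => c k • (A ^ (p k).1 * B ^ (p k).2))
    simp [hP]
  have hN : IsNilpotent N := isNilpotent_sum_smul_pow_mul_pow h hA hB
    (fun k : {k // P k} => hp k.1 k.2) _
  -- The constant term is a difference of commuting nilpotents, so a nilpotent scalar.
  have h1 : IsNilpotent (c k₀ • (1 : R)) := by
    have h2 : c k₀ • (1 : R) = C - N := by rw [hCN, add_sub_cancel_right]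
    rw [h2]
    refine Commute.isNilpotent_sub ?_ hC hN
    rw [hCN]
    exact ((Commute.one_left N).smul_left _).add_left (Commute.refl N)
  have h0 : c k₀ = 0 := by
    obtain ⟨m, hm⟩ := h1
    rw [smul_pow, one_pow] at hm
    exact eq_zero_of_pow_eq_zero ((smul_eq_zero.1 hm).resolve_right one_ne_zero)
  exact ⟨fun k => c k, by rw [hCN, h0, zero_smul, zero_add]⟩

end CommutingMonomials

/-! ### Monomial bases of F[A, B] -/

section MatrixMonomials

variable {F : Type*} [Field F] {n : ℕ} {A B : Matrix (Fin n) (Fin n) F}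

theorem mem_span_pow_mul_pow_of_mem_adjoin (h : Commute A B) (hA : IsNilpotent A)
    (hB : IsNilpotent B) {C : Matrix (Fin n) (Fin n) F} (hC : C ∈ Algebra.adjoin F {A, B}) :
    C ∈ Submodule.span F (Set.range fun k : Fin n × Fin n => A ^ (k.1 : ℕ) * B ^ (k.2 : ℕ)) := by
  rw [← Subalgebra.mem_toSubmodule, Algebra.adjoin_eq_span] at hC
  refine Submodule.span_le.2 ?_ hC
  intro x hx
  obtain ⟨i, j, rfl⟩ := exists_pow_mul_pow_of_mem_closure h hx
  have hpow : ∀ {M : Matrix (Fin n) (Fin n) F}, IsNilpotent M → ∀ {i : ℕ}, n ≤ i → M ^ i = 0 := by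
    intro M hM i hi
    have := (Matrix.isNilpotent_iff_pow_card_eq_zero M).1 hM
    rw [Fintype.card_fin] at this
    exact pow_eq_zero_of_le hi this
  by_cases hi : i < n
  · by_cases hj : j < n
    · exact Submodule.subset_span ⟨(⟨i, hi⟩, ⟨j, hj⟩), rfl⟩
    · rw [hpow hB (not_lt.1 hj), mul_zero]
      exact zero_mem _
  · rw [hpow hA (not_lt.1 hi), zero_mul]
    exact zero_mem _

/-- Gerstenhaber's bound leaves no room beyond n independent monomials. -/
theorem span_pow_mul_pow_eq_adjoin (h : Commute A B) (hA : IsNilpotent A) (hB : IsNilpotent B)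
    {p : Fin n → ℕ × ℕ} (hp : LinearIndependent F fun k => A ^ (p k).1 * B ^ (p k).2) :
    Submodule.span F (Set.range fun k => A ^ (p k).1 * B ^ (p k).2) =
      Subalgebra.toSubmodule (Algebra.adjoin F {A, B}) ∧
    Module.finrank F (Algebra.adjoin F ({A, B} : Set (Matrix (Fin n) (Fin n) F))) = n := by
  have hle : Submodule.span F (Set.range fun k => A ^ (p k).1 * B ^ (p k).2) ≤
      Subalgebra.toSubmodule (Algebra.adjoin F {A, B}) := by
    rw [Submodule.span_le]
    rintro _ ⟨k, rfl⟩
    exact pow_mul_pow_mem_adjoin _ _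
  have h1 := finrank_span_eq_card hp
  rw [Fintype.card_fin] at h1
  have h2 := (finrank_adjoin_pair_le_and_mem_of_commute h hA hB).1
  have h3 := Submodule.eq_of_le_of_finrank_le hle (h2.trans h1.ge)
  refine ⟨h3, ?_⟩
  rw [h3] at h1
  exact h1

end MatrixMonomials

/-! ### The nilpotent elements of the centralizer -/

section NilpotentCentralizer

variable {F : Type*} [Field F] {n : ℕ} {A : Matrix (Fin n) (Fin n) F}

/-- The nilpotent elements of the centralizer of a nilpotent matrix form the image of a polynomial
map defined on an affine space. -/
theorem exists_nilpotent_parametrization (hA : IsNilpotent A) :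
    ∃ Θ : matrixCentralizer A → matrixCentralizer A → matrixCentralizer A,
      (∀ g m, IsNilpotent (Θ g m)) ∧ (∀ B, IsNilpotent B → ∃ g m, Θ g m = B) ∧
      ∀ {ι : Type} (g m : (ι → F) → matrixCentralizer A), IsPolynomialMap g →
        IsPolynomialMap m → IsPolynomialMap fun x => Θ (g x) (m x) := by
  obtain ⟨β, hβ, -, htri⟩ := exists_centralizer_representation hA
  let T : Submodule F (matrixCentralizer A) :=
    { carrier := {m | ∀ i j, j ≤ i → β m i j = 0}
      add_mem' := fun {a b} ha hb i j hij => by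
        rw [map_add, Matrix.add_apply, ha i j hij, hb i j hij, add_zero]
      zero_mem' := fun i j _ => by rw [map_zero, Matrix.zero_apply]
      smul_mem' := fun c a ha i j hij => by
        rw [map_smul, Matrix.smul_apply, ha i j hij, smul_zero] }
  -- A linear projection onto T lets m range over the whole centralizer.
  obtain ⟨π, hπ⟩ := LinearMap.exists_extend (K := F) (V := matrixCentralizer A) (V' := T)
    (p := T) (LinearMap.id : T →ₗ[F] T)
  -- The adjugate of g up to sign, written by Cayley–Hamilton as a polynomial in g so that it stays
  -- in the centralizer.
  let q : matrixCentralizer A → matrixCentralizer A := fun g =>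
    Polynomial.aeval g g.1.charpoly.divX
  have hgq : ∀ g, g * q g = algebraMap F _ (-g.1.charpoly.coeff 0) := by
    intro g
    have h1 : Polynomial.aeval g g.1.charpoly = 0 := by
      apply Subtype.val_injective
      rw [← Subalgebra.coe_val, ← Polynomial.aeval_algHom_apply]
      exact Matrix.aeval_self_charpoly g.1
    rw [← Polynomial.X_mul_divX_add g.1.charpoly, map_add, map_mul, Polynomial.aeval_X,
      Polynomial.aeval_C] at h1
    rw [map_neg]
    exact eq_neg_of_add_eq_zero_left h1
  have hqg : ∀ g, q g * g = algebraMap F _ (-g.1.charpoly.coeff 0) := by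
    intro g
    rw [← hgq g]
    have h1 : q g * Polynomial.aeval g (Polynomial.X : Polynomial F) =
        Polynomial.aeval g (Polynomial.X : Polynomial F) * q g := by
      rw [← map_mul, ← map_mul, mul_comm]
    rwa [Polynomial.aeval_X] at h1
  refine ⟨fun g m => g * π m * q g, ?_, ?_, ?_⟩
  · intro g m
    have hm : IsNilpotent (π m : matrixCentralizer A) := by
      rw [← hβ]
      exact Matrix.isNilpotent_of_strictly_upper_triangular (π m).2
    obtain ⟨k, hk⟩ := hm
    -- Since q g * g is scalar, the powers telescope, so nilpotency holds even for singular g.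
    have hpow : ∀ k : ℕ, (g * π m * q g) ^ (k + 1) =
        (-g.1.charpoly.coeff 0) ^ k • (g * (π m : matrixCentralizer A) ^ (k + 1) * q g) := by
      intro k
      induction k with
      | zero => simp
      | succ k ih =>
        rw [pow_succ, ih, smul_mul_assoc, pow_succ (-g.1.charpoly.coeff 0), mul_smul]
        congr 1
        rw [show g * (π m : matrixCentralizer A) ^ (k + 1) * q g * (g * π m * q g) =
          g * (π m : matrixCentralizer A) ^ (k + 1) * (q g * g) * π m * q g by
            simp only [mul_assoc], hqg, pow_succ _ (k + 1), Algebra.algebraMap_eq_smul_one]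
        simp only [mul_smul_comm, smul_mul_assoc, mul_one, mul_assoc]
    refine ⟨k + 1, ?_⟩
    rw [hpow, pow_succ, hk, zero_mul, mul_zero, zero_mul, smul_zero]
  · intro B hB
    obtain ⟨g, h, m, hgh, hhg, rfl, hm⟩ := htri B hB
    set s := -g.1.charpoly.coeff 0 with hs
    have hq : q g = s • h := by
      calc q g = h * g * q g := by rw [hhg, one_mul]
        _ = s • h := by
          rw [mul_assoc, hgq, Algebra.algebraMap_eq_smul_one, mul_smul_comm, mul_one]
    have hs0 : s ≠ 0 := by
      intro h0
      have hdet : g.1.det = 0 := by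
        rw [Matrix.det_eq_sign_charpoly_coeff, neg_eq_zero.1 (hs.symm.trans h0), mul_zero]
      have h1 := congrArg (fun M : matrixCentralizer A => M.1.det) hgh
      simp only [MulMemClass.coe_mul, Matrix.det_mul, hdet, zero_mul, OneMemClass.coe_one,
        Matrix.det_one] at h1
      exact zero_ne_one h1
    -- For invertible g, q g = s g⁻¹; the factor s⁻¹ compensates.
    refine ⟨g, s⁻¹ • m, ?_⟩
    have hπm : (π (s⁻¹ • m) : matrixCentralizer A) = s⁻¹ • m := by
      have := LinearMap.congr_fun hπ (⟨s⁻¹ • m, T.smul_mem _ hm⟩ : T)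
      exact congrArg Subtype.val this
    change g * (π (s⁻¹ • m) : matrixCentralizer A) * q g = g * m * h
    rw [hπm, hq, mul_smul_comm, mul_smul_comm, smul_mul_assoc, smul_smul, mul_inv_cancel₀ hs0,
      one_smul]
  · intro ι g m hg hm
    have hgv : IsPolynomialMap fun x => (g x).1 := hg.linear_comp (matrixCentralizer A).val.toLinearMap
    have hc : ∀ k : ℕ, IsPolynomialMap fun x => (g x).1.charpoly.coeff (k + 1) := fun k =>
      hgv.charpoly_coeff (k + 1)
    have hp : ∀ k : ℕ, IsPolynomialMap fun x => g x ^ k := fun k => hg.pow k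
    have hq : IsPolynomialMap fun x => q (g x) := by
      have : (fun x => q (g x)) = fun x => ∑ k ∈ Finset.range (n + 1),
          ((g x).1.charpoly.coeff (k + 1)) • (g x) ^ k := by
        ext1 x
        simp only [q]
        rw [Polynomial.aeval_eq_sum_range' (n := n + 1)]
        · simp only [Polynomial.coeff_divX]
        · refine Nat.lt_succ_of_le ((Polynomial.natDegree_divX_le).trans ?_)
          rw [Matrix.charpoly_natDegree_eq_dim, Fintype.card_fin]
      rw [this]
      refine IsPolynomialMap.sum _ (f := fun k x => (g x).1.charpoly.coeff (k + 1) • (g x) ^ k)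
        fun k _ => ?_
      exact IsPolynomialMap.smul (hc k) (hp k)
    have hm' : IsPolynomialMap fun x => (π (m x) : matrixCentralizer A) :=
      hm.linear_comp (T.subtype ∘ₗ π : matrixCentralizer A →ₗ[F] matrixCentralizer A)
    have hgm : IsPolynomialMap fun x => g x * (π (m x) : matrixCentralizer A) := hg.mul hm'
    exact hgm.mul hq

/-- Coordinates on the centralizer of a nilpotent matrix for which the nilpotent cone is cut out by
`dim ker A` equations and is finite over the last coordinates. -/
theorem exists_centralizer_basis (hA : IsNilpotent A) :
    ∃ (t r : ℕ) (b : Module.Basis (Fin t ⊕ Fin r) F (matrixCentralizer A))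
      (β : matrixCentralizer A →ₐ[F] Matrix (Fin t) (Fin t) F),
      t = Module.finrank F (LinearMap.ker (Matrix.toLin' A)) ∧
      (∀ B, IsNilpotent (β B) ↔ IsNilpotent B) ∧
      ∀ i, β (b (Sum.inl i)) = Matrix.single i i 1 := by
  obtain ⟨β, hβ, hE, -⟩ := exists_centralizer_representation hA
  choose E hE using hE
  have hli : LinearIndependent F E := by
    apply LinearIndependent.of_comp β.toLinearMap
    rw [Fintype.linearIndependent_iff]
    intro c hc i
    have h1 := congrFun (congrFun hc i) i
    simp only [Function.comp_apply, AlgHom.toLinearMap_apply, hE, Matrix.sum_apply,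
      Matrix.smul_apply, Matrix.zero_apply, Matrix.single_apply] at h1
    simpa using h1
  let b := Module.Basis.sumExtend hli
  have hfin : Finite (Fin (Module.finrank F (LinearMap.ker (Matrix.toLin' A))) ⊕
      (Module.Basis.sumExtendIndex hli)) := Module.Finite.finite_basis b
  have : Finite (Module.Basis.sumExtendIndex hli) := hfin.of_injective (Sum.inr : _ → _ ⊕ _) Sum.inr_injective
  let e := Finite.equivFin (Module.Basis.sumExtendIndex hli)
  refine ⟨_, _, b.reindex ((Equiv.refl _).sumCongr e), β, rfl, hβ, fun i => ?_⟩
  rw [← hE i]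
  congr 1
  have : b (Sum.inl i) = E i := by
    simp only [b, Module.Basis.sumExtend, Module.Basis.reindex_apply, Module.Basis.extend_apply_self]
    rfl
  rw [Module.Basis.reindex_apply]
  exact this

end NilpotentCentralizer

/-! ### Parametrization of D₂(A) and irreducibility -/

section PairParametrization

variable {F : Type*} [Field F] {n : ℕ} {A : Matrix (Fin n) (Fin n) F}

theorem isNilpotent_centralizer_iff {B : matrixCentralizer A} :
    IsNilpotent B.1 ↔ IsNilpotent B :=
  IsNilpotent.map_iff (f := (matrixCentralizer A).val) Subtype.val_injective

theorem IsPolynomialMap.coords {ι : Type*} {B C : (ι → F) → Matrix (Fin n) (Fin n) F}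
    (hB : IsPolynomialMap B) (hC : IsPolynomialMap C) :
    IsPolynomialMap fun x => (⟨B x, C x⟩ : MatrixPair F n).coords := by
  refine IsPolynomialMap.pi fun k => ?_
  rcases k with ⟨i, j⟩ | ⟨i, j⟩
  · exact hB.linear_comp (Matrix.entryLinearMap F F i j)
  · exact hC.linear_comp (Matrix.entryLinearMap F F i j)

theorem IsPolynomialMap.pow_mul_pow {ι : Type*} {B : (ι → F) → Matrix (Fin n) (Fin n) F}
    (hB : IsPolynomialMap B) (p : ℕ × ℕ) : IsPolynomialMap fun x => A ^ p.1 * B x ^ p.2 :=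
  (IsPolynomialMap.const (A ^ p.1)).mul (hB.pow p.2)

theorem IsPolynomialMap.sum_smul_pow_mul_pow {ι κ : Type*} [Fintype κ]
    {B : (ι → F) → Matrix (Fin n) (Fin n) F} (hB : IsPolynomialMap B) (p : κ → ℕ × ℕ)
    {c : κ → (ι → F) → F} (hc : ∀ k, IsPolynomialMap (c k)) :
    IsPolynomialMap fun x => ∑ k, c k x • (A ^ (p k).1 * B x ^ (p k).2) :=
  IsPolynomialMap.sum _ fun k _ => (hc k).smul (hB.pow_mul_pow (p k))

theorem IsPolynomialMap.coord {ι : Type*} (i : ι) : IsPolynomialMap fun x : ι → F => x i :=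
  IsPolynomialMap.of_mem (mem_affinePolynomials.2 ⟨MvPolynomial.X i, fun x => by simp⟩)

theorem mem_D₂_of_isNilpotent (hA : IsNilpotent A) {B : matrixCentralizer A} (hB : IsNilpotent B)
    (hAB : Module.finrank F (Algebra.adjoin F ({A, B.1} : Set (Matrix (Fin n) (Fin n) F))) = n)
    {κ : Type*} [Fintype κ] {p : κ → ℕ × ℕ} (hp : ∀ k, p k ≠ (0, 0)) (c : κ → F) :
    (⟨B.1, ∑ k, c k • (A ^ (p k).1 * B.1 ^ (p k).2)⟩ : MatrixPair F n) ∈ D₂ A := by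
  have hcomm := mem_matrixCentralizer_iff.1 B.2
  have hB' := isNilpotent_centralizer_iff.2 hB
  refine ⟨⟨B.2, mem_matrixCentralizer_iff.2 ?_, ?_, hB', ?_⟩, hAB⟩
  · simpa using commute_sum_smul_pow_mul_pow hcomm p c 1 0
  · have := commute_sum_smul_pow_mul_pow hcomm p c 0 1
    rw [pow_zero, pow_one, one_mul] at this
    exact this.eq
  · exact isNilpotent_sum_smul_pow_mul_pow hcomm hA hB' hp c

theorem mem_adjoin_of_mem_D₂ (hA : IsNilpotent A) {P : MatrixPair F n} (hP : P ∈ D₂ A) :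
    P.C ∈ Algebra.adjoin F ({A, P.B} : Set (Matrix (Fin n) (Fin n) F)) := by
  obtain ⟨⟨hB, hC, hBC, hBn, -⟩, hfin⟩ := hP
  exact (finrank_adjoin_pair_le_and_mem_of_commute (mem_matrixCentralizer_iff.1 hB) hA hBn).2 hfin
    _ (mem_matrixCentralizer_iff.1 hC) hBC

/-- The matrix of coefficients of the monomials `A ^ i * B ^ j`, for `(i, j)` in a family `p`, with
respect to a family of linear functionals. -/
def monomialMatrix (A : Matrix (Fin n) (Fin n) F) (p : Fin n → ℕ × ℕ)
    (L : Matrix (Fin n) (Fin n) F →ₗ[F] (Fin n → F)) (B : Matrix (Fin n) (Fin n) F) :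
    Matrix (Fin n) (Fin n) F :=
  Matrix.of fun l k => L (A ^ (p k).1 * B ^ (p k).2) l

variable {p : Fin n → ℕ × ℕ} {L : Matrix (Fin n) (Fin n) F →ₗ[F] (Fin n → F)}

theorem IsPolynomialMap.monomialMatrix {ι : Type*} {B : (ι → F) → Matrix (Fin n) (Fin n) F}
    (hB : IsPolynomialMap B) (A : Matrix (Fin n) (Fin n) F) (p : Fin n → ℕ × ℕ)
    (L : Matrix (Fin n) (Fin n) F →ₗ[F] (Fin n → F)) :
    IsPolynomialMap fun x => monomialMatrix A p L (B x) := by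
  refine IsPolynomialMap.of_matrix fun l k => ?_
  exact (hB.pow_mul_pow (p k)).linear_comp (LinearMap.proj l ∘ₗ L)

theorem linearIndependent_of_det_monomialMatrix_ne_zero {B : Matrix (Fin n) (Fin n) F}
    (h : (monomialMatrix A p L B).det ≠ 0) :
    LinearIndependent F fun k => A ^ (p k).1 * B ^ (p k).2 := by
  apply LinearIndependent.of_comp L
  have := Matrix.linearIndependent_cols_iff_isUnit.2
    ((Matrix.isUnit_iff_isUnit_det _).2 (isUnit_iff_ne_zero.2 h))
  exact this

/-- The coefficients of a combination of the monomials are recovered by Cramer's rule. -/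
theorem adjugate_monomialMatrix_mulVec (B : Matrix (Fin n) (Fin n) F) (c : Fin n → F) :
    (monomialMatrix A p L B).adjugate.mulVec (L (∑ k, c k • (A ^ (p k).1 * B ^ (p k).2))) =
      (monomialMatrix A p L B).det • c := by
  have h1 : L (∑ k, c k • (A ^ (p k).1 * B ^ (p k).2)) = (monomialMatrix A p L B).mulVec c := by
    ext l
    simp [monomialMatrix, Matrix.mulVec, dotProduct, mul_comm]
  rw [h1, Matrix.mulVec_mulVec, Matrix.adjugate_mul, Matrix.smul_mulVec, Matrix.one_mulVec]

/-- With L a left inverse of the map from coefficients to combinations of the independent monomials,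
the matrix is the identity at the chosen B. -/
theorem exists_det_monomialMatrix_ne_zero (hn : 1 ≤ n) (hA : IsNilpotent A) :
    ∃ (p : Fin n → ℕ × ℕ) (k₀ : Fin n) (L : Matrix (Fin n) (Fin n) F →ₗ[F] (Fin n → F)),
      p k₀ = (0, 0) ∧ (∀ k, k ≠ k₀ → p k ≠ (0, 0)) ∧
      ∃ B : matrixCentralizer A, IsNilpotent B ∧ (monomialMatrix A p L B.1).det ≠ 0 := by
  obtain ⟨B, p, k₀, hAB, hB, hp, hli⟩ := exists_linearIndependent_monomials hn hA
  obtain ⟨L, hL⟩ := LinearMap.exists_leftInverse_of_injective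
    (Fintype.linearCombination F fun k => A ^ (p k).1 * B ^ (p k).2)
    (LinearMap.ker_eq_bot.2 hli.fintypeLinearCombination_injective)
  refine ⟨p, k₀, L, hp, fun k hk hpk => hk (hli.injective ?_), ⟨B, mem_matrixCentralizer_iff.2 hAB⟩,
    isNilpotent_centralizer_iff.1 hB, ?_⟩
  · rw [hpk, hp]
  · have : monomialMatrix A p L B = 1 := by
      ext l k
      have h1 := congrFun (LinearMap.congr_fun hL (Pi.single k 1)) l
      rw [LinearMap.comp_apply, Fintype.linearCombination_apply_single, one_smul] at h1
      simpa [monomialMatrix, Matrix.one_apply, Pi.single_apply] using h1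
    rw [this, Matrix.det_one]
    exact one_ne_zero

theorem finrank_adjoin_eq_of_det_monomialMatrix_ne_zero (hA : IsNilpotent A)
    {B : matrixCentralizer A} (hB : IsNilpotent B) (h : (monomialMatrix A p L B.1).det ≠ 0) :
    Module.finrank F (Algebra.adjoin F ({A, B.1} : Set (Matrix (Fin n) (Fin n) F))) = n :=
  (span_pow_mul_pow_eq_adjoin (mem_matrixCentralizer_iff.1 B.2) hA
    (isNilpotent_centralizer_iff.2 hB) (linearIndependent_of_det_monomialMatrix_ne_zero h)).2

theorem nontrivial_matrix_of_pos {F : Type*} [Field F] {n : ℕ} (hn : 1 ≤ n) :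
    Nontrivial (Matrix (Fin n) (Fin n) F) := by
  have : Nonempty (Fin n) := ⟨⟨0, hn⟩⟩
  infer_instance

/-- The parametrization uses all monomials with exponents below n except 1, and not just the n
chosen ones, so that it reaches every pair in D₂(A), including those where the chosen ones are
dependent. The determinant for the chosen ones defines an open set of parameters landing in D₂(A).
-/
theorem isPrime_pairIdeal_D₂ [Infinite F] (hn : 1 ≤ n) (hA : IsNilpotent A) :
    (pairIdeal (D₂ A)).IsPrime := by
  obtain ⟨Θ, hΘ, hΘs, hΘp⟩ := exists_nilpotent_parametrization hA
  obtain ⟨p, k₀, L, hp₀, hp, B₀, hB₀, hδ⟩ := exists_det_monomialMatrix_ne_zero hn hA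
  let b := Module.finBasis F (matrixCentralizer A)
  let τ := Fin (Module.finrank F (matrixCentralizer A))
  let κ := {k : Fin n × Fin n // k ≠ (⟨0, hn⟩, ⟨0, hn⟩)}
  let m : Fin n × Fin n → ℕ × ℕ := fun k => (k.1, k.2)
  have hm : ∀ k : Fin n × Fin n, k ≠ (⟨0, hn⟩, ⟨0, hn⟩) → m k ≠ (0, 0) := by
    intro k hk h
    exact hk (Prod.ext (Fin.ext (congrArg Prod.fst h)) (Fin.ext (congrArg Prod.snd h)))
  let G : ((τ ⊕ τ) ⊕ κ → F) → matrixCentralizer A := fun x =>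
    b.equivFun.symm fun i => x (Sum.inl (Sum.inl i))
  let M : ((τ ⊕ τ) ⊕ κ → F) → matrixCentralizer A := fun x =>
    b.equivFun.symm fun i => x (Sum.inl (Sum.inr i))
  have hG : IsPolynomialMap G := IsPolynomialMap.linearMap
    (b.equivFun.symm.toLinearMap ∘ₗ LinearMap.funLeft F F fun i : τ => Sum.inl (Sum.inl i))
  have hM : IsPolynomialMap M := IsPolynomialMap.linearMap
    (b.equivFun.symm.toLinearMap ∘ₗ LinearMap.funLeft F F fun i : τ => Sum.inl (Sum.inr i))
  have hsurj : ∀ B : matrixCentralizer A, IsNilpotent B → ∀ c : κ → F,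
      ∃ x : (τ ⊕ τ) ⊕ κ → F, Θ (G x) (M x) = B ∧ ∀ k, x (Sum.inr k) = c k := by
    intro B hB c
    obtain ⟨g, m, rfl⟩ := hΘs B hB
    refine ⟨Sum.elim (Sum.elim (b.equivFun g) (b.equivFun m)) c, ?_, fun k => rfl⟩
    change Θ (b.equivFun.symm (b.equivFun g)) (b.equivFun.symm (b.equivFun m)) = _
    rw [LinearEquiv.symm_apply_apply, LinearEquiv.symm_apply_apply]
  have hB : IsPolynomialMap fun x => Θ (G x) (M x) := hΘp G M hG hM
  have hB' : IsPolynomialMap fun x => (Θ (G x) (M x)).1 :=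
    hB.linear_comp (matrixCentralizer A).val.toLinearMap
  refine isPrime_vanishingIdeal_of_parametrization
    (f := fun x => (⟨(Θ (G x) (M x)).1, ∑ k : κ, x (Sum.inr k) • (A ^ (m k.1).1 *
      (Θ (G x) (M x)).1 ^ (m k.1).2)⟩ : MatrixPair F n).coords)
    (d := fun x => (monomialMatrix A p L (Θ (G x) (M x)).1).det)
    (hB'.coords (hB'.sum_smul_pow_mul_pow (fun k : κ => m k.1) fun k => .coord (Sum.inr k)))
    (hB'.monomialMatrix A p L).det ?_ ?_ ?_
  · rintro _ ⟨⟨B, C⟩, hP, rfl⟩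
    have hC := mem_adjoin_of_mem_D₂ hA hP
    obtain ⟨⟨hBA, -, -, hBn, hCn⟩, -⟩ := hP
    have hcomm := mem_matrixCentralizer_iff.1 hBA
    have := nontrivial_matrix_of_pos (F := F) hn
    obtain ⟨c, hc⟩ := exists_eq_sum_ne_of_isNilpotent (p := m) (F := F)
      (P := fun k => k ≠ (⟨0, hn⟩, ⟨0, hn⟩)) hcomm hA hBn
      (⟨0, hn⟩, ⟨0, hn⟩) (fun k => Iff.rfl) rfl hm hCn (mem_span_pow_mul_pow_of_mem_adjoin hcomm hA hBn hC)
    obtain ⟨x, hx, hxc⟩ := hsurj ⟨B, hBA⟩ (isNilpotent_centralizer_iff.1 hBn) c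
    refine ⟨x, ?_⟩
    simp only [hx, hxc]
    congr 2
    exact hc.symm
  · intro x hx
    exact ⟨_, mem_D₂_of_isNilpotent hA (hΘ _ _)
      (finrank_adjoin_eq_of_det_monomialMatrix_ne_zero hA (hΘ _ _) hx)
      (fun k : κ => hm k.1 k.2) (fun k => x (Sum.inr k)), rfl⟩
  · obtain ⟨x, hx, -⟩ := hsurj B₀ hB₀ 0
    exact ⟨x, by simp only [hx]; exact hδ⟩

end PairParametrization

/-! ### The dimension of the nilpotent cone and of D₂(A) -/

section NilpotentCone

variable {F : Type*} [Field F] {n : ℕ} {A : Matrix (Fin n) (Fin n) F} {t r : ℕ}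

/-- The product of the nilpotent cone of the centralizer, in coordinates, with an affine space. -/
def nilpotentConeProd (b : Module.Basis (Fin t ⊕ Fin r) F (matrixCentralizer A)) (κ : Type) :
    Set (Fin t ⊕ (Fin r ⊕ κ) → F) :=
  {y | IsNilpotent (b.equivFun.symm fun i => y (i.map id Sum.inl))}

theorem isPolynomialMap_centralizer_coordinates
    (b : Module.Basis (Fin t ⊕ Fin r) F (matrixCentralizer A)) (κ : Type) [Finite κ] :
    IsPolynomialMap fun y : Fin t ⊕ (Fin r ⊕ κ) → F =>
      b.equivFun.symm fun i => y (i.map id Sum.inl) :=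
  IsPolynomialMap.linearMap (b.equivFun.symm.toLinearMap ∘ₗ
    LinearMap.funLeft F F fun i : Fin t ⊕ Fin r => (i.map id Sum.inl : Fin t ⊕ (Fin r ⊕ κ)))

theorem exists_centralizer_coordinates_eq
    (b : Module.Basis (Fin t ⊕ Fin r) F (matrixCentralizer A)) {κ : Type}
    (B : matrixCentralizer A) (c : κ → F) : ∃ y : Fin t ⊕ (Fin r ⊕ κ) → F,
      b.equivFun.symm (fun i => y (i.map id Sum.inl)) = B ∧ ∀ k, y (Sum.inr (Sum.inr k)) = c k := by
  refine ⟨Sum.elim (fun i => b.equivFun B (Sum.inl i))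
    (Sum.elim (fun i => b.equivFun B (Sum.inr i)) c), ?_, fun k => rfl⟩
  rw [LinearEquiv.symm_apply_eq]
  ext (i | i) <;> rfl

/-- The cone is exactly the image of the parametrization Θ, so no open condition is needed and d = 1
serves. -/
theorem isPrime_vanishingIdeal_nilpotentConeProd [Infinite F] (hA : IsNilpotent A)
    (b : Module.Basis (Fin t ⊕ Fin r) F (matrixCentralizer A)) (κ : Type) [Finite κ] :
    (MvPolynomial.vanishingIdeal F (nilpotentConeProd b κ) :
      Ideal (MvPolynomial (Fin t ⊕ (Fin r ⊕ κ)) F)).IsPrime := by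
  obtain ⟨Θ, hΘ, hΘs, hΘp⟩ := exists_nilpotent_parametrization hA
  let τ := Fin t ⊕ Fin r
  let G : ((τ ⊕ τ) ⊕ κ → F) → matrixCentralizer A := fun x =>
    b.equivFun.symm fun i => x (Sum.inl (Sum.inl i))
  let M : ((τ ⊕ τ) ⊕ κ → F) → matrixCentralizer A := fun x =>
    b.equivFun.symm fun i => x (Sum.inl (Sum.inr i))
  have hG : IsPolynomialMap G := IsPolynomialMap.linearMap
    (b.equivFun.symm.toLinearMap ∘ₗ LinearMap.funLeft F F fun i : τ => Sum.inl (Sum.inl i))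
  have hM : IsPolynomialMap M := IsPolynomialMap.linearMap
    (b.equivFun.symm.toLinearMap ∘ₗ LinearMap.funLeft F F fun i : τ => Sum.inl (Sum.inr i))
  have hB : IsPolynomialMap fun x => Θ (G x) (M x) := hΘp G M hG hM
  have hinv : ∀ (B : matrixCentralizer A) (c : κ → F),
      b.equivFun.symm (fun i => (Sum.elim (fun i => b.coord (Sum.inl i) B)
        (Sum.elim (fun i => b.coord (Sum.inr i) B) c) : Fin t ⊕ (Fin r ⊕ κ) → F)
          (i.map id Sum.inl)) = B := by
    intro B c
    rw [LinearEquiv.symm_apply_eq]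
    ext (i | i) <;> rfl
  refine isPrime_vanishingIdeal_of_parametrization
    (f := fun x => Sum.elim (fun i => b.coord (Sum.inl i) (Θ (G x) (M x)))
      (Sum.elim (fun i => b.coord (Sum.inr i) (Θ (G x) (M x))) fun k => x (Sum.inr k)))
    (d := fun _ => 1) (IsPolynomialMap.pi ?_) (.const 1) ?_ ?_ ⟨0, one_ne_zero⟩
  · rintro (i | i | k)
    · exact hB.linear_comp (b.coord _)
    · exact hB.linear_comp (b.coord _)
    · exact .coord (Sum.inr k)
  · intro y hy
    obtain ⟨g, m, hgm⟩ := hΘs _ hy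
    refine ⟨Sum.elim (Sum.elim (b.equivFun g) (b.equivFun m)) fun k => y (Sum.inr (Sum.inr k)), ?_⟩
    have h1 : Θ (b.equivFun.symm (b.equivFun g)) (b.equivFun.symm (b.equivFun m)) =
        b.equivFun.symm fun i => y (i.map id Sum.inl) := by
      rw [LinearEquiv.symm_apply_apply, LinearEquiv.symm_apply_apply, hgm]
    have h2 : ∀ j, b.coord j (Θ (b.equivFun.symm (b.equivFun g)) (b.equivFun.symm (b.equivFun m))) =
        y (j.map id Sum.inl) := by
      intro j
      rw [h1]
      exact congrFun (b.equivFun.apply_symm_apply fun i => y (i.map id Sum.inl)) j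
    ext (i | i | k)
    · exact h2 (Sum.inl i)
    · exact h2 (Sum.inr i)
    · rfl
  · intro x _
    change IsNilpotent _
    rw [hinv]
    exact hΘ _ _

/-- The t diagonal coordinates are integral over the others, so the dimension is at most r + |κ|.
The t lower coefficients of the characteristic polynomial of β cut out the cone, so it is at least
that. -/
theorem exists_ringKrullDim_nilpotentConeProd [IsAlgClosed F] (hA : IsNilpotent A)
    (b : Module.Basis (Fin t ⊕ Fin r) F (matrixCentralizer A))
    (β : matrixCentralizer A →ₐ[F] Matrix (Fin t) (Fin t) F)
    (hβ : ∀ B, IsNilpotent (β B) ↔ IsNilpotent B)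
    (hb : ∀ i, β (b (Sum.inl i)) = Matrix.single i i 1) (κ : Type) [Fintype κ] :
    ringKrullDim (MvPolynomial (Fin t ⊕ (Fin r ⊕ κ)) F ⧸
      (MvPolynomial.vanishingIdeal F (nilpotentConeProd b κ) :
        Ideal (MvPolynomial (Fin t ⊕ (Fin r ⊕ κ)) F))) = (r + Fintype.card κ : ℕ) := by
  have hprime := isPrime_vanishingIdeal_nilpotentConeProd hA b κ
  obtain ⟨s, hs, -⟩ := exists_ringKrullDim_eq_and_trdeg_eq F
    (MvPolynomial (Fin t ⊕ (Fin r ⊕ κ)) F ⧸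
      (MvPolynomial.vanishingIdeal F (nilpotentConeProd b κ) :
        Ideal (MvPolynomial (Fin t ⊕ (Fin r ⊕ κ)) F)))
  -- The free coordinates indexed by κ enter the matrix with coefficient zero.
  have hupper := ringKrullDim_quotient_vanishingIdeal_le (nilpotentConeProd b κ)
    (Sum.elim (fun j => β (b (Sum.inr j))) 0) (fun y hy => by
      have h1 := (hβ _).2 hy
      convert h1 using 1
      rw [Module.Basis.equivFun_symm_apply, map_sum, Fintype.sum_sum_type, Fintype.sum_sum_type]
      congr 1
      · simp only [map_smul, hb, Sum.map_inl, id]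
        ext i j
        by_cases hij : i = j
        · subst hij
          simp [Matrix.sum_apply, Matrix.single_apply]
        · rw [Matrix.diagonal_apply_ne _ hij, Matrix.sum_apply]
          symm
          refine Finset.sum_eq_zero fun k _ => ?_
          rw [Matrix.smul_apply, Matrix.single_apply, if_neg, smul_zero]
          rintro ⟨rfl, h⟩
          exact hij h
      · simp)
  have hpoly : ∀ k : Fin t, ∃ q : MvPolynomial (Fin t ⊕ (Fin r ⊕ κ)) F, ∀ y,
      MvPolynomial.eval y q =
        (β (b.equivFun.symm fun i => y (i.map id Sum.inl))).charpoly.coeff k := fun k =>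
    mem_affinePolynomials.1
      (((isPolynomialMap_centralizer_coordinates b κ).linear_comp β.toLinearMap).charpoly_coeff k).mem
  choose q hq using hpoly
  -- The origin supplies the point of the cone that the lower bound requires.
  have hlower := card_le_ringKrullDim_quotient_vanishingIdeal_add q (nilpotentConeProd b κ)
    (fun y => by
      change IsNilpotent _ ↔ _
      rw [← hβ, Matrix.isNilpotent_iff_charpoly_coeff_eq_zero, Fintype.card_fin]
      simp only [hq]
      exact ⟨fun h k => h k k.2, fun h k hk => h ⟨k, hk⟩⟩) 0 (by
      change IsNilpotent _
      have : (fun i : Fin t ⊕ Fin r => (0 : Fin t ⊕ (Fin r ⊕ κ) → F) (i.map id Sum.inl)) = 0 := rfl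
      rw [this, map_zero]
      exact IsNilpotent.zero)
  rw [hs] at hupper hlower ⊢
  simp only [Fintype.card_sum, Fintype.card_fin] at hupper hlower
  norm_cast at hupper hlower ⊢
  omega

/-- The coordinate rings of the closure of `D₂ A` and of the product of the nilpotent cone of the
centralizer with an affine space of dimension `n - 1` have the same dimension. -/
theorem ringKrullDim_quotient_pairIdeal_D₂ [IsAlgClosed F] (hn : 1 ≤ n) (hA : IsNilpotent A)
    (b : Module.Basis (Fin t ⊕ Fin r) F (matrixCentralizer A)) :
    ∃ k₀ : Fin n, ringKrullDim
      (MvPolynomial ((Fin n × Fin n) ⊕ (Fin n × Fin n)) F ⧸ pairIdeal (D₂ A)) =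
      ringKrullDim (MvPolynomial (Fin t ⊕ (Fin r ⊕ {k // k ≠ k₀})) F ⧸
        (MvPolynomial.vanishingIdeal F (nilpotentConeProd b {k // k ≠ k₀}) :
          Ideal (MvPolynomial (Fin t ⊕ (Fin r ⊕ {k // k ≠ k₀})) F))) := by
  have hnt := nontrivial_matrix_of_pos (F := F) hn
  obtain ⟨p, k₀, L, hp₀, hp, B₀, hB₀, hδ⟩ := exists_det_monomialMatrix_ne_zero hn hA
  refine ⟨k₀, ?_⟩
  let κ := {k : Fin n // k ≠ k₀}
  have hY := isPrime_vanishingIdeal_nilpotentConeProd hA b κ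
  have hS : (MvPolynomial.vanishingIdeal F (MatrixPair.coords '' D₂ A) :
    Ideal (MvPolynomial ((Fin n × Fin n) ⊕ (Fin n × Fin n)) F)).IsPrime := isPrime_pairIdeal_D₂ hn hA
  let Bv : (Fin t ⊕ (Fin r ⊕ κ) → F) → matrixCentralizer A := fun y =>
    b.equivFun.symm fun i => y (i.map id Sum.inl)
  have hBv : IsPolynomialMap fun y => (Bv y).1 :=
    (isPolynomialMap_centralizer_coordinates b κ).linear_comp (matrixCentralizer A).val.toLinearMap
  let Cv : (Fin t ⊕ (Fin r ⊕ κ) → F) → Matrix (Fin n) (Fin n) F := fun y =>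
    ∑ k : κ, y (Sum.inr (Sum.inr k)) • (A ^ (p k.1).1 * (Bv y).1 ^ (p k.1).2)
  have hCv : IsPolynomialMap Cv :=
    hBv.sum_smul_pow_mul_pow (fun k : κ => p k.1) fun k => .coord (Sum.inr (Sum.inr k))
  let ψ : (Fin t ⊕ (Fin r ⊕ κ) → F) → (Fin n × Fin n) ⊕ (Fin n × Fin n) → F := fun y =>
    (⟨(Bv y).1, Cv y⟩ : MatrixPair F n).coords
  have hψ : IsPolynomialMap ψ := hBv.coords hCv
  let fB : ((Fin n × Fin n) ⊕ (Fin n × Fin n) → F) → Matrix (Fin n) (Fin n) F := fun x =>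
    Matrix.of fun i j => x (Sum.inl (i, j))
  let fC : ((Fin n × Fin n) ⊕ (Fin n × Fin n) → F) → Matrix (Fin n) (Fin n) F := fun x =>
    Matrix.of fun i j => x (Sum.inr (i, j))
  have hfB : IsPolynomialMap fB := .of_matrix fun i j => .coord (Sum.inl (i, j))
  have hfC : IsPolynomialMap fC := .of_matrix fun i j => .coord (Sum.inr (i, j))
  obtain ⟨δ, hδp⟩ := mem_affinePolynomials.1 (hfB.monomialMatrix A p L).det.mem
  have hδψ : ∀ y, MvPolynomial.eval (ψ y) δ = (monomialMatrix A p L (Bv y).1).det := fun y =>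
    hδp (ψ y)
  have hψS : ∀ y ∈ nilpotentConeProd b κ, MvPolynomial.eval (ψ y) δ ≠ 0 →
      ψ y ∈ MatrixPair.coords '' D₂ A := by
    intro y hy hδy
    rw [hδψ] at hδy
    exact ⟨_, mem_D₂_of_isNilpotent hA hy
      (finrank_adjoin_eq_of_det_monomialMatrix_ne_zero hA hy hδy)
      (fun k : κ => hp k.1 k.2) (fun k => y (Sum.inr (Sum.inr k))), rfl⟩
  obtain ⟨y₀, hy₀, -⟩ := exists_centralizer_coordinates_eq b B₀ (0 : κ → F)
  have hy₀Y : y₀ ∈ nilpotentConeProd b κ := by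
    change IsNilpotent _
    rwa [hy₀]
  have hδy₀ : MvPolynomial.eval (ψ y₀) δ ≠ 0 := by
    rw [hδψ]
    change (monomialMatrix A p L (b.equivFun.symm fun i => y₀ (i.map id Sum.inl)).1).det ≠ 0
    rwa [hy₀]
  have hδS : δ ∉ (MvPolynomial.vanishingIdeal F (MatrixPair.coords '' D₂ A) :
      Ideal (MvPolynomial ((Fin n × Fin n) ⊕ (Fin n × Fin n)) F)) := fun h =>
    hδy₀ (mem_vanishingIdeal_iff_eval.1 h _ (hψS y₀ hy₀Y hδy₀))
  obtain ⟨φ, hφ⟩ := hψ.exists_eval_comp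
  refine ringKrullDim_quotient_vanishingIdeal_eq (Y := nilpotentConeProd b κ)
    (S := MatrixPair.coords '' D₂ A) hψ (fun q => ⟨fun hq => ?_, fun hq => ?_⟩) ?_
  -- Where δ ≠ 0 the map ψ lands in D₂(A); as the ideal of the cone product is prime, the factor δ
  -- can be cancelled.
  · have h1 : φ δ * φ q ∈ (MvPolynomial.vanishingIdeal F (nilpotentConeProd b κ) :
        Ideal (MvPolynomial (Fin t ⊕ (Fin r ⊕ κ)) F)) := by
      rw [mem_vanishingIdeal_iff_eval]
      intro y hy
      rw [map_mul, hφ, hφ]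
      by_cases hδy : MvPolynomial.eval (ψ y) δ = 0
      · rw [hδy, zero_mul]
      · rw [mem_vanishingIdeal_iff_eval.1 hq _ (hψS y hy hδy), mul_zero]
    have h2 := (hY.mem_or_mem h1).resolve_left fun h => hδy₀ (by
      rw [← hφ]
      exact mem_vanishingIdeal_iff_eval.1 h y₀ hy₀Y)
    intro y hy
    rw [← hφ]
    exact mem_vanishingIdeal_iff_eval.1 h2 y hy
  -- Conversely, every pair of D₂(A) with δ ≠ 0 is a value of ψ, and primality of the ideal of D₂(A)
  -- cancels δ again.
  · refine (hS.mem_or_mem (x := δ) (y := q) ?_).resolve_left hδS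
    rw [mem_vanishingIdeal_iff_eval]
    rintro _ ⟨⟨B, C⟩, hP, rfl⟩
    rw [map_mul]
    by_cases hδP : MvPolynomial.eval (MatrixPair.coords ⟨B, C⟩) δ = 0
    · rw [hδP, zero_mul]
    · have hC := mem_adjoin_of_mem_D₂ hA hP
      obtain ⟨⟨hBA, -, -, hBn, hCn⟩, -⟩ := hP
      have hcomm := mem_matrixCentralizer_iff.1 hBA
      have hδB : (monomialMatrix A p L B).det ≠ 0 := by
        rw [hδp] at hδP
        exact hδP
      have hspan := (span_pow_mul_pow_eq_adjoin hcomm hA hBn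
        (linearIndependent_of_det_monomialMatrix_ne_zero hδB)).1
      obtain ⟨c, hc⟩ := exists_eq_sum_ne_of_isNilpotent (p := p) (F := F)
        (P := fun k => k ≠ k₀) hcomm hA hBn k₀ (fun k => Iff.rfl) hp₀ hp hCn
        (hspan.ge hC)
      obtain ⟨y, hyB, hyc⟩ := exists_centralizer_coordinates_eq b ⟨B, hBA⟩ c
      have hyψ : ψ y = MatrixPair.coords ⟨B, C⟩ := by
        simp only [ψ, Cv, Bv, hyB, hyc]
        congr 2
        exact hc.symm
      rw [← hyψ, hq y, mul_zero]
      change IsNilpotent _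
      rw [hyB]
      exact isNilpotent_centralizer_iff.1 hBn
  -- Coordinates on the centralizer extend to linear functionals of the entries of B, so they need
  -- no denominator.
  · have hcoordB : ∀ j : Fin t ⊕ Fin r, ∃ e : MvPolynomial ((Fin n × Fin n) ⊕ (Fin n × Fin n)) F,
        ∀ y, MvPolynomial.eval (ψ y) e = y (j.map id Sum.inl) := by
      intro j
      obtain ⟨l, hl⟩ := LinearMap.exists_extend (K := F) (V := Matrix (Fin n) (Fin n) F) (V' := F)
        (p := Subalgebra.toSubmodule (matrixCentralizer A)) (b.coord j)
      obtain ⟨e, he⟩ := mem_affinePolynomials.1 (hfB l)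
      refine ⟨e, fun y => ?_⟩
      rw [he]
      change l (Bv y).1 = _
      have h1 := LinearMap.congr_fun hl (Bv y)
      refine h1.trans ?_
      exact congrFun (b.equivFun.apply_symm_apply fun i => y (i.map id Sum.inl)) j
    have hone : (1 : MvPolynomial ((Fin n × Fin n) ⊕ (Fin n × Fin n)) F) ∉
        (MvPolynomial.vanishingIdeal F (MatrixPair.coords '' D₂ A) :
          Ideal (MvPolynomial ((Fin n × Fin n) ⊕ (Fin n × Fin n)) F)) := fun h =>
      hS.ne_top ((Ideal.eq_top_iff_one _).2 h)
    rintro (i | i | k)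
    · obtain ⟨e, he⟩ := hcoordB (Sum.inl i)
      exact ⟨1, e, hone, fun y => by rw [he, map_one, one_mul]; rfl⟩
    · obtain ⟨e, he⟩ := hcoordB (Sum.inr i)
      exact ⟨1, e, hone, fun y => by rw [he, map_one, one_mul]; rfl⟩
    -- The coefficients of C are recovered by Cramer's rule with denominator δ.
    · have hdet : IsPolynomialMap fun x =>
          ((monomialMatrix A p L (fB x)).adjugate.mulVec (L (fC x))) k.1 := by
        have h1 : ∀ l, IsPolynomialMap fun x => (monomialMatrix A p L (fB x)).adjugate k.1 l := by
          intro l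
          simp only [Matrix.adjugate_apply]
          refine IsPolynomialMap.det (.of_matrix fun i j => ?_)
          by_cases hi : i = l
          · subst hi
            simp only [Matrix.updateRow_self]
            exact .const _
          · simp only [Matrix.updateRow_ne hi]
            exact (hfB.monomialMatrix A p L).linear_comp (Matrix.entryLinearMap F F i j)
        simp only [Matrix.mulVec, dotProduct]
        exact .sum _ fun l _ => (h1 l).mul (hfC.linear_comp (LinearMap.proj l ∘ₗ L))
      obtain ⟨e, he⟩ := mem_affinePolynomials.1 hdet.mem
      refine ⟨δ, e, hδS, fun y => ?_⟩
      rw [he, hδψ]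
      change ((monomialMatrix A p L (Bv y).1).adjugate.mulVec (L (Cv y))) k.1 = _
      classical
      -- The omitted monomial is restored with coefficient 0, to apply Cramer's rule to all n
      -- monomials.
      have h2 : Cv y = ∑ k : Fin n, (if hk : k ≠ k₀ then y (Sum.inr (Sum.inr ⟨k, hk⟩)) else 0) •
          (A ^ (p k).1 * (Bv y).1 ^ (p k).2) := by
        rw [← Finset.add_sum_erase _ _ (Finset.mem_univ k₀), dif_neg (not_not.2 rfl), zero_smul,
          zero_add]
        rw [Finset.sum_subtype (p := fun k => k ≠ k₀) _ (fun k => by simp)]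
        refine Finset.sum_congr rfl fun k _ => ?_
        rw [dif_pos k.2]
      rw [h2, adjugate_monomialMatrix_mulVec, Pi.smul_apply, dif_pos k.2, smul_eq_mul]

end NilpotentCone

/-! ### Irreducibility and dimension of the closure of D₂(A) -/

theorem mainTheorem12 {F : Type*} [Field F] [IsAlgClosed F] (n : ℕ) (hn : 1 ≤ n)
    (A : Matrix (Fin n) (Fin n) F) (hA : IsNilpotent A) :
    IsIrreducible (closure (D₂ A)) ∧
      ∃ d : ℕ, topologicalKrullDim (closure (D₂ A)) = d ∧
        (d : ℤ) = Module.finrank F (matrixCentralizer A)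
          - Module.finrank F (LinearMap.ker (Matrix.toLin' A)) + n - 1 := by
  refine ⟨(isIrreducible_of_isPrime_pairIdeal (isPrime_pairIdeal_D₂ hn hA)).closure, ?_⟩
  obtain ⟨t, r, b, β, ht, hβ, hb⟩ := exists_centralizer_basis hA
  obtain ⟨k₀, hk₀⟩ := ringKrullDim_quotient_pairIdeal_D₂ hn hA b
  -- Here r = dim C(A) - dim ker A, and the index set, with k₀ removed, has n - 1 elements.
  refine ⟨r + Fintype.card {k : Fin n // k ≠ k₀}, ?_, ?_⟩
  · rw [topologicalKrullDim_closure_eq_ringKrullDim, hk₀,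
      exists_ringKrullDim_nilpotentConeProd hA b β hβ hb]
  · rw [← ht, Module.finrank_eq_card_basis b, Fintype.card_sum, Fintype.card_fin, Fintype.card_fin,
      Fintype.card_subtype_compl, Fintype.card_fin, Fintype.card_subtype_eq]
    omega
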